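/- **Setting.** Let $(I,\mathbb A,m)$ be a probability space and write $|A|=m(A)$. A *grid* is a sequence $\mathcal G=(\mathcal G^k)_{k\ge0}$ of finite families of measurable sets of positive measure, not all empty, such that $\sup_k\sup_{Q\in\mathcal G^k}\#\{P\in\mathcal G^k: P\cap Q\ne\emptyset\}<\infty$; its sets are called cells. It is a *$(c_1,c_2)$-good grid* ($0<c_1<c_2<1$) if $\mathcal G^0=\{I\}$; for each $k$ the cells of $\mathcal G^k$ are pairwise disjoint and cover $I$ up to a null set; each $Q\in\mathcal G^{k+1}$ is contained in some $P\in\mathcal G^{k}$; $c_1\le |Q|/|P|\le c_2$ whenever $Q\subset P$, $Q\in\mathcal G^{k+1}$, $P\in\mathcal G^k$; and the cells generate $\mathbb A$. Let $k_0(\Omega,\mathcal G)=\min\{k:\exists P\in\mathcal G^k,\ P\subset\Omega\}$. Fix a good grid $\mathcal P$ of $I$, $p\in[1,\infty)$, $q\in[1,\infty]$, $\gamma\in(0,1]$ and $s,\beta,\epsilon,\delta>0$ with $s+\epsilon\le 1/p$, $s<\beta<1/p$, $\delta<\max\{s,\epsilon\}$, and put $t_0=p/(1-sp+\delta p)$.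 **Spaces.** Put $a_Q=|Q|^{s-1/p}1_Q$. For a grid $\mathcal G$, a $\mathcal B^s_{p,q}(\mathcal G)$-representation of $f\in L^p$ is a series $f=\sum_k\sum_{Q\in\mathcal G^k}d_Qa_Q$ with $d_Q\in\mathbb C$, absolutely convergent in $L^p$ (that is, $\sum_k|\sum_{Q\in\mathcal G^k}d_Qa_Q|_p<\infty$), with $\|d\|_{\mathcal G}:=\big(\sum_k(\sum_{Q\in\mathcal G^k}|d_Q|^p)^{q/p}\big)^{1/q}<\infty$ (usual change if $q=\infty$). $\mathcal B^s_{p,q}$ is the space of all $f$ that have a $\mathcal B^s_{p,q}(\mathcal P)$-representation, normed by $|f|_{\mathcal B^s_{p,q}}=\inf\|d\|_{\mathcal P}$. $\mathcal B^\beta_{p,q}(W)$, with its norm, is defined likewise with exponent $\beta$, using only representations whose coefficients vanish at cells not contained in $W$. A *Besov atom* on $Q$ is a $b_Q$ with $|b_Q|_{\mathcal B^\beta_{p,q}(Q)}\le|Q|^{s-\beta}$. *Constants of the grid.* A *canonical family* with constant $C_{GC}\ge1$ consists of functionals $f\mapsto k_P^f$ in $(L^1)^*$, $P\in\mathcal P$,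 such that for every $f\in\mathcal B^s_{p,q}$ the series $\sum_Pk_P^fa_P$ is a $\mathcal B^s_{p,q}(\mathcal P)$-representation of $f$ with $\|k^f\|_{\mathcal P}\le C_{GC}|f|_{\mathcal B^s_{p,q}}$. A *conversion constant* is a $C_{GBS}\ge0$ such that every $f=\sum_Qd_Qb_Q$ (absolutely convergent in $L^p$ in the above sense, with Besov atoms $b_Q$ on $Q$ and $\|d\|_{\mathcal P}<\infty$) has a $\mathcal B^s_{p,q}(\mathcal P)$-representation $\sum_Qz_Qa_Q$ with $\|z\|_{\mathcal P}\le C_{GBS}\|d\|_{\mathcal P}$. **Dynamics.** Let $\Lambda\subset\mathbb N$ and, for $r\in\Lambda$, let $I_r,J_r\subset I$ be measurable, $h_r:J_r\to I_r$ a bijection, measurable with measurable inverse, $g_r:J_r\to\mathbb C$ measurable, $\mathcal G_r$ a grid of subsets of $I_r$, $a_r\in\mathbb R$, $|\epsilon_r|=\epsilon$, and $D_1^r,\lambda_1^r,D_2^r,\lambda_2^r,D_3^r>0$, such that: 1. the cells of each $\mathcal G_r^k$ are pairwise disjoint, and $k_0(Q,\mathcal G_r)=k$ for $Q\in\mathcal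 G_r^k$; 2. for measurable $Q\subset I_r$: $m(Q)=0$ iff $m(h_r^{-1}(Q))=0$; 3. for each cell $Q$ of $\mathcal G_r$, with $\Omega=h_r^{-1}(Q)$ and $\kappa=k_0(\Omega,\mathcal P)$, there are $\mathcal F^k\subset\mathcal P^k$, $k\ge \kappa$, with $\Omega=\bigcup_{k\ge \kappa}\bigcup_{W\in\mathcal F^k}W$, distinct members of $\bigcup_k\mathcal F^k$ being disjoint, and $\sum_{W\in\mathcal F^k}|W|^{1-sp}\le D_1^r(\lambda_1^r)^{k-\kappa}|\Omega|^{1-sp}$; 4. with $n=|k_0(Q,\mathcal G_r)-k_0(h_r^{-1}(Q),\mathcal P)|$, for each cell $Q$ of $\mathcal G_r$: $n\ge a_r$ and $(|Q|/|h_r^{-1}(Q)|)^{\epsilon_r/|\epsilon_r|}\le D_2^r(\lambda_2^r)^{n}$; 5. up to null sets, $I_r$ and each $h_r^{-1}(W)$, $W\in\mathcal G_r$, are countable unions of cells of $\mathcal P$; 6. $|g_r1_W|_{\mathcal B^\beta_{p,q}(W)}\le D_3^r\big(|Q|/|h_r^{-1}(Q)|\big)^{1/p-s+\epsilon_r}|W|^{1/p-\beta}$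 for all cells $W$ of $\mathcal P$ and $Q$ of $\mathcal G_r$ with $W\subset h_r^{-1}(Q)$; 7. the cells of all $\mathcal G_r$, together with the cells of $\mathcal P$ that meet no $I_r$, generate $\mathbb A$; 8. $\lambda^r:=\max\{(\lambda_2^r)^{\epsilon},(\lambda_1^r)^{1/p}\}<1$ for every $r$ and $\lambda:=\sup_r\lambda^r<1$. Put $\Theta_r=(D_2^r)^{\epsilon}D_3^r(D_1^r)^{1/p}(\lambda^r)^{a_r(1-\gamma)}$, $D=\frac{2}{1-\lambda^\gamma}$, $\Phi_rf=g_r\cdot(f\circ h_r)$ on $J_r$ and $0$ elsewhere, $\Phi f=\sum_r\Phi_rf$, and assume that for some $C\ge0$, $|\Phi f|_1\le\sum_r|\Phi_rf|_{1}\le C|f|_{t_0}$ for all $f\in L^{t_0}$. **Slicing.** Let $N=\sup_{W\in\mathcal P}\#\{r:W\subset J_r\}$ and $1/p+1/p'=1$ (with $N^{1/\infty}=1$ even if $N=\infty$). A series $\sum_{Q\in\mathcal P}d_Qa_Q$ has a *$C$-regular slicing*, $C\ge0$, if it is a $\mathcal B^s_{p,q}(\mathcal P)$-representation of some $f$ and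 for each $r$ there is a $\mathcal B^s_{p,q}(\mathcal G_r)$-representation $f1_{I_r}=\sum_{Q\in\mathcal G_r}c^r_Qa_Q$ such that either $$\Big(\sum_j\big(\sum_r\Theta_r(\sum_{Q\in\mathcal G_r^j}|c^r_Q|^p)^{1/p}\big)^q\Big)^{1/q}\le C\|d\|_{\mathcal P}\quad\text{or}\quad N^{1/p'}\Big(\sum_j\big(\sum_r\Theta_r^p\sum_{Q\in\mathcal G_r^j}|c^r_Q|^p\big)^{q/p}\Big)^{1/q}\le C\|d\|_{\mathcal P},$$ and, if all $d_Q\ge0$, with all $c^r_Q\ge0$. Suppose that $\mathcal B^s_{p,q}$ has a *$(C_{FR},C_{ES})$-essential slicing*: $C_{FR},C_{ES}\ge0$ and there is a finite set $\mathcal P'$ of cells of $\mathcal P$ such that for every $\mathcal B^s_{p,q}(\mathcal P)$-representation $\sum_Qd_Qa_Q$ of an $f\in\mathcal B^s_{p,q}$, $\sum_{Q\notin\mathcal P'}d_Qa_Q$ has a $C_{ES}$-regular slicing and $\sum_{Q\in\mathcal P'}d_Qa_Q$ has a $C_{FR}$-regular slicing. **Corollary (Boundedness and essential spectral radius of $\Phi$).**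 For the good grid $\mathcal P$ and the exponents there exist a canonical family and a conversion constant. For every canonical family $(k_P)$ with constant $C_{GC}$, every conversion constant $C_{GBS}$, and all dynamics as above with an essential slicing realized by $\mathcal P'$: for $f\in\mathcal B^s_{p,q}$ the series $\sum_r\Phi_rf$ converges absolutely almost everywhere, $\Phi$ is a bounded linear operator of $\mathcal B^s_{p,q}$, and $$|\Phi|_{\mathcal B^s_{p,q}}\le C_{GBS}\,D\,(C_{FR}+C_{ES})\,C_{GC}.$$ Its essential spectral radius, i.e. $\sup\{|z|: z-\Phi\text{ is not Fredholm}\}$ (with $\sup\emptyset=0$), is at most $C_{GBS}\,D\,C_{ES}\,C_{GC}$. Indeed, for $\mathcal R\subset\mathcal P$ let $\pi_{\mathcal R}f=\sum_{P\in\mathcal R}k_P^fa_P$. For $\mathcal R=\mathcal P'$ and $\mathcal R=\mathcal P\setminus\mathcal P'$ this series is a $\mathcal B^s_{p,q}(\mathcal P)$-representation and $\pi_{\mathcal R}$ is a bounded linear operator of $\mathcal B^s_{p,q}$, $\pi_{\mathcal P'}+\pi_{\mathcal P\setminus\mathcal P'}=\mathrm{id}$, the operator $\Phi\circ\pi_{\mathcal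 P'}$ has finite rank and norm at most $C_{GBS}\,D\,C_{FR}\,C_{GC}$, and $\Phi\circ\pi_{\mathcal P\setminus\mathcal P'}$ has norm at most $C_{GBS}\,D\,C_{ES}\,C_{GC}$. -/

import Mathlib

open MeasureTheory Filter Topology
open scoped ENNReal

noncomputable section

namespace BesovTransfer

/-! ## Grids -/

/-- A grid: a sequence of finite families of measurable sets of positive measure, not all of them
empty, with uniformly bounded multiplicity inside each family. -/
structure Grid {I : Type*} [MeasurableSpace I] (m : Measure I) where
  level : ℕ → Finset (Set I)
  measurableSet : ∀ k, ∀ Q ∈ level k, MeasurableSet Q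
  pos : ∀ k, ∀ Q ∈ level k, 0 < m Q
  nonempty : ∃ k, (level k).Nonempty
  bounded_multiplicity : ∃ M : ℕ, ∀ k, ∀ Q ∈ level k,
    {P : Set I | P ∈ level k ∧ (P ∩ Q).Nonempty}.ncard ≤ M

namespace Grid

variable {I : Type*} [MeasurableSpace I] {m : Measure I}

/-- The union of all families of the grid. -/
def cells (P : Grid m) : Set (Set I) := {Q | ∃ k, Q ∈ P.level k}

/-- `k₀(Ω, P)`: the first level at which some cell is contained in `Ω`. -/
def k0 (P : Grid m) (Ω : Set I) : ℕ := sInf {k | ∃ Q ∈ P.level k, Q ⊆ Ω}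

/-- The cells of a common level are pairwise disjoint. -/
def DisjointLevels (P : Grid m) : Prop :=
  ∀ k, ∀ Q ∈ P.level k, ∀ R ∈ P.level k, Q ≠ R → Disjoint Q R

/-- A `(c₁, c₂)`-good grid. -/
structure IsGood (P : Grid m) (c₁ c₂ : ℝ) : Prop where
  c₁_pos : 0 < c₁
  c₁_lt_c₂ : c₁ < c₂
  c₂_lt_one : c₂ < 1
  level_zero : P.level 0 = {Set.univ}
  covers : ∀ k, ∀ᵐ x ∂m, ∃ Q ∈ P.level k, x ∈ Q
  disjoint : P.DisjointLevels
  nested : ∀ k, ∀ Q ∈ P.level (k + 1), ∃ R ∈ P.level k, Q ⊆ R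
  ratio : ∀ k, ∀ Q ∈ P.level (k + 1), ∀ R ∈ P.level k, Q ⊆ R →
    c₁ ≤ m.real Q / m.real R ∧ m.real Q / m.real R ≤ c₂
  generates : MeasurableSpace.generateFrom P.cells = ‹MeasurableSpace I›

end Grid

/-! ## Besov spaces -/

/-- The (possibly infinite) `ℓ^q` norm of a sequence, `1 ≤ q ≤ ∞`. -/
def lqNorm (q : ℝ≥0∞) (u : ℕ → ℝ≥0∞) : ℝ≥0∞ :=
  if q = ∞ then ⨆ k, u k else (∑' k, u k ^ q.toReal) ^ (1 / q.toReal)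

section Besov

variable {I : Type*} [MeasurableSpace I] {m : Measure I}

/-- `(∑_{Q ∈ P^k} |c_Q|^p)^{1/p}`. -/
def levelNorm (P : Grid m) (p : ℝ) (c : Set I → ℂ) (k : ℕ) : ℝ≥0∞ :=
  (∑ Q ∈ P.level k, ‖c Q‖ₑ ^ p) ^ (1 / p)

/-- `(∑_k (∑_{Q ∈ P^k} |c_Q|^p)^{q/p})^{1/q}`, with the usual change for `q = ∞`. -/
def coefNorm (P : Grid m) (p : ℝ) (q : ℝ≥0∞) (c : Set I → ℂ) : ℝ≥0∞ :=
  lqNorm q (levelNorm P p c)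

/-- The `k`-th block `∑_{Q ∈ P^k} c_Q b_Q`. -/
def levelSum (P : Grid m) (b : Set I → I → ℂ) (c : Set I → ℂ) (k : ℕ) (x : I) : ℂ :=
  ∑ Q ∈ P.level k, c Q * b Q x

/-- `f = ∑_k ∑_{Q ∈ P^k} c_Q b_Q` with absolute convergence in `L^p` and finite coefficient
norm. -/
structure IsAtomicRep (P : Grid m) (p : ℝ) (q : ℝ≥0∞) (b : Set I → I → ℂ)
    (c : Set I → ℂ) (f : I → ℂ) : Prop where
  memLp : MemLp f (ENNReal.ofReal p) m
  coef_lt_top : coefNorm P p q c < ∞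
  abs_conv : ∑' k, eLpNorm (levelSum P b c k) (ENNReal.ofReal p) m < ∞
  tendsto : Tendsto
    (fun n => eLpNorm (fun x => f x - ∑ k ∈ Finset.range n, levelSum P b c k x)
      (ENNReal.ofReal p) m) atTop (𝓝 0)

/-- The canonical Souza atom: `|Q|^{s - 1/p}` on `Q` and `0` elsewhere. -/
def souzaAtom (m : Measure I) (p s : ℝ) (Q : Set I) : I → ℂ :=
  Q.indicator fun _ => ((m.real Q ^ (s - 1 / p) : ℝ) : ℂ)

/-- `f = ∑_Q c_Q a_Q` is a `B^s_{p,q}`-representation of `f`. -/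
def IsRep (P : Grid m) (p : ℝ) (q : ℝ≥0∞) (s : ℝ) (c : Set I → ℂ) (f : I → ℂ) : Prop :=
  IsAtomicRep P p q (souzaAtom m p s) c f

/-- Membership in `B^s_{p,q}`. -/
def MemBesov (P : Grid m) (p : ℝ) (q : ℝ≥0∞) (s : ℝ) (f : I → ℂ) : Prop :=
  ∃ c, IsRep P p q s c f

/-- The norm of `B^s_{p,q}`; it is `∞` exactly outside the space. -/
def besovNorm (P : Grid m) (p : ℝ) (q : ℝ≥0∞) (s : ℝ) (f : I → ℂ) : ℝ≥0∞ :=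
  ⨅ (c : Set I → ℂ) (_ : IsRep P p q s c f), coefNorm P p q c

/-- The norm of `B^s_{p,q}(W)`, where only representations are used whose coefficients vanish at
all cells not contained in `W`; it is `∞` exactly outside the space. -/
def besovNormOn (P : Grid m) (p : ℝ) (q : ℝ≥0∞) (s : ℝ) (W : Set I) (f : I → ℂ) : ℝ≥0∞ :=
  ⨅ (c : Set I → ℂ) (_ : IsRep P p q s c f ∧ ∀ Q ∈ P.cells, ¬ Q ⊆ W → c Q = 0), coefNorm P p q c

/-- An `(s, β, p, q)`-Besov atom supported on `Q`, normalized so that the Souza atom on `Q` is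
one. -/
def IsBesovAtom (P : Grid m) (p : ℝ) (q : ℝ≥0∞) (s β : ℝ) (Q : Set I) (b : I → ℂ) : Prop :=
  besovNormOn P p q β Q b ≤ ENNReal.ofReal (m.real Q ^ (s - β))

/-- `C` controls the conversion of representations by Besov atoms into representations by Souza
atoms. -/
def IsConversionConstant (P : Grid m) (p : ℝ) (q : ℝ≥0∞) (s β : ℝ) (C : ℝ) : Prop :=
  0 ≤ C ∧ ∀ (d : Set I → ℂ) (b : Set I → I → ℂ) (f : I → ℂ),
    (∀ Q ∈ P.cells, IsBesovAtom P p q s β Q (b Q)) → IsAtomicRep P p q b d f →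
      ∃ z, IsRep P p q s z f ∧ coefNorm P p q z ≤ ENNReal.ofReal C * coefNorm P p q d

/-- The bounded functionals `κ Q` on `L¹` give a representation of each `f ∈ B^s_{p,q}` that is
optimal up to the factor `C`. -/
def IsCanonicalFamily (P : Grid m) (p : ℝ) (q : ℝ≥0∞) (s : ℝ)
    (κ : Set I → Lp ℂ 1 m →L[ℂ] ℂ) (C : ℝ) : Prop :=
  1 ≤ C ∧ ∀ f : Lp ℂ 1 m, MemBesov P p q s f →
    IsRep P p q s (fun Q => κ Q f) f ∧
      coefNorm P p q (fun Q => κ Q f) ≤ ENNReal.ofReal C * besovNorm P p q s f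

theorem lqNorm_mono {q : ℝ≥0∞} {u v : ℕ → ℝ≥0∞} (h : ∀ k, u k ≤ v k) :
    lqNorm q u ≤ lqNorm q v := by
  unfold lqNorm
  split_ifs
  · exact iSup_mono h
  · refine ENNReal.rpow_le_rpow (ENNReal.tsum_le_tsum fun k => ?_) (by positivity)
    exact ENNReal.rpow_le_rpow (h k) (by positivity)

theorem one_le_toReal {q : ℝ≥0∞} (hq : 1 ≤ q) (h : q ≠ ∞) : 1 ≤ q.toReal := by
  simpa using (ENNReal.toReal_le_toReal ENNReal.one_ne_top h).2 hq

theorem lqNorm_add_le {q : ℝ≥0∞} (hq : 1 ≤ q) (u v : ℕ → ℝ≥0∞) :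
    lqNorm q (u + v) ≤ lqNorm q u + lqNorm q v := by
  unfold lqNorm
  split_ifs with h
  · exact iSup_le fun k => add_le_add (le_iSup u k) (le_iSup v k)
  · have := ENNReal.lintegral_Lp_add_le (μ := Measure.count) (measurable_of_countable u).aemeasurable
      (measurable_of_countable v).aemeasurable (one_le_toReal hq h)
    simpa [lintegral_count] using this

theorem lqNorm_const_mul {q : ℝ≥0∞} (hq : 1 ≤ q) (a : ℝ≥0∞) (u : ℕ → ℝ≥0∞) :
    lqNorm q (fun k => a * u k) = a * lqNorm q u := by
  unfold lqNorm
  split_ifs with h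
  · rw [ENNReal.mul_iSup]
  · have hq1 := one_le_toReal hq h
    simp_rw [ENNReal.mul_rpow_of_nonneg _ _ (show (0 : ℝ) ≤ q.toReal by positivity)]
    rw [ENNReal.tsum_mul_left, ENNReal.mul_rpow_of_nonneg _ _ (by positivity), ← ENNReal.rpow_mul,
      mul_one_div_cancel (by positivity), ENNReal.rpow_one]

theorem le_lqNorm {q : ℝ≥0∞} (hq : 1 ≤ q) (u : ℕ → ℝ≥0∞) (k : ℕ) : u k ≤ lqNorm q u := by
  unfold lqNorm
  split_ifs with h
  · exact le_iSup u k
  · have hq1 := one_le_toReal hq h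
    calc u k = (u k ^ q.toReal) ^ (1 / q.toReal) := by
          rw [← ENNReal.rpow_mul, mul_one_div_cancel (by positivity), ENNReal.rpow_one]
      _ ≤ _ := ENNReal.rpow_le_rpow (ENNReal.le_tsum k) (by positivity)

theorem coefNorm_add_le (P : Grid m) {p : ℝ} {q : ℝ≥0∞} (hp : 1 ≤ p) (hq : 1 ≤ q)
    (c d : Set I → ℂ) : coefNorm P p q (c + d) ≤ coefNorm P p q c + coefNorm P p q d := by
  refine (lqNorm_mono fun k => ?_).trans (lqNorm_add_le hq _ _)
  refine le_trans ?_ (ENNReal.Lp_add_le _ _ _ hp)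
  unfold levelNorm
  gcongr with Q
  exact enorm_add_le _ _

theorem coefNorm_smul (P : Grid m) {p : ℝ} {q : ℝ≥0∞} (hp : 1 ≤ p) (hq : 1 ≤ q)
    (a : ℂ) (c : Set I → ℂ) : coefNorm P p q (a • c) = ‖a‖ₑ * coefNorm P p q c := by
  have hp0 : 0 < p := by linarith
  unfold coefNorm
  rw [← lqNorm_const_mul hq]
  congr 1
  ext k
  simp only [levelNorm, Pi.smul_apply, smul_eq_mul, enorm_mul]
  simp_rw [ENNReal.mul_rpow_of_nonneg _ _ hp0.le]
  rw [← Finset.mul_sum, ENNReal.mul_rpow_of_nonneg _ _ (by positivity), ← ENNReal.rpow_mul,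
    mul_one_div_cancel hp0.ne', ENNReal.rpow_one]

theorem coefNorm_zero (P : Grid m) {p : ℝ} {q : ℝ≥0∞} (hp : 1 ≤ p) (hq : 1 ≤ q) :
    coefNorm P p q 0 = 0 := by
  have := coefNorm_smul P hp hq 0 0
  simpa using this

theorem aestronglyMeasurable_levelSum_souzaAtom (P : Grid m) (p s : ℝ) (c : Set I → ℂ) (k : ℕ) :
    AEStronglyMeasurable (levelSum P (souzaAtom m p s) c k) m := by
  unfold levelSum
  refine Finset.aestronglyMeasurable_fun_sum _ fun Q hQ => ?_
  refine AEStronglyMeasurable.const_mul ?_ _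
  exact aestronglyMeasurable_const.indicator (P.measurableSet k Q hQ)

theorem levelSum_add (P : Grid m) (b : Set I → I → ℂ) (c d : Set I → ℂ) (k : ℕ) (x : I) :
    levelSum P b (c + d) k x = levelSum P b c k x + levelSum P b d k x := by
  simp [levelSum, add_mul, Finset.sum_add_distrib]

theorem levelSum_smul (P : Grid m) (b : Set I → I → ℂ) (a : ℂ) (c : Set I → ℂ) (k : ℕ) (x : I) :
    levelSum P b (a • c) k x = a * levelSum P b c k x := by
  simp [levelSum, Finset.mul_sum, mul_assoc]

theorem IsRep.aestronglyMeasurable_sub {P : Grid m} {p : ℝ} {q : ℝ≥0∞} {s : ℝ}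
    {c : Set I → ℂ} {f : I → ℂ} (hf : IsRep P p q s c f) (n : ℕ) :
    AEStronglyMeasurable
      (fun x => f x - ∑ k ∈ Finset.range n, levelSum P (souzaAtom m p s) c k x) m :=
  hf.memLp.1.sub (Finset.aestronglyMeasurable_fun_sum _ fun k _ =>
    aestronglyMeasurable_levelSum_souzaAtom P p s c k)

theorem IsRep.add {P : Grid m} {p : ℝ} {q : ℝ≥0∞} {s : ℝ} (hp : 1 ≤ p) (hq : 1 ≤ q)
    {c d : Set I → ℂ} {f g : I → ℂ} (hf : IsRep P p q s c f) (hg : IsRep P p q s d g) :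
    IsRep P p q s (c + d) (f + g) := by
  have hp0 : (1 : ℝ≥0∞) ≤ ENNReal.ofReal p := by simpa using hp
  refine ⟨hf.memLp.add hg.memLp, ?_, ?_, ?_⟩
  · exact (coefNorm_add_le P hp hq c d).trans_lt
      (ENNReal.add_lt_top.2 ⟨hf.coef_lt_top, hg.coef_lt_top⟩)
  · have hfin := ENNReal.add_lt_top.2 ⟨hf.abs_conv, hg.abs_conv⟩
    rw [← ENNReal.tsum_add] at hfin
    refine lt_of_le_of_lt (ENNReal.tsum_le_tsum fun k => ?_) hfin
    have : levelSum P (souzaAtom m p s) (c + d) k =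
        levelSum P (souzaAtom m p s) c k + levelSum P (souzaAtom m p s) d k :=
      funext fun x => levelSum_add P _ c d k x
    rw [this]
    exact eLpNorm_add_le (aestronglyMeasurable_levelSum_souzaAtom P p s c k)
      (aestronglyMeasurable_levelSum_souzaAtom P p s d k) hp0
  · have h := hf.tendsto.add hg.tendsto
    rw [add_zero] at h
    refine tendsto_of_tendsto_of_tendsto_of_le_of_le tendsto_const_nhds h (fun _ => zero_le) ?_
    intro n
    have he : (fun x => (f + g) x -
          ∑ k ∈ Finset.range n, levelSum P (souzaAtom m p s) (c + d) k x) =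
        (fun x => f x - ∑ k ∈ Finset.range n, levelSum P (souzaAtom m p s) c k x) +
          fun x => g x - ∑ k ∈ Finset.range n, levelSum P (souzaAtom m p s) d k x := by
      ext x
      simp only [Pi.add_apply, levelSum_add, Finset.sum_add_distrib]
      ring
    change eLpNorm _ _ m ≤ eLpNorm _ _ m + eLpNorm _ _ m
    rw [he]
    exact eLpNorm_add_le (hf.aestronglyMeasurable_sub n) (hg.aestronglyMeasurable_sub n) hp0

theorem IsRep.smul {P : Grid m} {p : ℝ} {q : ℝ≥0∞} {s : ℝ} (hp : 1 ≤ p) (hq : 1 ≤ q)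
    {c : Set I → ℂ} {f : I → ℂ} (a : ℂ) (hf : IsRep P p q s c f) :
    IsRep P p q s (a • c) (a • f) := by
  refine ⟨hf.memLp.const_smul a, ?_, ?_, ?_⟩
  · rw [coefNorm_smul P hp hq]
    exact ENNReal.mul_lt_top enorm_lt_top hf.coef_lt_top
  · have : ∀ k, levelSum P (souzaAtom m p s) (a • c) k =
        a • levelSum P (souzaAtom m p s) c k :=
      fun k => funext fun x => levelSum_smul P _ a c k x
    simp_rw [this, eLpNorm_const_smul]
    rw [ENNReal.tsum_mul_left]
    exact ENNReal.mul_lt_top enorm_lt_top hf.abs_conv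
  · have h := ENNReal.Tendsto.const_mul (a := ‖a‖ₑ) hf.tendsto (Or.inr enorm_ne_top)
    rw [mul_zero] at h
    refine h.congr fun n => ?_
    rw [← eLpNorm_const_smul]
    congr 1
    ext x
    simp only [Pi.smul_apply, smul_eq_mul, levelSum_smul, mul_sub, Finset.mul_sum]

theorem IsRep.congr {P : Grid m} {p : ℝ} {q : ℝ≥0∞} {s : ℝ} {c : Set I → ℂ} {f g : I → ℂ}
    (hf : IsRep P p q s c f) (h : f =ᵐ[m] g) : IsRep P p q s c g := by
  refine ⟨(memLp_congr_ae h).1 hf.memLp, hf.coef_lt_top, hf.abs_conv, hf.tendsto.congr fun n => ?_⟩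
  refine eLpNorm_congr_ae ?_
  filter_upwards [h] with x hx
  rw [hx]

theorem isRep_zero (P : Grid m) {p : ℝ} {q : ℝ≥0∞} {s : ℝ} (hp : 1 ≤ p) (hq : 1 ≤ q) :
    IsRep P p q s 0 0 := by
  have hs : ∀ k, levelSum P (souzaAtom m p s) 0 k = 0 := fun k => by
    ext x
    simp [levelSum]
  refine ⟨MemLp.zero, ?_, ?_, ?_⟩
  · rw [coefNorm_zero P hp hq]
    exact ENNReal.zero_lt_top
  · simp [hs]
  · simp [hs]

/-- The space `B^s_{p,q}`, as a space of classes of functions modulo equality almost everywhere.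
All its elements are in `L^p`; they are viewed inside `L¹`, which contains `L^p` since the measure
is finite in all uses. -/
def besovSubmodule (P : Grid m) (p : ℝ) (q : ℝ≥0∞) (s : ℝ) (hp : 1 ≤ p) (hq : 1 ≤ q) :
    Submodule ℂ (Lp ℂ 1 m) where
  carrier := {f | MemBesov P p q s f}
  add_mem' := by
    rintro f g ⟨c, hc⟩ ⟨d, hd⟩
    exact ⟨c + d, (hc.add hp hq hd).congr (Lp.coeFn_add f g).symm⟩
  zero_mem' := ⟨0, (isRep_zero P hp hq).congr (Lp.coeFn_zero ℂ 1 m).symm⟩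
  smul_mem' := by
    rintro a f ⟨c, hc⟩
    exact ⟨a • c, (hc.smul hp hq a).congr (Lp.coeFn_smul a f).symm⟩

/-! ### The norm -/

theorem besovNorm_congr (P : Grid m) (p : ℝ) (q : ℝ≥0∞) (s : ℝ) {f g : I → ℂ} (h : f =ᵐ[m] g) :
    besovNorm P p q s f = besovNorm P p q s g :=
  le_antisymm
    (le_iInf₂ fun c hc => iInf₂_le c (hc.congr h.symm))
    (le_iInf₂ fun c hc => iInf₂_le c (hc.congr h))

theorem besovNorm_lt_top {P : Grid m} {p : ℝ} {q : ℝ≥0∞} {s : ℝ} {f : I → ℂ}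
    (h : MemBesov P p q s f) : besovNorm P p q s f < ∞ := by
  obtain ⟨c, hc⟩ := h
  exact (iInf₂_le c hc).trans_lt hc.coef_lt_top

theorem besovNorm_add_le (P : Grid m) {p : ℝ} {q : ℝ≥0∞} (s : ℝ) (hp : 1 ≤ p) (hq : 1 ≤ q)
    (f g : I → ℂ) :
    besovNorm P p q s (f + g) ≤ besovNorm P p q s f + besovNorm P p q s g := by
  unfold besovNorm
  simp only [iInf_subtype']
  refine ENNReal.le_iInf_add_iInf fun c d => ?_
  exact (iInf_le _ (⟨c.1 + d.1, c.2.add hp hq d.2⟩ : {c // IsRep P p q s c (f + g)})).trans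
    (coefNorm_add_le P hp hq _ _)

theorem besovNorm_smul_le (P : Grid m) {p : ℝ} {q : ℝ≥0∞} {s : ℝ} (hp : 1 ≤ p) (hq : 1 ≤ q)
    (a : ℂ) {f : I → ℂ} (hf : MemBesov P p q s f) :
    besovNorm P p q s (a • f) ≤ ‖a‖ₑ * besovNorm P p q s f := by
  unfold besovNorm
  simp only [iInf_subtype']
  have : Nonempty {c // IsRep P p q s c f} := ⟨⟨hf.choose, hf.choose_spec⟩⟩
  rw [ENNReal.mul_iInf fun h => absurd h enorm_ne_top]
  refine le_iInf fun c => ?_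
  rw [← coefNorm_smul P hp hq]
  exact iInf_le _ (⟨a • c.1, c.2.smul hp hq a⟩ : {c // IsRep P p q s c (a • f)})

theorem measureReal_le_pow [IsProbabilityMeasure m] {P : Grid m} {c₁ c₂ : ℝ} (hP : P.IsGood c₁ c₂)
    (k : ℕ) : ∀ Q ∈ P.level k, m.real Q ≤ c₂ ^ k := by
  induction k with
  | zero => intro Q _; simp
  | succ k ih =>
    intro Q hQ
    obtain ⟨R, hR, hQR⟩ := hP.nested k Q hQ
    have hpos : 0 < m.real R := ENNReal.toReal_pos (P.pos k R hR).ne' (measure_ne_top _ _)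
    have h := (hP.ratio k Q hQ R hR hQR).2
    rw [div_le_iff₀ hpos] at h
    have h0 : 0 ≤ c₂ := (hP.c₁_pos.trans hP.c₁_lt_c₂).le
    calc m.real Q ≤ c₂ * m.real R := h
      _ ≤ c₂ * c₂ ^ k := by gcongr; exact ih R hR
      _ = c₂ ^ (k + 1) := by ring

theorem eLpNorm_levelSum_le [IsProbabilityMeasure m] {P : Grid m} {c₁ c₂ : ℝ}
    (hP : P.IsGood c₁ c₂) {p s : ℝ} (hp : 1 ≤ p) (hs : 0 < s) (c : Set I → ℂ) (k : ℕ) :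
    eLpNorm (levelSum P (souzaAtom m p s) c k) (ENNReal.ofReal p) m ≤
      ENNReal.ofReal (c₂ ^ s) ^ k * levelNorm P p c k := by
  have hp0 : 0 < p := by linarith
  have hc0 : 0 < c₂ := hP.c₁_pos.trans hP.c₁_lt_c₂
  have hpw : ∀ x, ‖levelSum P (souzaAtom m p s) c k x‖ₑ ^ p ≤
      ∑ Q ∈ P.level k, Q.indicator
        (fun _ => ‖c Q‖ₑ ^ p * ENNReal.ofReal (m.real Q ^ (s - 1 / p)) ^ p) x := by
    intro x
    by_cases hx : ∃ Q ∈ P.level k, x ∈ Q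
    · obtain ⟨Q, hQ, hxQ⟩ := hx
      have h0 : ∀ R ∈ P.level k, R ≠ Q → x ∉ R := fun R hR hne hxR =>
        Set.disjoint_left.1 (hP.disjoint k R hR Q hQ hne) hxR hxQ
      have h1 : levelSum P (souzaAtom m p s) c k x = c Q * souzaAtom m p s Q x := by
        unfold levelSum
        refine Finset.sum_eq_single_of_mem Q hQ fun R hR hne => ?_
        simp [souzaAtom, h0 R hR hne]
      refine le_trans (le_of_eq ?_) (Finset.single_le_sum (fun _ _ => zero_le) hQ)
      rw [h1, enorm_mul, ENNReal.mul_rpow_of_nonneg _ _ hp0.le]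
      simp only [souzaAtom, Set.indicator_of_mem hxQ]
      congr 2
      rw [← ofReal_norm, Complex.norm_real, Real.norm_of_nonneg (by positivity)]
    · push Not at hx
      have h1 : levelSum P (souzaAtom m p s) c k x = 0 := by
        unfold levelSum
        refine Finset.sum_eq_zero fun R hR => ?_
        simp [souzaAtom, hx R hR]
      rw [h1]
      simp [hp0]
  rw [eLpNorm_eq_lintegral_rpow_enorm_toReal (by simpa using hp0) ENNReal.ofReal_ne_top,
    ENNReal.toReal_ofReal hp0.le]
  have hcell : ∀ Q ∈ P.level k,
      ENNReal.ofReal (m.real Q ^ (s - 1 / p)) ^ p * m Q ≤ (ENNReal.ofReal (c₂ ^ s) ^ k) ^ p := by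
    intro Q hQ
    have hpos : 0 < m.real Q := ENNReal.toReal_pos (P.pos k Q hQ).ne' (measure_ne_top _ _)
    rw [← ofReal_measureReal (measure_ne_top _ _),
      ENNReal.ofReal_rpow_of_nonneg (by positivity) hp0.le, ← ENNReal.ofReal_mul (by positivity),
      ← ENNReal.ofReal_pow (by positivity), ENNReal.ofReal_rpow_of_nonneg (by positivity) hp0.le]
    refine ENNReal.ofReal_le_ofReal ?_
    have h1 : (m.real Q ^ (s - 1 / p)) ^ p * m.real Q = (m.real Q ^ s) ^ p := by
      rw [← Real.rpow_mul hpos.le, ← Real.rpow_mul hpos.le]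
      nth_rewrite 2 [← Real.rpow_one (m.real Q)]
      rw [← Real.rpow_add hpos]
      congr 1
      field_simp
      ring
    have h2 : (c₂ ^ s) ^ k = (c₂ ^ k) ^ s := by
      rw [← Real.rpow_natCast, ← Real.rpow_natCast, ← Real.rpow_mul hc0.le,
        ← Real.rpow_mul hc0.le, mul_comm]
    rw [h1, h2]
    gcongr
    exact measureReal_le_pow hP k Q hQ
  calc (∫⁻ x, ‖levelSum P (souzaAtom m p s) c k x‖ₑ ^ p ∂m) ^ (1 / p)
      ≤ (∑ Q ∈ P.level k, ‖c Q‖ₑ ^ p * (ENNReal.ofReal (c₂ ^ s) ^ k) ^ p) ^ (1 / p) := by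
        gcongr
        refine (lintegral_mono hpw).trans ?_
        rw [lintegral_finsetSum _ fun Q hQ =>
          measurable_const.indicator (P.measurableSet k Q hQ)]
        refine Finset.sum_le_sum fun Q hQ => ?_
        rw [lintegral_indicator_const (P.measurableSet k Q hQ), mul_assoc]
        gcongr
        exact hcell Q hQ
    _ = ENNReal.ofReal (c₂ ^ s) ^ k * levelNorm P p c k := by
        rw [← Finset.sum_mul, ENNReal.mul_rpow_of_nonneg _ _ (by positivity), ← ENNReal.rpow_mul,
          mul_one_div_cancel hp0.ne', ENNReal.rpow_one, mul_comm, levelNorm]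

theorem IsRep.eLpNorm_le [IsProbabilityMeasure m] {P : Grid m} {c₁ c₂ : ℝ}
    (hP : P.IsGood c₁ c₂) {p s : ℝ} {q : ℝ≥0∞} (hp : 1 ≤ p) (hq : 1 ≤ q) (hs : 0 < s)
    {c : Set I → ℂ} {f : I → ℂ} (hf : IsRep P p q s c f) :
    eLpNorm f (ENNReal.ofReal p) m ≤
      (∑' k, ENNReal.ofReal (c₂ ^ s) ^ k) * coefNorm P p q c := by
  have hp0 : (1 : ℝ≥0∞) ≤ ENNReal.ofReal p := by simpa using hp
  have key : ∀ n, eLpNorm f (ENNReal.ofReal p) m ≤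
      eLpNorm (fun x => f x - ∑ k ∈ Finset.range n, levelSum P (souzaAtom m p s) c k x)
        (ENNReal.ofReal p) m + (∑' k, ENNReal.ofReal (c₂ ^ s) ^ k) * coefNorm P p q c := by
    intro n
    have hsum : (fun x => ∑ k ∈ Finset.range n, levelSum P (souzaAtom m p s) c k x) =
        ∑ k ∈ Finset.range n, levelSum P (souzaAtom m p s) c k := by
      ext x
      simp
    have hdec : f = (fun x => f x - ∑ k ∈ Finset.range n, levelSum P (souzaAtom m p s) c k x) +
        ∑ k ∈ Finset.range n, levelSum P (souzaAtom m p s) c k := by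
      rw [← hsum]
      ext x
      simp
    have hm : ∀ k ∈ Finset.range n,
        AEStronglyMeasurable (levelSum P (souzaAtom m p s) c k) m :=
      fun k _ => aestronglyMeasurable_levelSum_souzaAtom P p s c k
    conv_lhs => rw [hdec]
    refine (eLpNorm_add_le (hf.aestronglyMeasurable_sub n)
      (Finset.aestronglyMeasurable_sum _ hm) hp0).trans ?_
    gcongr
    refine (eLpNorm_sum_le hm hp0).trans ?_
    rw [← ENNReal.tsum_mul_right]
    refine le_trans (Finset.sum_le_sum fun k _ => ?_) (ENNReal.sum_le_tsum (Finset.range n))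
    refine (eLpNorm_levelSum_le hP hp hs c k).trans ?_
    gcongr
    exact le_lqNorm hq _ k
  have h := hf.tendsto.add_const ((∑' k, ENNReal.ofReal (c₂ ^ s) ^ k) * coefNorm P p q c)
  rw [zero_add] at h
  exact ge_of_tendsto' h key

theorem ae_zero_of_besovNorm_eq_zero [IsProbabilityMeasure m] {P : Grid m} {c₁ c₂ : ℝ}
    (hP : P.IsGood c₁ c₂) {p s : ℝ} {q : ℝ≥0∞} (hp : 1 ≤ p) (hq : 1 ≤ q) (hs : 0 < s)
    {f : I → ℂ} (hf : MemBesov P p q s f) (h : besovNorm P p q s f = 0) : f =ᵐ[m] 0 := by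
  have hc0 : 0 < c₂ := hP.c₁_pos.trans hP.c₁_lt_c₂
  have hlt : ENNReal.ofReal (c₂ ^ s) < 1 :=
    ENNReal.ofReal_lt_one.2 (Real.rpow_lt_one hc0.le hP.c₂_lt_one hs)
  have hK : ∑' k, ENNReal.ofReal (c₂ ^ s) ^ k ≠ ∞ := by
    rw [ENNReal.tsum_geometric]
    exact ENNReal.inv_ne_top.2 (tsub_pos_of_lt hlt).ne'
  obtain ⟨c₀, hc₀⟩ := hf
  have hle : eLpNorm f (ENNReal.ofReal p) m ≤
      (∑' k, ENNReal.ofReal (c₂ ^ s) ^ k) * besovNorm P p q s f := by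
    unfold besovNorm
    simp only [iInf_subtype']
    have : Nonempty {c // IsRep P p q s c f} := ⟨⟨c₀, hc₀⟩⟩
    rw [ENNReal.mul_iInf fun h => absurd h hK]
    exact le_iInf fun c => c.2.eLpNorm_le hP hp hq hs
  rw [h, mul_zero, nonpos_iff_eq_zero, eLpNorm_eq_zero_iff hc₀.memLp.1
    (by simpa using (by linarith : 0 < p))] at hle
  exact hle

end Besov

/-! ## Exponents -/

/-- The numerical parameters. -/
structure Exponents where
  p : ℝ
  q : ℝ≥0∞
  s : ℝ
  β : ℝ
  ε : ℝ
  δ : ℝ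
  γ : ℝ
  one_le_p : 1 ≤ p
  one_le_q : 1 ≤ q
  s_pos : 0 < s
  ε_pos : 0 < ε
  s_add_ε_le : s + ε ≤ 1 / p
  s_lt_β : s < β
  β_lt : β < 1 / p
  δ_pos : 0 < δ
  δ_lt : δ < max s ε
  γ_pos : 0 < γ
  γ_le_one : γ ≤ 1

/-- `t₀ = p / (1 - s p + δ p)`. -/
def Exponents.t0 (E : Exponents) : ℝ≥0∞ :=
  ENNReal.ofReal (E.p / (1 - E.s * E.p + E.δ * E.p))

/-! ## The normed space -/

section Space

variable {I : Type*} [MeasurableSpace I] {m : Measure I} {P : Grid m} {c₁ c₂ : ℝ}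

/-- The space `B^s_{p,q}` of a good grid, as a type of its own: it carries the norm `besovNorm`,
not the norm of `L¹`. -/
def BesovSpace (_ : P.IsGood c₁ c₂) (E : Exponents) : Type _ :=
  besovSubmodule P E.p E.q E.s E.one_le_p E.one_le_q

instance (hP : P.IsGood c₁ c₂) (E : Exponents) : AddCommGroup (BesovSpace hP E) :=
  inferInstanceAs (AddCommGroup (besovSubmodule P E.p E.q E.s E.one_le_p E.one_le_q))

instance (hP : P.IsGood c₁ c₂) (E : Exponents) : Module ℂ (BesovSpace hP E) :=
  inferInstanceAs (Module ℂ (besovSubmodule P E.p E.q E.s E.one_le_p E.one_le_q))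

/-- The inclusion `B^s_{p,q} ⊆ L¹`. -/
def BesovSpace.toL1 {hP : P.IsGood c₁ c₂} {E : Exponents} (f : BesovSpace hP E) : Lp ℂ 1 m :=
  f.1

instance (hP : P.IsGood c₁ c₂) (E : Exponents) : Norm (BesovSpace hP E) :=
  ⟨fun f => (besovNorm P E.p E.q E.s f.toL1).toReal⟩

theorem BesovSpace.norm_def {hP : P.IsGood c₁ c₂} {E : Exponents} (f : BesovSpace hP E) :
    ‖f‖ = (besovNorm P E.p E.q E.s f.toL1).toReal := rfl

theorem BesovSpace.norm_smul_le' {hP : P.IsGood c₁ c₂} {E : Exponents} (a : ℂ)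
    (f : BesovSpace hP E) : ‖a • f‖ ≤ ‖a‖ * ‖f‖ := by
  have hf : MemBesov P E.p E.q E.s f.toL1 := f.2
  have h := besovNorm_smul_le P E.one_le_p E.one_le_q a hf
  rw [← besovNorm_congr P E.p E.q E.s (Lp.coeFn_smul a f.toL1)] at h
  have h' := ENNReal.toReal_mono
    (ENNReal.mul_ne_top enorm_ne_top (besovNorm_lt_top hf).ne) h
  rw [ENNReal.toReal_mul, toReal_enorm] at h'
  exact h'

theorem BesovSpace.core [IsProbabilityMeasure m] (hP : P.IsGood c₁ c₂) (E : Exponents) :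
    NormedSpace.Core ℂ (BesovSpace hP E) where
  norm_nonneg _ := ENNReal.toReal_nonneg
  norm_smul a f := by
    refine le_antisymm (BesovSpace.norm_smul_le' a f) ?_
    by_cases ha : a = 0
    · rw [ha, norm_zero, zero_mul]
      exact ENNReal.toReal_nonneg
    · have h := BesovSpace.norm_smul_le' a⁻¹ (a • f)
      rw [smul_smul, inv_mul_cancel₀ ha, one_smul, norm_inv] at h
      have hpos : 0 < ‖a‖ := norm_pos_iff.2 ha
      calc ‖a‖ * ‖f‖ ≤ ‖a‖ * (‖a‖⁻¹ * ‖a • f‖) := by gcongr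
        _ = ‖a • f‖ := by field_simp
  norm_triangle f g := by
    have hf : MemBesov P E.p E.q E.s f.toL1 := f.2
    have hg : MemBesov P E.p E.q E.s g.toL1 := g.2
    have h := besovNorm_add_le P E.s E.one_le_p E.one_le_q f.toL1 g.toL1
    rw [← besovNorm_congr P E.p E.q E.s (Lp.coeFn_add f.toL1 g.toL1)] at h
    have h' := ENNReal.toReal_mono
      (ENNReal.add_lt_top.2 ⟨besovNorm_lt_top hf, besovNorm_lt_top hg⟩).ne h
    rw [ENNReal.toReal_add (besovNorm_lt_top hf).ne (besovNorm_lt_top hg).ne] at h'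
    exact h'
  norm_eq_zero_iff f := by
    have hf : MemBesov P E.p E.q E.s f.toL1 := f.2
    constructor
    · intro h
      rw [BesovSpace.norm_def, ENNReal.toReal_eq_zero_iff] at h
      have h0 := ae_zero_of_besovNorm_eq_zero hP E.one_le_p E.one_le_q E.s_pos hf
        (h.resolve_right (besovNorm_lt_top hf).ne)
      exact Subtype.ext (Lp.ext (h0.trans (Lp.coeFn_zero ℂ 1 m).symm))
    · rintro rfl
      have h := BesovSpace.norm_smul_le' (0 : ℂ) (0 : BesovSpace hP E)
      rw [smul_zero, norm_zero, zero_mul] at h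
      exact le_antisymm h ENNReal.toReal_nonneg

instance [IsProbabilityMeasure m] (hP : P.IsGood c₁ c₂) (E : Exponents) :
    NormedAddCommGroup (BesovSpace hP E) :=
  NormedAddCommGroup.ofCore (BesovSpace.core hP E)

instance [IsProbabilityMeasure m] (hP : P.IsGood c₁ c₂) (E : Exponents) :
    NormedSpace ℂ (BesovSpace hP E) :=
  NormedSpace.ofCore (BesovSpace.core hP E)

end Space

/-! ## Branches and potentials -/

/-- `Ω` is an `(α, C, c)`-regular domain with respect to the grid `H`. -/
def IsRegularDomain {J : Type*} [MeasurableSpace J] {μ : Measure J} (H : Grid μ)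
    (α C c : ℝ) (Ω : Set J) : Prop :=
  ∃ F : ℕ → Finset (Set J),
    (∀ k, H.k0 Ω ≤ k → F k ⊆ H.level k) ∧
    (Ω = ⋃ k, ⋃ (_ : H.k0 Ω ≤ k), ⋃ Q ∈ F k, Q) ∧
    (∀ k, H.k0 Ω ≤ k → ∀ l, H.k0 Ω ≤ l → ∀ Q ∈ F k, ∀ R ∈ F l, Q ≠ R → Disjoint Q R) ∧
    (∀ k, H.k0 Ω ≤ k →
      ∑ Q ∈ F k, μ.real Q ^ α ≤ C * c ^ (k - H.k0 Ω) * μ.real Ω ^ α)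

/-- The set `h⁻¹(Q)`, for `h` defined on `A ⊆ J` with values in `B ⊆ I`. -/
def pullback {I J : Type*} {A : Set J} {B : Set I} (h : A → B) (Q : Set I) : Set J :=
  {x | ∃ hx : x ∈ A, (h ⟨x, hx⟩ : I) ∈ Q}

/-- `h` is an `(s, p, a, ε', DGD1, DGD2, DC1, DC2, G)`-branch from `Jhat ⊆ J` onto `Ihat ⊆ I`. -/
structure IsBranch {I J : Type*} [MeasurableSpace I] [MeasurableSpace J] {m : Measure I}
    {μ : Measure J} (P : Grid m) (H : Grid μ) (s p a ε' DGD1 DGD2 DC1 DC2 : ℝ) (G : Grid m)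
    (Ihat : Set I) (Jhat : Set J) (h : Jhat ≃ᵐ Ihat) : Prop where
  measurableSet_Ihat : MeasurableSet Ihat
  measurableSet_Jhat : MeasurableSet Jhat
  /-- `G` is a grid on `Ihat`, its levels consist of disjoint sets, and a cell of level `k`
  contains no cell of a smaller level. -/
  grid_subset : ∀ Q ∈ G.cells, Q ⊆ Ihat
  grid_disjoint : G.DisjointLevels
  grid_k0 : ∀ k, ∀ Q ∈ G.level k, G.k0 Q = k
  null_iff : ∀ Q : Set I, MeasurableSet Q → Q ⊆ Ihat → (m Q = 0 ↔ μ (pullback h Q) = 0)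
  /-- Geometric distortion control. -/
  regular : ∀ Q ∈ G.cells, IsRegularDomain H (1 - s * p) DGD1 DGD2 (pullback h Q)
  /-- Scaling control. -/
  le_scale : ∀ Q ∈ G.cells, a ≤ |(G.k0 Q : ℝ) - (H.k0 (pullback h Q) : ℝ)|
  scaling : ∀ Q ∈ G.cells,
    (m.real Q / μ.real (pullback h Q)) ^ (ε' / |ε'|) ≤
      DC1 * DC2 ^ |(G.k0 Q : ℝ) - (H.k0 (pullback h Q) : ℝ)|
  union_cells : ∃ S : Set (Set I), S.Countable ∧ S ⊆ P.cells ∧ Ihat =ᵐ[m] ⋃₀ S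
  pullback_union_cells : ∀ W ∈ G.cells, ∃ S : Set (Set J), S.Countable ∧ S ⊆ H.cells ∧
    pullback h W =ᵐ[μ] ⋃₀ S

/-- Extension by zero to `J` of a function on a subset. -/
def extendZero {J : Type*} {A : Set J} (g : A → ℂ) (x : J) : ℂ :=
  open Classical in if hx : x ∈ A then g ⟨x, hx⟩ else 0

/-- `g` is a `(DRP, β, ε')`-regular potential associated with the branch `h`. -/
def IsRegularPotential {I J : Type*} [MeasurableSpace I] [MeasurableSpace J] {m : Measure I}
    {μ : Measure J} (H : Grid μ) (p : ℝ) (q : ℝ≥0∞) (s β ε' DRP : ℝ) (G : Grid m)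
    {Ihat : Set I} {Jhat : Set J} (h : Jhat → Ihat) (g : Jhat → ℂ) : Prop :=
  ∀ W ∈ H.cells, ∀ Q ∈ G.cells, W ⊆ Jhat → Q ⊆ Ihat → W ⊆ pullback h Q →
    besovNormOn H p q β W (W.indicator (extendZero g)) ≤
      ENNReal.ofReal (DRP * (m.real Q / μ.real (pullback h Q)) ^ (1 / p - s + ε') *
        μ.real W ^ (1 / p - β))

/-! ## The transfer transformation -/

/-- Branches, potentials and the constants that go with them. `Iset r`, `Jset r` are the sets
`I_r`, `J_r`. -/
structure Dynamics {I J : Type*} [MeasurableSpace I] [MeasurableSpace J] (m : Measure I)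
    (Λ : Type*) where
  Iset : Λ → Set I
  Jset : Λ → Set J
  h : ∀ r, Jset r ≃ᵐ Iset r
  g : ∀ r, Jset r → ℂ
  grid : Λ → Grid m
  a : Λ → ℝ
  ε' : Λ → ℝ
  DGD1 : Λ → ℝ
  DGD2 : Λ → ℝ
  DC1 : Λ → ℝ
  DC2 : Λ → ℝ
  DRP : Λ → ℝ

namespace Dynamics

variable {I J : Type*} [MeasurableSpace I] [MeasurableSpace J] {m : Measure I} {Λ : Type*}

/-- `max {DC2_r ^ ε, DGD2_r ^ (1/p)}`. -/
def DRS2 (D : Dynamics (J := J) m Λ) (E : Exponents) (r : Λ) : ℝ :=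
  max (D.DC2 r ^ E.ε) (D.DGD2 r ^ (1 / E.p))

/-- `Θ_r`, which measures the regularity of the pair `(h_r, g_r)`. -/
def Θ (D : Dynamics (J := J) m Λ) (E : Exponents) (r : Λ) : ℝ :=
  D.DC1 r ^ E.ε * D.DRP r * D.DGD1 r ^ (1 / E.p) * D.DRS2 E r ^ (D.a r * (1 - E.γ))

/-- The constant `2 / (1 - DRS2 ^ γ)`, where `DRS2 = sup_r DRS2_r`. -/
def CD (D : Dynamics (J := J) m Λ) (E : Exponents) : ℝ :=
  2 / (1 - (⨆ r, D.DRS2 E r) ^ E.γ)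

/-- The standing hypotheses on branches and potentials. -/
structure IsAdmissible (D : Dynamics (J := J) m Λ) {μ : Measure J} (E : Exponents)
    (P : Grid m) (H : Grid μ) : Prop where
  consts_pos : ∀ r, 0 < D.DGD1 r ∧ 0 < D.DGD2 r ∧ 0 < D.DC1 r ∧ 0 < D.DC2 r ∧ 0 < D.DRP r
  abs_ε' : ∀ r, |D.ε' r| = E.ε
  branch : ∀ r, IsBranch P H E.s E.p (D.a r) (D.ε' r) (D.DGD1 r) (D.DGD2 r) (D.DC1 r) (D.DC2 r)
    (D.grid r) (D.Iset r) (D.Jset r) (D.h r)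
  generates : MeasurableSpace.generateFrom
    ({Q | ∃ r, Q ∈ (D.grid r).cells ∧ Q ⊆ D.Iset r} ∪
      {Q | Q ∈ P.cells ∧ ∀ r, Q ∩ D.Iset r = ∅}) = ‹MeasurableSpace I›
  measurable_potential : ∀ r, Measurable (D.g r)
  potential : ∀ r, IsRegularPotential H E.p E.q E.s E.β (D.ε' r) (D.DRP r) (D.grid r)
    (D.h r) (D.g r)
  DRS2_lt_one : ∀ r, D.DRS2 E r < 1
  iSup_DRS2_lt_one : ⨆ r, D.DRS2 E r < 1

/-- `Φ_r f = g_r · (f ∘ h_r)` on `J_r`, and `0` elsewhere. -/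
def term (D : Dynamics (J := J) m Λ) (r : Λ) (f : I → ℂ) : J → ℂ :=
  extendZero fun x : D.Jset r => D.g r x * f (D.h r x)

/-- The transfer transformation `Φ f = ∑_r Φ_r f`. -/
def transfer (D : Dynamics (J := J) m Λ) (f : I → ℂ) (x : J) : ℂ :=
  ∑' r, D.term r f x

/-- `∑_r |Φ_r f|_{L¹} ≤ C |f|_{L^{t₀}}`. The inequality `|Φ f|_{L¹} ≤ ∑_r |Φ_r f|_{L¹}` is then
automatic, the series of the `Φ_r f` being absolutely convergent almost everywhere. -/
def IsIntegrable (D : Dynamics (J := J) m Λ) (μ : Measure J) (E : Exponents) : Prop :=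
  ∃ C : ℝ, 0 ≤ C ∧ ∀ f : I → ℂ, MemLp f E.t0 m →
    ∑' r, eLpNorm (D.term r f) 1 μ ≤ ENNReal.ofReal C * eLpNorm f E.t0 m

/-! ## Slicings -/

/-- `N = sup_{W ∈ H} #{r : W ⊆ J_r}`. -/
def N (D : Dynamics (J := J) m Λ) {μ : Measure J} (H : Grid μ) : ℝ≥0∞ :=
  ⨆ W ∈ H.cells, (({r | W ⊆ D.Jset r} : Set Λ).encard : ℝ≥0∞)

/-- The pair formed by the family and `∑_Q d_Q a_Q` has a `C`-regular slicing. -/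
def HasRegularSlicing (D : Dynamics (J := J) m Λ) {μ : Measure J} (E : Exponents)
    (P : Grid m) (H : Grid μ) (C : ℝ) (d : Set I → ℂ) : Prop :=
  0 ≤ C ∧ ∃ f : I → ℂ, IsRep P E.p E.q E.s d f ∧ ∃ c : Λ → Set I → ℂ,
    (∀ r, IsRep (D.grid r) E.p E.q E.s (c r) ((D.Iset r).indicator f)) ∧
    (lqNorm E.q (fun j => ∑' r, ENNReal.ofReal (D.Θ E r) * levelNorm (D.grid r) E.p (c r) j) ≤
        ENNReal.ofReal C * coefNorm P E.p E.q d ∨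
      D.N H ^ (1 - 1 / E.p) *
          lqNorm E.q (fun j => (∑' r, ENNReal.ofReal (D.Θ E r) ^ E.p *
            ∑ Q ∈ (D.grid r).level j, ‖c r Q‖ₑ ^ E.p) ^ (1 / E.p)) ≤
        ENNReal.ofReal C * coefNorm P E.p E.q d) ∧
    ((∀ Q ∈ P.cells, ∃ t : ℝ, 0 ≤ t ∧ d Q = t) →
      ∀ r, ∀ Q ∈ (D.grid r).cells, ∃ t : ℝ, 0 ≤ t ∧ c r Q = t)

/-- The subspace `S` has a `(CFR, CES)`-essential slicing, realized by the finite set `P'` of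
cells. -/
def HasEssentialSlicing (D : Dynamics (J := J) m Λ) {μ : Measure J} (E : Exponents)
    (P : Grid m) (H : Grid μ) (S : Submodule ℂ (Lp ℂ 1 m)) (P' : Finset (Set I))
    (CFR CES : ℝ) : Prop :=
  (P' : Set (Set I)) ⊆ P.cells ∧ 0 ≤ CFR ∧ 0 ≤ CES ∧
  ∀ f ∈ S, ∀ d : Set I → ℂ, IsRep P E.p E.q E.s d f →
    D.HasRegularSlicing E P H CES ((P' : Set (Set I))ᶜ.indicator d) ∧
    D.HasRegularSlicing E P H CFR ((P' : Set (Set I)).indicator d)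

end Dynamics

/-! ## Essential spectrum -/

/-- The essential spectral radius: the supremum of the moduli over the essential spectrum, which
consists of those `z` for which `z - T` is not a Fredholm operator. -/
def essentialSpectralRadius {V : Type*} [NormedAddCommGroup V] [NormedSpace ℂ V]
    (T : V →L[ℂ] V) : ℝ≥0∞ :=
  ⨆ z ∈ {z : ℂ | ¬ (z • ContinuousLinearMap.id ℂ V - T).IsFredholm}, ‖z‖ₑ

end BesovTransfer

end

noncomputable section

namespace BesovTransfer

/-! ## Minkowski and Young inequalities for series -/

/-! A branch sends a Souza atom to a combination of Besov atoms whose coefficients decay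
geometrically in the distance between levels. Let `Q` be a cell of level `j` of the grid of branch
`r`, put `Ω = h_r⁻¹(Q)` and let `κ` be the first level of `P` with a cell inside `Ω`. Then `Φ_r a_Q
= |Q|^(s-1/p) g_r 1_Ω`, and `Ω` is a disjoint union of cells `W` of `P`. The regularity of `g_r`
makes `g_r 1_W` a multiple of a Besov atom, with total coefficient `D₃ (|Q|/|Ω|)^ε_r
(|W|/|Ω|)^(1/p-s)`. Summing `p`-th powers over the pieces of level `k` uses the geometric control of
`Ω`, and the scaling condition bounds `(|Q|/|Ω|)^ε_r`. The result is a constant times `(λ^r)^(|j-κ|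
+ (k-κ))`. The exponent is at least `a_r` and at least `|j-k|`; spending the share `1-γ` on the
first bound and `γ` on the second gives `Θ_r λ^(γ|k-j|)`. This is `scaling_le`, and `exists_atoms`
turns it into atoms.

Given a regular slicing, these images are added up. Cells of one level of one grid have disjoint
preimages, so `ℓ^p` sums pass through without loss. The branches are combined by Minkowski's
inequality, or by Hölder's inequality with the overlap number `N`, and the levels by Young's
inequality with kernel `λ^(γ|k-j|)`, which yields `D = 2/(1-λ^γ)` (`exists_level_bound`). All series
converge absolutely almost everywhere, so regrouping by cells identifies the sum with `Φ f`, and the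
conversion constant returns to Souza atoms (`transfer_bound`).

Applying this to the parts of the canonical representation inside and outside `P'` bounds `Φ ∘ π` on
each part. The part inside depends on finitely many functionals and has finite rank. For `|z|` above
the norm of the other part, `z` minus that part is invertible by a Neumann series, which requires
completeness of the space; hence `z - Φ` is Fredholm (`essentialSpectralRadius_le`).

The two constants of the grid also come from geometric decay. A Besov atom on a cell of level `k`,
rewritten with exponent `s < β`, has coefficients at level `j` of size `c₂^((β-s)(j-k))`, and
Young's inequality gives a conversion constant. The canonical functionals are normalized martingale
differences `|Q|^(1/p-s) (avg_Q f - avg_R f)`, `R` the parent of `Q`. In any representation the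
blocks up to the level of `R` cancel from this difference, while a finer block of level `j` gains a
power `c₂^(s(j-k))` on being averaged over cells of level `k`. -/

theorem finset_Lp_sum_le {α ι : Type*} (t : Finset α) (s : Finset ι) {p : ℝ} (hp : 1 ≤ p)
    (y : ι → α → ℝ≥0∞) :
    (∑ a ∈ t, (∑ i ∈ s, y i a) ^ p) ^ (1 / p) ≤ ∑ i ∈ s, (∑ a ∈ t, y i a ^ p) ^ (1 / p) := by
  classical
  have hp0 : 0 < p := by linarith
  induction s using Finset.induction_on with
  | empty => simp [hp0]
  | insert i s hi ih =>
    simp only [Finset.sum_insert hi]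
    exact (ENNReal.Lp_add_le _ _ _ hp).trans (by gcongr)

theorem finset_Lp_tsum_le {α ι : Type*} (t : Finset α) {p : ℝ} (hp : 1 ≤ p)
    (y : ι → α → ℝ≥0∞) :
    (∑ a ∈ t, (∑' i, y i a) ^ p) ^ (1 / p) ≤ ∑' i, (∑ a ∈ t, y i a ^ p) ^ (1 / p) := by
  have h : Tendsto (fun s : Finset ι => (∑ a ∈ t, (∑ i ∈ s, y i a) ^ p) ^ (1 / p)) atTop
      (𝓝 ((∑ a ∈ t, (∑' i, y i a) ^ p) ^ (1 / p))) := by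
    refine (ENNReal.continuous_rpow_const.tendsto _).comp (tendsto_finsetSum _ fun a _ => ?_)
    exact (ENNReal.continuous_rpow_const.tendsto _).comp ENNReal.summable.hasSum
  exact le_of_tendsto' h fun s => (finset_Lp_sum_le t s hp y).trans (ENNReal.sum_le_tsum s)

/-- Reduces inequalities for infinite sequences to finite sections, where Minkowski's inequality for
finite sums applies. -/
theorem lqNorm_le_iff {q : ℝ≥0∞} (hq : 1 ≤ q) (h : q ≠ ∞) (u : ℕ → ℝ≥0∞) (C : ℝ≥0∞) :
    lqNorm q u ≤ C ↔ ∀ K : Finset ℕ, (∑ k ∈ K, u k ^ q.toReal) ^ (1 / q.toReal) ≤ C := by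
  have hq0 : 0 < q.toReal := by linarith [one_le_toReal hq h]
  simp only [lqNorm, if_neg h, one_div, ENNReal.rpow_inv_le_iff hq0]
  rw [ENNReal.tsum_eq_iSup_sum]
  exact iSup_le_iff

theorem lqNorm_tsum_le {ι : Type*} {q : ℝ≥0∞} (hq : 1 ≤ q) (u : ι → ℕ → ℝ≥0∞) :
    lqNorm q (fun k => ∑' i, u i k) ≤ ∑' i, lqNorm q (u i) := by
  by_cases h : q = ∞
  · simp only [lqNorm, if_pos h]
    exact iSup_le fun k => ENNReal.tsum_le_tsum fun i => le_iSup (u i) k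
  · rw [lqNorm_le_iff hq h]
    intro K
    refine (finset_Lp_tsum_le K (one_le_toReal hq h) u).trans (ENNReal.tsum_le_tsum fun i => ?_)
    exact (lqNorm_le_iff hq h _ _).1 le_rfl K

theorem lqNorm_comp_le {q : ℝ≥0∞} (u : ℕ → ℝ≥0∞) {φ : ℕ → ℕ} (hφ : φ.Injective) :
    lqNorm q (fun k => u (φ k)) ≤ lqNorm q u := by
  unfold lqNorm
  split_ifs
  · exact iSup_le fun k => le_iSup u (φ k)
  · exact ENNReal.rpow_le_rpow (ENNReal.tsum_comp_le_tsum_of_injective hφ fun k => u k ^ q.toReal)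
      (by positivity)

theorem lqNorm_shift_right_le {q : ℝ≥0∞} (hq : 1 ≤ q) (u : ℕ → ℝ≥0∞) (n : ℕ) :
    lqNorm q (fun k => if n ≤ k then u (k - n) else 0) ≤ lqNorm q u := by
  by_cases h : q = ∞
  · simp only [lqNorm, if_pos h]
    refine iSup_le fun k => ?_
    split_ifs
    · exact le_iSup u _
    · exact zero_le
  · have hq0 : 0 < q.toReal := by linarith [one_le_toReal hq h]
    simp only [lqNorm, if_neg h]
    refine ENNReal.rpow_le_rpow ?_ (by positivity)
    rw [← ENNReal.summable.sum_add_tsum_nat_add' (f := fun k =>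
      (if n ≤ k then u (k - n) else 0) ^ q.toReal) (k := n)]
    rw [Finset.sum_eq_zero]
    · simp
    · intro k hk
      rw [if_neg (by simpa using hk), ENNReal.zero_rpow_of_pos hq0]

/-- The sequence is a superposition of left shifts of `u` with weights `ρ ^ n`. Shifts do not
increase the norm, so Minkowski's inequality leaves a geometric series. -/
theorem lqNorm_young_up {q : ℝ≥0∞} (hq : 1 ≤ q) (ρ : ℝ≥0∞) (u : ℕ → ℝ≥0∞) :
    lqNorm q (fun k => ∑' n, ρ ^ n * u (k + n)) ≤ (1 - ρ)⁻¹ * lqNorm q u := by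
  refine (lqNorm_tsum_le hq fun n k => ρ ^ n * u (k + n)).trans ?_
  simp_rw [lqNorm_const_mul hq]
  rw [← ENNReal.tsum_geometric, ← ENNReal.tsum_mul_right]
  gcongr with n
  exact lqNorm_comp_le u (add_left_injective n)

theorem lqNorm_young_down {q : ℝ≥0∞} (hq : 1 ≤ q) (ρ : ℝ≥0∞) (u : ℕ → ℝ≥0∞) :
    lqNorm q (fun k => ∑ j ∈ Finset.range (k + 1), ρ ^ (k - j) * u j) ≤
      (1 - ρ)⁻¹ * lqNorm q u := by
  have h : ∀ k, ∑ j ∈ Finset.range (k + 1), ρ ^ (k - j) * u j =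
      ∑' n, ρ ^ n * (if n ≤ k then u (k - n) else 0) := by
    intro k
    rw [tsum_eq_sum (s := Finset.range (k + 1))]
    · rw [← Finset.sum_range_reflect]
      refine Finset.sum_congr rfl fun j hj => ?_
      have : j ≤ k := by simpa [Nat.lt_succ_iff] using hj
      rw [if_pos this]
      congr 2
      omega
    · intro n hn
      rw [if_neg (by simpa [Nat.lt_succ_iff] using hn), mul_zero]
  simp_rw [h]
  refine (lqNorm_tsum_le hq fun n k => ρ ^ n * (if n ≤ k then u (k - n) else 0)).trans ?_
  simp_rw [lqNorm_const_mul hq]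
  rw [← ENNReal.tsum_geometric, ← ENNReal.tsum_mul_right]
  gcongr with n
  exact lqNorm_shift_right_le hq u n

/-- With truncated subtraction, `(k - j) + (j - k)` is `|k - j|`. The kernel splits into `j ≤ k` and
`j > k`; each half costs one geometric series, whence the factor 2. -/
theorem lqNorm_young {q : ℝ≥0∞} (hq : 1 ≤ q) (ρ : ℝ≥0∞) (u : ℕ → ℝ≥0∞) :
    lqNorm q (fun k => ∑' j, ρ ^ ((k - j) + (j - k)) * u j) ≤
      2 * (1 - ρ)⁻¹ * lqNorm q u := by
  have h : ∀ k, ∑' j, ρ ^ ((k - j) + (j - k)) * u j ≤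
      ((fun k => ∑ j ∈ Finset.range (k + 1), ρ ^ (k - j) * u j) +
        fun k => ∑' n, ρ ^ n * u (k + n)) k := by
    intro k
    rw [← ENNReal.summable.sum_add_tsum_nat_add' (f := fun j => ρ ^ ((k - j) + (j - k)) * u j)
      (k := k + 1)]
    refine add_le_add (Finset.sum_le_sum fun j hj => ?_) ?_
    · have : j ≤ k := by simpa [Nat.lt_succ_iff] using hj
      rw [Nat.sub_eq_zero_of_le this, add_zero]
    -- The diagonal already belongs to the other half, so only the terms `n + 1` of the upward
    -- series occur; they are bounded by the whole series.
    · refine le_trans (le_of_eq ?_) (ENNReal.tsum_comp_le_tsum_of_injective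
        (add_left_injective 1) fun n => ρ ^ n * u (k + n))
      refine tsum_congr fun n => ?_
      have e : (k - (n + (k + 1))) + (n + (k + 1) - k) = n + 1 := by omega
      have e' : n + (k + 1) = k + (n + 1) := by omega
      change ρ ^ ((k - (n + (k + 1))) + (n + (k + 1) - k)) * u (n + (k + 1)) =
        ρ ^ (n + 1) * u (k + (n + 1))
      rw [e, e']
  refine (lqNorm_mono h).trans ((lqNorm_add_le hq _ _).trans ?_)
  calc _ ≤ (1 - ρ)⁻¹ * lqNorm q u + (1 - ρ)⁻¹ * lqNorm q u :=
        add_le_add (lqNorm_young_down hq ρ u) (lqNorm_young_up hq ρ u)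
    _ = _ := by ring

/-- Hölder's inequality on a subset of the index set. -/
theorem tsum_le_encard_rpow_mul {ι : Type*} {p : ℝ} (hp : 1 ≤ p) (A : Set ι) (x : ι → ℝ≥0∞)
    (hx : ∀ i, i ∉ A → x i = 0) :
    ∑' i, x i ≤ (A.encard : ℝ≥0∞) ^ (1 - 1 / p) * (∑' i, x i ^ p) ^ (1 / p) := by
  have hp0 : 0 < p := by linarith
  -- For `p = 1` the exponent is `0` and the first factor is `1`, even when `A` is infinite.
  rcases hp.eq_or_lt with rfl | hp1
  · simp
  by_cases h0 : ∀ i, x i = 0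
  · simp [h0]
  push Not at h0
  obtain ⟨i₀, hi₀⟩ := h0
  have hpos : (∑' i, x i ^ p) ^ (1 / p) ≠ 0 := by
    have h1 : x i₀ ^ p ≤ ∑' i, x i ^ p := ENNReal.le_tsum i₀
    have h2 : 0 < x i₀ ^ p := ENNReal.rpow_pos_of_nonneg (pos_iff_ne_zero.2 hi₀) hp0.le
    exact (ENNReal.rpow_pos_of_nonneg (h2.trans_le h1) (by positivity)).ne'
  have hexp : 0 < 1 - 1 / p := by
    rw [sub_pos, div_lt_one hp0]
    exact hp1
  by_cases hA : A.Finite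
  · have hsup : ∀ i, i ∉ hA.toFinset → x i = 0 := fun i hi => hx i (by simpa using hi)
    rw [tsum_eq_sum (s := hA.toFinset) hsup, tsum_eq_sum (s := hA.toFinset)
      (fun i hi => by rw [hsup i hi, ENNReal.zero_rpow_of_pos hp0])]
    have h := ENNReal.rpow_sum_le_const_mul_sum_rpow hA.toFinset x hp
    rw [hA.encard_eq_coe_toFinset_card]
    have h' := ENNReal.rpow_le_rpow h (show 0 ≤ 1 / p by positivity)
    rw [← ENNReal.rpow_mul, mul_one_div_cancel hp0.ne', ENNReal.rpow_one,
      ENNReal.mul_rpow_of_nonneg _ _ (by positivity), ← ENNReal.rpow_mul] at h'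
    have e : (p - 1) * (1 / p) = 1 - 1 / p := by field_simp
    rw [e] at h'
    simpa using h'
  -- Here the exponent and the second factor are positive, so the right-hand side is infinite.
  · have : A.encard = ⊤ := by simpa using hA
    rw [this]
    simp only [ENat.toENNReal_top]
    rw [ENNReal.top_rpow_of_pos hexp, ENNReal.top_mul hpos]
    exact le_top

/-! ## Series of functions in `L^p` -/

section LpSeries

variable {I : Type*} [MeasurableSpace I] {m : Measure I}

theorem enorm_tsum_le {ι : Type*} (u : ι → ℂ) : ‖∑' i, u i‖ₑ ≤ ∑' i, ‖u i‖ₑ := by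
  by_cases h : ∑' i, ‖u i‖ₑ = ∞
  · rw [h]
    exact le_top
  · exact enorm_tsum_le_tsum_enorm

/-- Fubini's theorem for an absolutely convergent double series. -/
theorem tsum_comm_of_tsum_enorm_ne_top {ι κ : Type*} (u : ι → κ → ℂ)
    (h : ∑' k, ∑' i, ‖u i k‖ₑ ≠ ∞) :
    Summable (fun i => ‖∑' k, u i k‖) ∧ ∑' i, ∑' k, u i k = ∑' k, ∑' i, u i k := by
  rw [ENNReal.tsum_comm] at h
  constructor
  · rw [← tsum_enorm_ne_top_iff_summable_norm]
    exact ne_top_of_le_ne_top h (ENNReal.tsum_le_tsum fun i => enorm_tsum_le _)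
  · have hs : Summable (Function.uncurry u) := by
      refine Summable.of_norm (tsum_enorm_ne_top_iff_summable_norm.1 ?_)
      rwa [← ENNReal.tsum_prod (f := fun i k => ‖u i k‖ₑ)] at h
    exact hs.tsum_comm.symm

/-- When the right-hand side is finite the series converges absolutely almost everywhere, and the
bound on finite sums passes to the pointwise limit by Fatou's lemma. -/
theorem eLpNorm_tsum_le {E ι : Type*} [NormedAddCommGroup E] [CompleteSpace E] [Countable ι] {p : ℝ≥0∞} (hp : 1 ≤ p)
    {u : ι → I → E} (hu : ∀ i, AEStronglyMeasurable (u i) m) :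
    eLpNorm (fun x => ∑' i, u i x) p m ≤ ∑' i, eLpNorm (u i) p m := by
  by_cases hs : ∑' i, eLpNorm (u i) p m = ∞
  · rw [hs]
    exact le_top
  refine Lp.eLpNorm_le_of_ae_tendsto (u := atTop) (f := fun (s : Finset ι) x => ∑ i ∈ s, u i x)
    (Eventually.of_forall fun s => ?_)
    (fun s => Finset.aestronglyMeasurable_fun_sum s fun i _ => hu i) ?_
  · have : (fun x => ∑ i ∈ s, u i x) = ∑ i ∈ s, u i := by
      ext x
      simp
    rw [this]
    exact (eLpNorm_sum_le (fun i _ => hu i) hp).trans (ENNReal.sum_le_tsum s)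
  · filter_upwards [summable_norm_of_tsum_eLpNorm_ne_top hp hu hs] with x hx
    exact hx.of_norm.hasSum

theorem aestronglyMeasurable_tsum {E ι : Type*} [NormedAddCommGroup E] [Countable ι] {u : ι → I → E}
    (hu : ∀ i, AEStronglyMeasurable (u i) m) (hs : ∀ᵐ x ∂m, Summable fun i => u i x) :
    AEStronglyMeasurable (fun x => ∑' i, u i x) m := by
  refine aestronglyMeasurable_of_tendsto_ae (u := atTop)
    (f := fun (s : Finset ι) x => ∑ i ∈ s, u i x)
    (fun s => Finset.aestronglyMeasurable_fun_sum s fun i _ => hu i) ?_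
  filter_upwards [hs] with x hx
  exact hx.hasSum

theorem memLp_tsum {ι : Type*} [Countable ι] {p : ℝ≥0∞} (hp : 1 ≤ p)
    {u : ι → I → ℂ} (hu : ∀ i, AEStronglyMeasurable (u i) m)
    (hs : ∑' i, eLpNorm (u i) p m ≠ ∞) : MemLp (fun x => ∑' i, u i x) p m := by
  refine ⟨aestronglyMeasurable_tsum hu ?_, (eLpNorm_tsum_le hp hu).trans_lt hs.lt_top⟩
  filter_upwards [summable_norm_of_tsum_eLpNorm_ne_top hp hu hs] with x hx
  exact hx.of_norm

theorem tendsto_eLpNorm_tsum_sub {p : ℝ≥0∞} (hp : 1 ≤ p)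
    {u : ℕ → I → ℂ} (hu : ∀ i, AEStronglyMeasurable (u i) m)
    (hs : ∑' i, eLpNorm (u i) p m ≠ ∞) :
    Tendsto (fun n => eLpNorm (fun x => ∑' i, u i x - ∑ k ∈ Finset.range n, u k x) p m) atTop
      (𝓝 0) := by
  refine tendsto_of_tendsto_of_tendsto_of_le_of_le tendsto_const_nhds
    (ENNReal.tendsto_sum_nat_add (fun i => eLpNorm (u i) p m) hs) (fun _ => zero_le) fun n => ?_
  refine le_trans (le_of_eq (eLpNorm_congr_ae ?_)) (eLpNorm_tsum_le hp fun i => hu (i + n))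
  filter_upwards [summable_norm_of_tsum_eLpNorm_ne_top hp hu hs] with x hx
  rw [← hx.of_norm.sum_add_tsum_nat_add n]
  ring

/-- Limits in `L^p` are unique. -/
theorem ae_eq_of_tendsto_eLpNorm_sub {p : ℝ≥0∞} (hp : 1 ≤ p) {f g : I → ℂ} {S : ℕ → I → ℂ}
    (hf : AEStronglyMeasurable f m) (hg : AEStronglyMeasurable g m)
    (hS : ∀ n, AEStronglyMeasurable (S n) m)
    (h1 : Tendsto (fun n => eLpNorm (fun x => f x - S n x) p m) atTop (𝓝 0))
    (h2 : Tendsto (fun n => eLpNorm (fun x => g x - S n x) p m) atTop (𝓝 0)) : f =ᵐ[m] g := by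
  have h := h1.add h2
  rw [add_zero] at h
  have h0 : eLpNorm (f - g) p m ≤ 0 := by
    refine ge_of_tendsto' h fun n => ?_
    have : f - g = (fun x => f x - S n x) - fun x => g x - S n x := by
      ext x
      simp
    rw [this]
    exact eLpNorm_sub_le (hf.sub (hS n)) (hg.sub (hS n)) hp
  rw [nonpos_iff_eq_zero, eLpNorm_eq_zero_iff (hf.sub hg) (zero_lt_one.trans_le hp).ne'] at h0
  filter_upwards [h0] with x hx
  exact sub_eq_zero.1 hx

end LpSeries

section

variable {I : Type*} [MeasurableSpace I] {m : Measure I}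

/-! ## Norms of nonnegative coefficient families -/

/-- `levelNorm` for families with values in `[0, ∞]`. -/
def eLevelNorm (P : Grid m) (p : ℝ) (y : Set I → ℝ≥0∞) (k : ℕ) : ℝ≥0∞ :=
  (∑ Q ∈ P.level k, y Q ^ p) ^ (1 / p)

/-- `coefNorm` for families with values in `[0, ∞]`. -/
def eCoefNorm (P : Grid m) (p : ℝ) (q : ℝ≥0∞) (y : Set I → ℝ≥0∞) : ℝ≥0∞ :=
  lqNorm q (eLevelNorm P p y)

theorem eLevelNorm_enorm (P : Grid m) (p : ℝ) (c : Set I → ℂ) :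
    eLevelNorm P p (fun Q => ‖c Q‖ₑ) = levelNorm P p c := rfl

theorem eLevelNorm_mono (P : Grid m) {p : ℝ} (hp : 1 ≤ p) {y z : Set I → ℝ≥0∞} {k : ℕ}
    (h : ∀ Q ∈ P.level k, y Q ≤ z Q) : eLevelNorm P p y k ≤ eLevelNorm P p z k := by
  unfold eLevelNorm
  gcongr with Q hQ
  exact h Q hQ

theorem eLevelNorm_tsum_le {ι : Type*} (P : Grid m) {p : ℝ} (hp : 1 ≤ p)
    (y : ι → Set I → ℝ≥0∞) (k : ℕ) :
    eLevelNorm P p (fun Q => ∑' i, y i Q) k ≤ ∑' i, eLevelNorm P p (y i) k :=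
  finset_Lp_tsum_le _ hp y

theorem eLevelNorm_add_le (P : Grid m) {p : ℝ} (hp : 1 ≤ p) (y z : Set I → ℝ≥0∞) (k : ℕ) :
    eLevelNorm P p (fun Q => y Q + z Q) k ≤ eLevelNorm P p y k + eLevelNorm P p z k :=
  ENNReal.Lp_add_le _ _ _ hp

theorem eLevelNorm_const_mul (P : Grid m) {p : ℝ} (hp : 1 ≤ p) (a : ℝ≥0∞) (y : Set I → ℝ≥0∞)
    (k : ℕ) : eLevelNorm P p (fun Q => a * y Q) k = a * eLevelNorm P p y k := by
  have hp0 : 0 < p := by linarith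
  simp only [eLevelNorm, ENNReal.mul_rpow_of_nonneg _ _ hp0.le]
  rw [← Finset.mul_sum, ENNReal.mul_rpow_of_nonneg _ _ (by positivity), ← ENNReal.rpow_mul,
    mul_one_div_cancel hp0.ne', ENNReal.rpow_one]

theorem le_eLevelNorm (P : Grid m) {p : ℝ} (hp : 1 ≤ p) (y : Set I → ℝ≥0∞) {k : ℕ} {Q : Set I}
    (hQ : Q ∈ P.level k) : y Q ≤ eLevelNorm P p y k := by
  have hp0 : 0 < p := by linarith
  calc y Q = (y Q ^ p) ^ (1 / p) := by
        rw [← ENNReal.rpow_mul, mul_one_div_cancel hp0.ne', ENNReal.rpow_one]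
    _ ≤ _ := ENNReal.rpow_le_rpow
        (Finset.single_le_sum (f := fun Q => y Q ^ p) (fun _ _ => zero_le) hQ) (by positivity)

theorem eLevelNorm_rpow (P : Grid m) {p : ℝ} (hp : 1 ≤ p) (y : Set I → ℝ≥0∞) (k : ℕ) :
    eLevelNorm P p y k ^ p = ∑ Q ∈ P.level k, y Q ^ p := by
  have hp0 : 0 < p := by linarith
  rw [eLevelNorm, ← ENNReal.rpow_mul, one_div_mul_cancel hp0.ne', ENNReal.rpow_one]

theorem eCoefNorm_mono (P : Grid m) {p : ℝ} (hp : 1 ≤ p) (q : ℝ≥0∞) {y z : Set I → ℝ≥0∞}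
    (h : ∀ Q ∈ P.cells, y Q ≤ z Q) : eCoefNorm P p q y ≤ eCoefNorm P p q z :=
  lqNorm_mono fun k => eLevelNorm_mono P hp fun Q hQ => h Q ⟨k, hQ⟩

theorem eCoefNorm_tsum_le {ι : Type*} (P : Grid m) {p : ℝ} {q : ℝ≥0∞} (hp : 1 ≤ p) (hq : 1 ≤ q)
    (y : ι → Set I → ℝ≥0∞) :
    eCoefNorm P p q (fun Q => ∑' i, y i Q) ≤ ∑' i, eCoefNorm P p q (y i) :=
  (lqNorm_mono fun k => eLevelNorm_tsum_le P hp y k).trans (lqNorm_tsum_le hq _)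

theorem lt_top_of_eCoefNorm_lt_top {P : Grid m} {p : ℝ} {q : ℝ≥0∞} (hp : 1 ≤ p) (hq : 1 ≤ q)
    {y : Set I → ℝ≥0∞} (h : eCoefNorm P p q y < ∞) {Q : Set I} (hQ : Q ∈ P.cells) : y Q < ∞ := by
  obtain ⟨k, hk⟩ := hQ
  exact ((le_eLevelNorm P hp y hk).trans (le_lqNorm hq _ k)).trans_lt h

/-! ## Combinatorics of good grids -/

namespace Grid.IsGood

variable {P : Grid m} {c₁ c₂ : ℝ}

theorem c₂_pos (hP : P.IsGood c₁ c₂) : 0 < c₂ := hP.c₁_pos.trans hP.c₁_lt_c₂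

theorem nonempty_of_mem_level {P : Grid m} {k : ℕ} {Q : Set I} (hQ : Q ∈ P.level k) :
    Q.Nonempty :=
  nonempty_of_measure_ne_zero (P.pos k Q hQ).ne'

theorem real_pos [IsFiniteMeasure m] {P : Grid m} {k : ℕ} {Q : Set I} (hQ : Q ∈ P.level k) :
    0 < m.real Q :=
  ENNReal.toReal_pos (P.pos k Q hQ).ne' (measure_ne_top _ _)

theorem eq_of_inter (hP : P.IsGood c₁ c₂) {k : ℕ} {Q R : Set I} (hQ : Q ∈ P.level k)
    (hR : R ∈ P.level k) {x : I} (hx : x ∈ Q) (hx' : x ∈ R) : Q = R := by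
  by_contra h
  exact Set.disjoint_left.1 (hP.disjoint k Q hQ R hR h) hx hx'

theorem exists_ancestor [IsFiniteMeasure m] (hP : P.IsGood c₁ c₂) (k n : ℕ) :
    ∀ Q ∈ P.level (k + n), ∃ R ∈ P.level k, Q ⊆ R ∧ m.real Q ≤ c₂ ^ n * m.real R := by
  induction n with
  | zero => exact fun Q hQ => ⟨Q, hQ, subset_rfl, by simp⟩
  | succ n ih =>
    intro Q hQ
    obtain ⟨R, hR, hQR⟩ := hP.nested (k + n) Q hQ
    obtain ⟨S, hS, hRS, hle⟩ := ih R hR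
    refine ⟨S, hS, hQR.trans hRS, ?_⟩
    have h := (hP.ratio _ Q hQ R hR hQR).2
    rw [div_le_iff₀ (real_pos hR)] at h
    calc m.real Q ≤ c₂ * m.real R := h
      _ ≤ c₂ * (c₂ ^ n * m.real S) := by gcongr; exact hP.c₂_pos.le
      _ = _ := by ring

/-- If `S ⊆ Q` with `Q` of strictly finer level, then `S` is the ancestor of `Q` at its own level,
so `|S| ≤ |Q| ≤ c₂^(n+1) |S| < |S|`. In particular a cell has only one level, although levels are
merely indexed families of sets. -/
theorem level_le_of_subset [IsFiniteMeasure m] (hP : P.IsGood c₁ c₂) {j k : ℕ} {S Q : Set I}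
    (hS : S ∈ P.level j) (hQ : Q ∈ P.level k) (h : S ⊆ Q) : k ≤ j := by
  by_contra! hlt
  obtain ⟨n, rfl⟩ := Nat.exists_eq_add_of_lt hlt
  obtain ⟨R, hR, hQR, hle⟩ := hP.exists_ancestor j (n + 1) Q hQ
  obtain ⟨x, hx⟩ := nonempty_of_mem_level hS
  have hSR := hP.eq_of_inter hS hR hx (hQR (h hx))
  subst hSR
  have h1 : m.real S ≤ m.real Q := measureReal_mono h
  have h2 : c₂ ^ (n + 1) < 1 := pow_lt_one₀ hP.c₂_pos.le hP.c₂_lt_one (by simp)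
  have h3 := real_pos (m := m) hS
  nlinarith

theorem level_unique [IsFiniteMeasure m] (hP : P.IsGood c₁ c₂) {j k : ℕ} {Q : Set I}
    (hj : Q ∈ P.level j) (hk : Q ∈ P.level k) : j = k :=
  le_antisymm (hP.level_le_of_subset hk hj subset_rfl) (hP.level_le_of_subset hj hk subset_rfl)

theorem real_le_of_subset [IsFiniteMeasure m] (hP : P.IsGood c₁ c₂) {j k : ℕ} {S Q : Set I}
    (hS : S ∈ P.level j) (hQ : Q ∈ P.level k) (h : S ⊆ Q) :
    m.real S ≤ c₂ ^ (j - k) * m.real Q := by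
  obtain ⟨n, rfl⟩ := Nat.exists_eq_add_of_le (hP.level_le_of_subset hS hQ h)
  obtain ⟨R, hR, hSR, hle⟩ := hP.exists_ancestor k n S hS
  obtain ⟨x, hx⟩ := nonempty_of_mem_level hS
  rw [hP.eq_of_inter hQ hR (h hx) (hSR hx)]
  simpa using hle

theorem subset_or_disjoint [IsFiniteMeasure m] (hP : P.IsGood c₁ c₂) {j k : ℕ} {S Q : Set I}
    (hS : S ∈ P.level j) (hQ : Q ∈ P.level k) (hkj : k ≤ j) : S ⊆ Q ∨ Disjoint S Q := by
  obtain ⟨n, rfl⟩ := Nat.exists_eq_add_of_le hkj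
  obtain ⟨R, hR, hSR, -⟩ := hP.exists_ancestor k n S hS
  by_cases h : Q = R
  · exact Or.inl (h ▸ hSR)
  · exact Or.inr ((hP.disjoint k Q hQ R hR h).symm.mono_left hSR)

end Grid.IsGood

theorem Grid.countable_cells (P : Grid m) : P.cells.Countable := by
  have : P.cells = ⋃ k, (P.level k : Set (Set I)) := by
    ext Q
    simp [Grid.cells]
  rw [this]
  exact Set.countable_iUnion fun k => (P.level k).countable_toSet

/-! ## Functions supported on disjoint cells -/

/-- At most one term of the sum is nonzero. -/
theorem sum_rpow_of_disjoint {α : Type*} (t : Finset α) {p : ℝ} (hp : 0 < p) (h : α → ℝ≥0∞)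
    (hd : ∀ a ∈ t, ∀ b ∈ t, h a ≠ 0 → h b ≠ 0 → a = b) :
    (∑ a ∈ t, h a) ^ p = ∑ a ∈ t, h a ^ p := by
  by_cases h0 : ∃ a ∈ t, h a ≠ 0
  · obtain ⟨a, ha, hne⟩ := h0
    have hz : ∀ b ∈ t, b ≠ a → h b = 0 := fun b hb hba => by
      by_contra hb0
      exact hba (hd b hb a ha hb0 hne)
    rw [Finset.sum_eq_single_of_mem a ha hz, Finset.sum_eq_single_of_mem a ha fun b hb hba => by
      rw [hz b hb hba, ENNReal.zero_rpow_of_pos hp]]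
  · push Not at h0
    rw [Finset.sum_eq_zero h0, ENNReal.zero_rpow_of_pos hp, Finset.sum_eq_zero fun a ha => by
      rw [h0 a ha, ENNReal.zero_rpow_of_pos hp]]

/-- The `L^p` norm of a sum of functions supported on the distinct cells of one level. -/
theorem eLpNorm_sum_le_of_disjoint {E : Type*} [NormedAddCommGroup E] {P : Grid m}
    (hP : P.DisjointLevels) {p : ℝ} (hp : 1 ≤ p)
    (k : ℕ) (F : Set I → I → E) (hF : ∀ W ∈ P.level k, AEStronglyMeasurable (F W) m)
    (hs : ∀ W ∈ P.level k, ∀ᵐ x ∂m, x ∉ W → F W x = 0) :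
    eLpNorm (fun x => ∑ W ∈ P.level k, F W x) (ENNReal.ofReal p) m ≤
      eLevelNorm P p (fun W => eLpNorm (F W) (ENNReal.ofReal p) m) k := by
  have hp0 : 0 < p := by linarith
  have hne : ENNReal.ofReal p ≠ 0 := by simpa using hp0
  rw [eLevelNorm]
  simp only [eLpNorm_eq_lintegral_rpow_enorm_toReal hne ENNReal.ofReal_ne_top,
    ENNReal.toReal_ofReal hp0.le]
  refine ENNReal.rpow_le_rpow ?_ (by positivity)
  simp only [← ENNReal.rpow_mul, one_div_mul_cancel hp0.ne', ENNReal.rpow_one]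
  rw [← lintegral_finsetSum' _ fun W hW => (hF W hW).enorm.pow_const p]
  refine lintegral_mono_ae ?_
  have hs' : ∀ᵐ x ∂m, ∀ W ∈ P.level k, x ∉ W → F W x = 0 :=
    (ae_ball_iff (P.level k).countable_toSet).2 hs
  filter_upwards [hs'] with x hx
  rw [← sum_rpow_of_disjoint _ hp0]
  · gcongr
    exact enorm_sum_le _ _
  · intro V hV W hW hV0 hW0
    have h1 : x ∈ V := by
      by_contra h
      exact hV0 (by rw [hx V hV h, enorm_zero])
    have h2 : x ∈ W := by
      by_contra h
      exact hW0 (by rw [hx W hW h, enorm_zero])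
    by_contra hne
    exact Set.disjoint_left.1 (hP k V hV W hW hne) h1 h2

/-! ## Representations as almost everywhere convergent series -/

/-- Absolute convergence in `L^p` forces absolute convergence of the blocks at almost every point,
and `L^p` limits are unique. Identities between represented functions can thus be checked pointwise,
and the coefficients determine the function. -/
theorem IsAtomicRep.ae_eq {P : Grid m} {p : ℝ} {q : ℝ≥0∞} (hp : 1 ≤ p) {b : Set I → I → ℂ}
    {c : Set I → ℂ} {f : I → ℂ} (hf : IsAtomicRep P p q b c f)
    (hb : ∀ Q ∈ P.cells, AEStronglyMeasurable (b Q) m) :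
    (∀ᵐ x ∂m, Summable fun k => ‖levelSum P b c k x‖) ∧
      f =ᵐ[m] fun x => ∑' k, levelSum P b c k x := by
  have hp1 : (1 : ℝ≥0∞) ≤ ENNReal.ofReal p := by simpa using hp
  have hm : ∀ k, AEStronglyMeasurable (levelSum P b c k) m := fun k =>
    Finset.aestronglyMeasurable_fun_sum _ fun Q hQ => (hb Q ⟨k, hQ⟩).const_mul _
  refine ⟨summable_norm_of_tsum_eLpNorm_ne_top hp1 hm hf.abs_conv.ne, ?_⟩
  refine ae_eq_of_tendsto_eLpNorm_sub hp1 hf.memLp.1 (memLp_tsum hp1 hm hf.abs_conv.ne).1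
    (S := fun n x => ∑ k ∈ Finset.range n, levelSum P b c k x) (fun n => ?_) hf.tendsto
    (tendsto_eLpNorm_tsum_sub hp1 hm hf.abs_conv.ne)
  exact Finset.aestronglyMeasurable_fun_sum _ fun k _ => hm k

theorem aestronglyMeasurable_souzaAtom {P : Grid m} (p s : ℝ) {Q : Set I} (hQ : Q ∈ P.cells) :
    AEStronglyMeasurable (souzaAtom m p s Q) m := by
  obtain ⟨k, hk⟩ := hQ
  exact aestronglyMeasurable_const.indicator (P.measurableSet k Q hk)

theorem IsRep.ae_eq {P : Grid m} {p s : ℝ} {q : ℝ≥0∞} (hp : 1 ≤ p)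
    {c : Set I → ℂ} {f : I → ℂ} (hf : IsRep P p q s c f) :
    (∀ᵐ x ∂m, Summable fun k => ‖levelSum P (souzaAtom m p s) c k x‖) ∧
      f =ᵐ[m] fun x => ∑' k, levelSum P (souzaAtom m p s) c k x :=
  IsAtomicRep.ae_eq hp hf fun _ hQ => aestronglyMeasurable_souzaAtom p s hQ

theorem isAtomicRep_tsum {P : Grid m} {p : ℝ} {q : ℝ≥0∞} (hp : 1 ≤ p) {b : Set I → I → ℂ}
    {c : Set I → ℂ} {f : I → ℂ}
    (hb : ∀ Q ∈ P.cells, AEStronglyMeasurable (b Q) m) (hc : coefNorm P p q c < ∞)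
    (hs : ∑' k, eLpNorm (levelSum P b c k) (ENNReal.ofReal p) m < ∞)
    (hf : f =ᵐ[m] fun x => ∑' k, levelSum P b c k x) : IsAtomicRep P p q b c f := by
  have hp1 : (1 : ℝ≥0∞) ≤ ENNReal.ofReal p := by simpa using hp
  have hm : ∀ k, AEStronglyMeasurable (levelSum P b c k) m := fun k =>
    Finset.aestronglyMeasurable_fun_sum _ fun Q hQ => (hb Q ⟨k, hQ⟩).const_mul _
  refine ⟨(memLp_congr_ae hf).2 (memLp_tsum hp1 hm hs.ne), hc, hs,
    (tendsto_eLpNorm_tsum_sub hp1 hm hs.ne).congr fun n => eLpNorm_congr_ae ?_⟩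
  filter_upwards [hf] with x hx
  rw [hx]

section Good

variable {P : Grid m} {c₁ c₂ : ℝ} {p s : ℝ} {q : ℝ≥0∞}

theorem Grid.IsGood.ofReal_rpow_lt_one (hP : P.IsGood c₁ c₂) (hs : 0 < s) :
    ENNReal.ofReal (c₂ ^ s) < 1 :=
  ENNReal.ofReal_lt_one.2 (Real.rpow_lt_one hP.c₂_pos.le hP.c₂_lt_one hs)

theorem inv_one_sub_lt_top {ρ : ℝ≥0∞} (h : ρ < 1) : (1 - ρ)⁻¹ < ∞ :=
  ENNReal.inv_lt_top.2 (tsub_pos_of_lt h)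

theorem tsum_pow_mul_eLevelNorm_le {ρ : ℝ≥0∞} (hq : 1 ≤ q) (y : Set I → ℝ≥0∞) :
    ∑' k, ρ ^ k * eLevelNorm P p y k ≤ (1 - ρ)⁻¹ * eCoefNorm P p q y := by
  rw [← ENNReal.tsum_geometric, ← ENNReal.tsum_mul_right]
  gcongr with k
  exact le_lqNorm hq _ k

theorem besovNormOn_smul_le (a : ℂ) (hp : 1 ≤ p) (hq : 1 ≤ q) (W : Set I) {f : I → ℂ}
    (hf : besovNormOn P p q s W f ≠ ∞) :
    besovNormOn P p q s W (a • f) ≤ ‖a‖ₑ * besovNormOn P p q s W f := by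
  have hne : Nonempty {c // IsRep P p q s c f ∧ ∀ Q ∈ P.cells, ¬ Q ⊆ W → c Q = 0} := by
    by_contra h
    rw [not_nonempty_iff] at h
    refine hf ?_
    unfold besovNormOn
    rw [iInf_subtype', iInf_of_empty]
  unfold besovNormOn
  simp only [iInf_subtype']
  rw [ENNReal.mul_iInf fun h => absurd h enorm_ne_top]
  refine le_iInf fun c => ?_
  rw [← coefNorm_smul P hp hq]
  refine iInf_le _ (⟨a • c.1, c.2.1.smul hp hq a, fun Q hQ hQW => ?_⟩ :
    {c // IsRep P p q s c (a • f) ∧ ∀ Q ∈ P.cells, ¬ Q ⊆ W → c Q = 0})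
  simp [c.2.2 Q hQ hQW]

variable [IsProbabilityMeasure m]

theorem tsum_eLpNorm_levelSum_lt_top (hP : P.IsGood c₁ c₂) (hp : 1 ≤ p) (hq : 1 ≤ q)
    (hs : 0 < s) {c : Set I → ℂ} (hc : coefNorm P p q c < ∞) :
    ∑' k, eLpNorm (levelSum P (souzaAtom m p s) c k) (ENNReal.ofReal p) m < ∞ :=
  ((ENNReal.tsum_le_tsum fun k => eLpNorm_levelSum_le hP hp hs c k).trans
    (tsum_pow_mul_eLevelNorm_le hq _)).trans_lt
    (ENNReal.mul_lt_top (inv_one_sub_lt_top (hP.ofReal_rpow_lt_one hs)) hc)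

theorem isRep_of_ae_eq (hP : P.IsGood c₁ c₂) (hp : 1 ≤ p) (hq : 1 ≤ q)
    (hs : 0 < s) {c : Set I → ℂ} (hc : coefNorm P p q c < ∞) {f : I → ℂ}
    (hf : f =ᵐ[m] fun x => ∑' k, levelSum P (souzaAtom m p s) c k x) : IsRep P p q s c f :=
  isAtomicRep_tsum hp (fun _ hQ => aestronglyMeasurable_souzaAtom p s hQ) hc
    (tsum_eLpNorm_levelSum_lt_top hP hp hq hs hc) hf

/-- For nonnegative coefficients there is no cancellation inside a block, since Souza atoms are
nonnegative. Absolute convergence of the blocks is then absolute convergence of the whole double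
series, which is what Fubini's theorem needs. -/
theorem ae_summable_souza (hP : P.IsGood c₁ c₂) (hp : 1 ≤ p) (hq : 1 ≤ q)
    (hs : 0 < s) {y : Set I → ℝ≥0∞} (hy : eCoefNorm P p q y < ∞) :
    ∀ᵐ x ∂m, ∑' k, ∑ Q ∈ P.level k, y Q * ‖souzaAtom m p s Q x‖ₑ < ∞ := by
  have hp1 : (1 : ℝ≥0∞) ≤ ENNReal.ofReal p := by simpa using hp
  set c : Set I → ℂ := fun Q => ((y Q).toReal : ℂ) with hc
  have hcy : ∀ Q ∈ P.cells, ‖c Q‖ₑ = y Q := by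
    intro Q hQ
    have := lt_top_of_eCoefNorm_lt_top hp hq hy hQ
    rw [hc, ← ofReal_norm, Complex.norm_real, Real.norm_of_nonneg (by positivity),
      ENNReal.ofReal_toReal this.ne]
  have hcn : coefNorm P p q c < ∞ := by
    refine lt_of_le_of_lt ?_ hy
    exact eCoefNorm_mono P hp q fun Q hQ => (hcy Q hQ).le
  have h := summable_norm_of_tsum_eLpNorm_ne_top hp1
    (fun k => aestronglyMeasurable_levelSum_souzaAtom P p s c k)
    (tsum_eLpNorm_levelSum_lt_top hP hp hq hs hcn).ne
  filter_upwards [h] with x hx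
  rw [← tsum_enorm_ne_top_iff_summable_norm] at hx
  refine lt_of_le_of_lt (le_of_eq ?_) hx.lt_top
  refine tsum_congr fun k => ?_
  have hpos : ∀ Q : Set I, souzaAtom m p s Q x =
      ((Q.indicator (fun _ => m.real Q ^ (s - 1 / p)) x : ℝ) : ℂ) := fun Q => by
      by_cases hQ : x ∈ Q <;> simp [souzaAtom, hQ]
  have hnn : ∀ Q : Set I, 0 ≤ Q.indicator (fun _ => m.real Q ^ (s - 1 / p)) x := fun Q =>
    Set.indicator_nonneg (fun _ _ => by positivity) x
  rw [levelSum]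
  simp only [hc, hpos, ← Complex.ofReal_mul, ← Complex.ofReal_sum]
  rw [← ofReal_norm, Complex.norm_real, Real.norm_of_nonneg
    (Finset.sum_nonneg fun Q _ => mul_nonneg ENNReal.toReal_nonneg (hnn Q)),
    ENNReal.ofReal_sum_of_nonneg fun Q _ => mul_nonneg ENNReal.toReal_nonneg (hnn Q)]
  refine Finset.sum_congr rfl fun Q hQ => ?_
  rw [ENNReal.ofReal_mul ENNReal.toReal_nonneg,
    ENNReal.ofReal_toReal (lt_top_of_eCoefNorm_lt_top hp hq hy ⟨k, hQ⟩).ne, ← ofReal_norm,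
    Complex.norm_real, Real.norm_of_nonneg (hnn Q)]

/-- Superposition of countably many representations. -/
theorem isRep_superposition (hP : P.IsGood c₁ c₂) (hp : 1 ≤ p) (hq : 1 ≤ q)
    (hs : 0 < s) {ι : Type*} [Countable ι] {c : ι → Set I → ℂ} {f : ι → I → ℂ}
    (hf : ∀ i, IsRep P p q s (c i) (f i))
    (hy : eCoefNorm P p q (fun Q => ∑' i, ‖c i Q‖ₑ) < ∞) :
    (∀ᵐ x ∂m, Summable fun i => ‖f i x‖) ∧
      IsRep P p q s (fun Q => ∑' i, c i Q) (fun x => ∑' i, f i x) ∧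
      coefNorm P p q (fun Q => ∑' i, c i Q) ≤ eCoefNorm P p q fun Q => ∑' i, ‖c i Q‖ₑ := by
  have hle : coefNorm P p q (fun Q => ∑' i, c i Q) ≤ eCoefNorm P p q fun Q => ∑' i, ‖c i Q‖ₑ :=
    eCoefNorm_mono P hp q fun Q _ => enorm_tsum_le _
  have hae : ∀ᵐ x ∂m, ∀ i, (Summable fun k => ‖levelSum P (souzaAtom m p s) (c i) k x‖) ∧
      f i x = ∑' k, levelSum P (souzaAtom m p s) (c i) k x := by
    rw [ae_all_iff]
    intro i
    obtain ⟨h1, h2⟩ := (hf i).ae_eq hp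
    filter_upwards [h1, h2] with x hx1 hx2 using ⟨hx1, hx2⟩
  have key : ∀ᵐ x ∂m, Summable (fun i => ‖f i x‖) ∧
      ∑' i, f i x = ∑' k, levelSum P (souzaAtom m p s) (fun Q => ∑' i, c i Q) k x := by
    filter_upwards [hae, ae_summable_souza hP hp hq hs hy] with x hx hfin
    have hf' : (fun i => f i x) = fun i => ∑' k, levelSum P (souzaAtom m p s) (c i) k x :=
      funext fun i => (hx i).2
    -- The dominating series has the coefficients `∑ᵢ ‖c i Q‖ₑ`; it is finite at this point.
    have hsum := tsum_comm_of_tsum_enorm_ne_top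
      (fun i k => levelSum P (souzaAtom m p s) (c i) k x) (ne_of_lt (by
        refine lt_of_le_of_lt (ENNReal.tsum_le_tsum fun k => ?_) hfin
        calc ∑' i, ‖levelSum P (souzaAtom m p s) (c i) k x‖ₑ
            ≤ ∑' i, ∑ Q ∈ P.level k, ‖c i Q‖ₑ * ‖souzaAtom m p s Q x‖ₑ := by
              refine ENNReal.tsum_le_tsum fun i => (enorm_sum_le _ _).trans ?_
              simp
          _ = ∑ Q ∈ P.level k, (∑' i, ‖c i Q‖ₑ) * ‖souzaAtom m p s Q x‖ₑ := by
              rw [Summable.tsum_finsetSum fun _ _ => ENNReal.summable]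
              simp only [ENNReal.tsum_mul_right]))
    rw [← hf'] at hsum
    refine ⟨by simpa only [← (hx _).2] using hsum.1, hsum.2.trans (tsum_congr fun k => ?_)⟩
    unfold levelSum
    rw [Summable.tsum_finsetSum]
    · exact Finset.sum_congr rfl fun Q hQ => tsum_mul_right
    · intro Q hQ
      refine Summable.mul_right _ (Summable.of_norm ?_)
      rw [← tsum_enorm_ne_top_iff_summable_norm]
      exact (lt_top_of_eCoefNorm_lt_top hp hq hy ⟨k, hQ⟩).ne
  refine ⟨key.mono fun x hx => hx.1, isRep_of_ae_eq hP hp hq hs (hle.trans_lt hy) ?_, hle⟩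
  exact key.mono fun x hx => hx.2

/-! ## Countable subadditivity of the norms -/

/-- Nearly optimal representations, with errors of total size at most `η`, are superposed; vanishing
of coefficients at cells not contained in `W` survives summation. -/
theorem besovNormOn_tsum_le (hP : P.IsGood c₁ c₂) (hp : 1 ≤ p) (hq : 1 ≤ q)
    (hs : 0 < s) {ι : Type*} [Countable ι] (W : Set I) (f : ι → I → ℂ) :
    besovNormOn P p q s W (fun x => ∑' i, f i x) ≤ ∑' i, besovNormOn P p q s W (f i) := by
  by_cases htop : ∑' i, besovNormOn P p q s W (f i) = ∞
  · rw [htop]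
    exact le_top
  refine ENNReal.le_of_forall_pos_le_add fun η hη _ => ?_
  obtain ⟨η', hη', hsum⟩ := ENNReal.exists_pos_sum_of_countable' (ENNReal.coe_pos.2 hη).ne' ι
  have hch : ∀ i, ∃ c, (IsRep P p q s c (f i) ∧ ∀ Q ∈ P.cells, ¬ Q ⊆ W → c Q = 0) ∧
      coefNorm P p q c ≤ besovNormOn P p q s W (f i) + η' i := by
    intro i
    have hlt : besovNormOn P p q s W (f i) < besovNormOn P p q s W (f i) + η' i :=
      ENNReal.lt_add_right (ENNReal.ne_top_of_tsum_ne_top htop i) (hη' i).ne'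
    conv_lhs at hlt => unfold besovNormOn
    simp only [iInf_lt_iff] at hlt
    obtain ⟨c, hc, hlt⟩ := hlt
    exact ⟨c, hc, hlt.le⟩
  choose c hc hcle using hch
  have hle : eCoefNorm P p q (fun Q => ∑' i, ‖c i Q‖ₑ) ≤
      ∑' i, besovNormOn P p q s W (f i) + η := by
    refine (eCoefNorm_tsum_le P hp hq fun i Q => ‖c i Q‖ₑ).trans ?_
    refine (ENNReal.tsum_le_tsum hcle).trans ?_
    rw [ENNReal.tsum_add]
    gcongr
  have hfin : ∑' i, besovNormOn P p q s W (f i) + η < ∞ :=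
    ENNReal.add_lt_top.2 ⟨lt_top_iff_ne_top.2 htop, ENNReal.coe_lt_top⟩
  obtain ⟨-, hrep, hle'⟩ := isRep_superposition hP hp hq hs (fun i => (hc i).1)
    (hle.trans_lt hfin)
  refine (iInf₂_le (fun Q => ∑' i, c i Q) ⟨hrep, fun Q hQ hQW => ?_⟩).trans (hle'.trans hle)
  simp [(hc _).2 Q hQ hQW]

end Good

end

/-! ## Besov atoms -/

section Atoms

variable {I : Type*} [MeasurableSpace I] {m : Measure I}

/-- For families with disjoint supports `p`-th powers add. This replaces the triangle inequality
whenever contributions of distinct cells of one level are combined, and keeps their `ℓ^p` norm. -/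
theorem eLevelNorm_finset_sum_of_disjoint {α : Type*} (P : Grid m) {p : ℝ} (hp : 1 ≤ p)
    (t : Finset α) (z : α → Set I → ℝ≥0∞) (j : ℕ)
    (hd : ∀ S ∈ P.level j, ∀ a ∈ t, ∀ b ∈ t, z a S ≠ 0 → z b S ≠ 0 → a = b) :
    eLevelNorm P p (fun S => ∑ a ∈ t, z a S) j = (∑ a ∈ t, eLevelNorm P p (z a) j ^ p) ^ (1 / p) := by
  have hp0 : 0 < p := by linarith
  simp only [eLevelNorm_rpow P hp]
  rw [Finset.sum_comm, eLevelNorm]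
  congr 1
  exact Finset.sum_congr rfl fun S hS => sum_rpow_of_disjoint t hp0 _ (hd S hS)

variable [IsProbabilityMeasure m] {P : Grid m} {c₁ c₂ : ℝ} {p s β : ℝ} {q : ℝ≥0∞}

/-- A Besov atom on a cell `W` of level `k` has a representation by Souza atoms whose coefficients
decay geometrically with the level. -/
theorem IsBesovAtom.exists_isRep (hP : P.IsGood c₁ c₂) (hp : 1 ≤ p) (hq : 1 ≤ q) (hs : 0 < s)
    (hβ : s < β) {k : ℕ} {W : Set I} (hW : W ∈ P.level k) {b : I → ℂ}
    (hb : IsBesovAtom P p q s β W b) :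
    ∃ c, IsRep P p q s c b ∧
      (∀ j, k ≤ j → levelNorm P p c j ≤ 2 * ENNReal.ofReal (c₂ ^ (β - s)) ^ (j - k)) ∧
      ∀ S ∈ P.cells, ¬ S ⊆ W → c S = 0 := by
  have hWpos : 0 < m.real W := Grid.IsGood.real_pos hW
  -- The infimum defining the norm need not be attained; the factor 2 leaves room for an actual
  -- representation.
  have hlt : besovNormOn P p q β W b < 2 * ENNReal.ofReal (m.real W ^ (s - β)) := by
    refine lt_of_le_of_lt hb ?_
    rw [two_mul]
    exact ENNReal.lt_add_right ENNReal.ofReal_ne_top (ENNReal.ofReal_pos.2 (by positivity)).ne'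
  unfold besovNormOn at hlt
  simp only [iInf_lt_iff] at hlt
  obtain ⟨e, ⟨he, heW⟩, hlt⟩ := hlt
  -- The same terms with exponent `s`, since `|S|^(β-1/p) = |S|^(β-s) |S|^(s-1/p)`. For `S ⊆ W` of
  -- level `j` the new factor is at most `(c₂^(j-k) |W|)^(β-s)`, which is the source of the decay.
  set c : Set I → ℂ := fun S => e S * ((m.real S ^ (β - s) : ℝ) : ℂ) with hc
  have hcn : ∀ S, ‖c S‖ₑ = ENNReal.ofReal (m.real S ^ (β - s)) * ‖e S‖ₑ := fun S => by
    rw [hc, enorm_mul, mul_comm, ← ofReal_norm (((m.real S ^ (β - s) : ℝ) : ℂ)),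
      Complex.norm_real, Real.norm_of_nonneg (by positivity)]
  have hcoef : coefNorm P p q c ≤ coefNorm P p q e := by
    refine eCoefNorm_mono P hp q fun S _ => ?_
    rw [hcn]
    refine mul_le_of_le_one_left zero_le (ENNReal.ofReal_le_one.2 ?_)
    exact Real.rpow_le_one (by positivity) measureReal_le_one (by linarith)
  refine ⟨c, ?_, fun j hkj => ?_, fun S hS hSW => by simp [hc, heW S hS hSW]⟩
  · refine isRep_of_ae_eq hP hp hq hs (hcoef.trans_lt he.coef_lt_top) ?_
    refine (he.ae_eq hp).2.trans (Eventually.of_forall fun x => tsum_congr fun j => ?_)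
    refine Finset.sum_congr rfl fun S hS => ?_
    have hSpos : 0 < m.real S := Grid.IsGood.real_pos hS
    by_cases hx : x ∈ S
    · simp only [souzaAtom, Set.indicator_of_mem hx, hc]
      rw [mul_assoc, ← Complex.ofReal_mul, ← Real.rpow_add hSpos]
      congr 3
      ring
    · simp [souzaAtom, hx]
  · have hle : ∀ S ∈ P.level j, ‖c S‖ₑ ≤
        ENNReal.ofReal ((c₂ ^ (j - k) * m.real W) ^ (β - s)) * ‖e S‖ₑ := by
      intro S hS
      by_cases hSW : S ⊆ W
      · rw [hcn]
        gcongr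
        exact hP.real_le_of_subset hS hW hSW
      · simp [hc, heW S ⟨j, hS⟩ hSW]
    calc levelNorm P p c j ≤ eLevelNorm P p
          (fun S => ENNReal.ofReal ((c₂ ^ (j - k) * m.real W) ^ (β - s)) * ‖e S‖ₑ) j :=
          eLevelNorm_mono P hp hle
      _ = ENNReal.ofReal ((c₂ ^ (j - k) * m.real W) ^ (β - s)) * levelNorm P p e j :=
          eLevelNorm_const_mul P hp _ _ j
      _ ≤ ENNReal.ofReal ((c₂ ^ (j - k) * m.real W) ^ (β - s)) *
          (2 * ENNReal.ofReal (m.real W ^ (s - β))) := by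
          gcongr
          exact (le_lqNorm hq _ j).trans hlt.le
      _ = 2 * ENNReal.ofReal (c₂ ^ (β - s)) ^ (j - k) := by
          have hc0 := hP.c₂_pos
          rw [mul_left_comm, ← ENNReal.ofReal_mul (by positivity),
            ← ENNReal.ofReal_pow (by positivity), Real.mul_rpow (by positivity) (by positivity),
            mul_assoc, ← Real.rpow_add hWpos]
          have h0 : β - s + (s - β) = 0 := by ring
          rw [h0, Real.rpow_zero, mul_one, ← Real.rpow_natCast, ← Real.rpow_natCast,
            ← Real.rpow_mul hc0.le, ← Real.rpow_mul hc0.le, mul_comm (β - s)]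

theorem levelNorm_eq_zero_of_lt (hP : P.IsGood c₁ c₂) (hp : 1 ≤ p) {j k : ℕ} (hjk : j < k)
    {W : Set I} (hW : W ∈ P.level k) {c : Set I → ℂ} (hc : ∀ S ∈ P.cells, ¬ S ⊆ W → c S = 0) :
    levelNorm P p c j = 0 := by
  have hp0 : 0 < p := by linarith
  have h : ∀ S ∈ P.level j, ‖c S‖ₑ ^ p = 0 := fun S hS => by
    rw [hc S ⟨j, hS⟩ fun hSW => absurd (hP.level_le_of_subset hS hW hSW) (by omega), enorm_zero,
      ENNReal.zero_rpow_of_pos hp0]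
  rw [levelNorm, Finset.sum_eq_zero h, ENNReal.zero_rpow_of_pos (by positivity)]

theorem IsBesovAtom.aestronglyMeasurable (hP : P.IsGood c₁ c₂) (hp : 1 ≤ p) (hq : 1 ≤ q)
    (hs : 0 < s) (hβ : s < β) {W : Set I} (hW : W ∈ P.cells) {b : I → ℂ}
    (hb : IsBesovAtom P p q s β W b) : AEStronglyMeasurable b m := by
  obtain ⟨k, hk⟩ := hW
  obtain ⟨c, hc, -⟩ := hb.exists_isRep hP hp hq hs hβ hk
  exact hc.memLp.1

theorem IsBesovAtom.ae_eq_zero (hP : P.IsGood c₁ c₂) (hp : 1 ≤ p) (hq : 1 ≤ q)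
    (hs : 0 < s) (hβ : s < β) {W : Set I} (hW : W ∈ P.cells) {b : I → ℂ}
    (hb : IsBesovAtom P p q s β W b) : ∀ᵐ x ∂m, x ∉ W → b x = 0 := by
  obtain ⟨k, hk⟩ := hW
  obtain ⟨c, hc, -, h0⟩ := hb.exists_isRep hP hp hq hs hβ hk
  filter_upwards [(hc.ae_eq hp).2] with x hx hxW
  rw [hx]
  refine (tsum_congr fun j => ?_).trans tsum_zero
  refine Finset.sum_eq_zero fun S hS => ?_
  by_cases hSW : S ⊆ W
  · rw [souzaAtom, Set.indicator_of_notMem fun h => hxW (hSW h), mul_zero]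
  · simp [h0 S ⟨j, hS⟩ hSW]

/-- Only levels `j ≥ k` carry coefficients, their level norms are at most 2, and the block of level
`j` costs `σ ^ j` with `σ = c₂ ^ s`. The geometric series therefore starts at `σ ^ k`. -/
theorem IsBesovAtom.eLpNorm_le (hP : P.IsGood c₁ c₂) (hp : 1 ≤ p) (hq : 1 ≤ q)
    (hs : 0 < s) (hβ : s < β) {k : ℕ} {W : Set I} (hW : W ∈ P.level k) {b : I → ℂ}
    (hb : IsBesovAtom P p q s β W b) :
    eLpNorm b (ENNReal.ofReal p) m ≤
      2 * (1 - ENNReal.ofReal (c₂ ^ s))⁻¹ * ENNReal.ofReal (c₂ ^ s) ^ k := by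
  have hp1 : (1 : ℝ≥0∞) ≤ ENNReal.ofReal p := by simpa using hp
  obtain ⟨c, hc, hcj, h0⟩ := hb.exists_isRep hP hp hq hs hβ hW
  set σ := ENNReal.ofReal (c₂ ^ s)
  have hρ : ENNReal.ofReal (c₂ ^ (β - s)) ≤ 1 := (hP.ofReal_rpow_lt_one (by linarith)).le
  rw [eLpNorm_congr_ae (hc.ae_eq hp).2]
  refine (eLpNorm_tsum_le hp1 fun j => aestronglyMeasurable_levelSum_souzaAtom P p s c j).trans ?_
  refine (ENNReal.tsum_le_tsum fun j => eLpNorm_levelSum_le hP hp hs c j).trans ?_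
  rw [← ENNReal.summable.sum_add_tsum_nat_add' (k := k), Finset.sum_eq_zero fun j hj => by
    rw [levelNorm_eq_zero_of_lt hP hp (by simpa using hj) hW h0, mul_zero], zero_add]
  calc ∑' n, σ ^ (n + k) * levelNorm P p c (n + k) ≤ ∑' n, σ ^ n * (2 * σ ^ k) := by
        refine ENNReal.tsum_le_tsum fun n => ?_
        have h2 : levelNorm P p c (n + k) ≤ 2 :=
          (hcj _ (by omega)).trans (mul_le_of_le_one_right zero_le (pow_le_one₀ zero_le hρ))
        calc σ ^ (n + k) * levelNorm P p c (n + k) ≤ σ ^ (n + k) * 2 := by gcongr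
          _ = _ := by ring
    _ = _ := by
        rw [ENNReal.tsum_mul_right, ENNReal.tsum_geometric]
        ring

/-- A family of multiples of Besov atoms, countably many on each cell, adds up to an atomic
representation with one atom per cell. -/
theorem exists_isAtomicRep_of_family (hP : P.IsGood c₁ c₂) (hp : 1 ≤ p) (hq : 1 ≤ q)
    (hs : 0 < s) (hβ : s < β) {ι : Type*} [Countable ι] (e : ι → Set I → ℂ)
    (b : ι → Set I → I → ℂ) (hb : ∀ i, ∀ W ∈ P.cells, IsBesovAtom P p q s β W (b i W))
    (hy : eCoefNorm P p q (fun W => ∑' i, ‖e i W‖ₑ) < ∞) :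
    (∀ᵐ x ∂m, ∑' k, ∑ W ∈ P.level k, ∑' i, ‖e i W * b i W x‖ₑ < ∞) ∧
    ∃ (B : Set I → I → ℂ) (d : Set I → ℂ), (∀ W ∈ P.cells, IsBesovAtom P p q s β W (B W)) ∧
      coefNorm P p q d ≤ eCoefNorm P p q (fun W => ∑' i, ‖e i W‖ₑ) ∧
      IsAtomicRep P p q B d fun x => ∑' k, ∑ W ∈ P.level k, ∑' i, e i W * b i W x := by
  have hp1 : (1 : ℝ≥0∞) ≤ ENNReal.ofReal p := by simpa using hp
  set y : Set I → ℝ≥0∞ := fun W => ∑' i, ‖e i W‖ₑ with hydef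
  have hyfin : ∀ W ∈ P.cells, y W < ∞ := fun W hW => lt_top_of_eCoefNorm_lt_top hp hq hy hW
  set σ := ENNReal.ofReal (c₂ ^ s)
  have hσ : σ < 1 := hP.ofReal_rpow_lt_one hs
  set K := 2 * (1 - σ)⁻¹
  have hK : K < ∞ := ENNReal.mul_lt_top (by simp) (inv_one_sub_lt_top hσ)
  have hbm : ∀ i, ∀ W ∈ P.cells, AEStronglyMeasurable (b i W) m := fun i W hW =>
    (hb i W hW).aestronglyMeasurable hP hp hq hs hβ hW
  have hvm : ∀ i, ∀ W ∈ P.cells, AEStronglyMeasurable (fun x => e i W * b i W x) m :=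
    fun i W hW => (hbm i W hW).const_mul _
  have hvn : ∀ k, ∀ W ∈ P.level k, ∑' i, eLpNorm (fun x => e i W * b i W x) (ENNReal.ofReal p) m ≤
      K * σ ^ k * y W := by
    intro k W hW
    rw [hydef, ← ENNReal.tsum_mul_left]
    refine ENNReal.tsum_le_tsum fun i => ?_
    have : (fun x => e i W * b i W x) = e i W • b i W := rfl
    rw [this, eLpNorm_const_smul, mul_comm]
    gcongr
    exact (hb i W ⟨k, hW⟩).eLpNorm_le hP hp hq hs hβ hW
  have hvtop : ∀ W ∈ P.cells, ∑' i, eLpNorm (fun x => e i W * b i W x) (ENNReal.ofReal p) m ≠ ∞ := by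
    rintro W ⟨k, hW⟩
    refine ne_top_of_le_ne_top ?_ (hvn k W hW)
    exact (ENNReal.mul_lt_top (ENNReal.mul_lt_top hK (ENNReal.pow_lt_top (hσ.trans_le le_top)))
      (hyfin W ⟨k, hW⟩)).ne
  have hsum : ∀ᵐ x ∂m, ∀ W ∈ P.cells, Summable fun i => ‖e i W * b i W x‖ :=
    (ae_ball_iff P.countable_cells).2 fun W hW =>
      summable_norm_of_tsum_eLpNorm_ne_top hp1 (fun i => hvm i W hW) (hvtop W hW)
  -- The sum of absolute values on `W`. Bounding its blocks in `L^p` gives absolute convergence over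
  -- family, cells and levels at once.
  set G : Set I → I → ℝ := fun W x => ∑' i, ‖e i W * b i W x‖ with hG
  have hGm : ∀ W ∈ P.cells, AEStronglyMeasurable (G W) m := fun W hW =>
    aestronglyMeasurable_tsum (fun i => (hvm i W hW).norm) (hsum.mono fun x hx => hx W hW)
  have hGnn : ∀ W x, 0 ≤ G W x := fun W x => tsum_nonneg fun i => norm_nonneg _
  have hGn : ∀ k, eLpNorm (fun x => ∑ W ∈ P.level k, G W x) (ENNReal.ofReal p) m ≤
      K * (σ ^ k * eLevelNorm P p y k) := by
    intro k
    refine (eLpNorm_sum_le_of_disjoint hP.disjoint hp k G (fun W hW => hGm W ⟨k, hW⟩)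
      fun W hW => ?_).trans ?_
    · filter_upwards [ae_all_iff.2 fun i =>
        (hb i W ⟨k, hW⟩).ae_eq_zero hP hp hq hs hβ ⟨k, hW⟩] with x hx hxW
      simp [hG, fun i => hx i hxW]
    · rw [← mul_assoc, ← eLevelNorm_const_mul P hp]
      refine eLevelNorm_mono P hp fun W hW => ?_
      refine (eLpNorm_tsum_le hp1 fun i => (hvm i W ⟨k, hW⟩).norm).trans ?_
      simp only [eLpNorm_norm]
      exact hvn k W hW
  have hGtop : ∑' k, eLpNorm (fun x => ∑ W ∈ P.level k, G W x) (ENNReal.ofReal p) m < ∞ := by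
    refine (ENNReal.tsum_le_tsum hGn).trans_lt ?_
    rw [ENNReal.tsum_mul_left]
    refine ENNReal.mul_lt_top hK ((tsum_pow_mul_eLevelNorm_le hq y).trans_lt ?_)
    exact ENNReal.mul_lt_top (inv_one_sub_lt_top hσ) hy
  refine ⟨?_, ?_⟩
  · have h := summable_norm_of_tsum_eLpNorm_ne_top hp1 (fun k =>
      Finset.aestronglyMeasurable_fun_sum _ fun W hW => hGm W ⟨k, hW⟩) hGtop.ne
    filter_upwards [h, hsum] with x hx hx'
    rw [← tsum_enorm_ne_top_iff_summable_norm] at hx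
    refine lt_of_le_of_lt (le_of_eq (tsum_congr fun k => ?_)) hx.lt_top
    rw [Real.enorm_eq_ofReal (Finset.sum_nonneg fun W _ => hGnn W x),
      ENNReal.ofReal_sum_of_nonneg fun W _ => hGnn W x]
    refine Finset.sum_congr rfl fun W hW => ?_
    rw [hG, ENNReal.ofReal_tsum_of_nonneg (fun i => norm_nonneg _) (hx' W ⟨k, hW⟩)]
    simp
  -- The coefficient is the total mass `∑ᵢ ‖e i W‖ₑ`, so `B W` has total weight at most one and is
  -- an atom by countable subadditivity. If the mass is zero, every `e i W` vanishes and `B W = 0`,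
  -- because `0⁻¹ = 0`.
  · set d : Set I → ℂ := fun W => ((y W).toReal : ℂ) with hd
    set B : Set I → I → ℂ := fun W x => ∑' i, (d W)⁻¹ * e i W * b i W x with hB
    have hdn : ∀ W ∈ P.cells, ‖d W‖ₑ = y W := fun W hW => by
      rw [hd, ← ofReal_norm, Complex.norm_real, Real.norm_of_nonneg (by positivity),
        ENNReal.ofReal_toReal (hyfin W hW).ne]
    have hdB : ∀ W ∈ P.cells, ∀ x, d W * B W x = ∑' i, e i W * b i W x := by
      intro W hW x
      by_cases h0 : d W = 0
      · have hy0 : y W = 0 := by rw [← hdn W hW, h0, enorm_zero]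
        rw [hydef, ENNReal.tsum_eq_zero] at hy0
        have he0 : ∀ i, e i W = 0 := fun i => enorm_eq_zero.1 (hy0 i)
        simp [he0, h0]
      · rw [hB, ← tsum_mul_left]
        refine tsum_congr fun i => ?_
        field_simp
    have hBatom : ∀ W ∈ P.cells, IsBesovAtom P p q s β W (B W) := by
      intro W hW
      unfold IsBesovAtom
      refine (besovNormOn_tsum_le hP hp hq (hs.trans hβ) W
        (fun i x => (d W)⁻¹ * e i W * b i W x)).trans ?_
      have hle : ∀ i, besovNormOn P p q β W (fun x => (d W)⁻¹ * e i W * b i W x) ≤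
          ‖(d W)⁻¹‖ₑ * ‖e i W‖ₑ * ENNReal.ofReal (m.real W ^ (s - β)) := by
        intro i
        have : (fun x => (d W)⁻¹ * e i W * b i W x) = ((d W)⁻¹ * e i W) • b i W := rfl
        rw [this, ← enorm_mul]
        refine (besovNormOn_smul_le _ hp hq W
          (ne_top_of_le_ne_top ENNReal.ofReal_ne_top (hb i W hW))).trans ?_
        gcongr
        exact hb i W hW
      refine (ENNReal.tsum_le_tsum hle).trans ?_
      rw [ENNReal.tsum_mul_right, ENNReal.tsum_mul_left]
      change ‖(d W)⁻¹‖ₑ * y W * _ ≤ _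
      refine mul_le_of_le_one_left zero_le ?_
      rw [← hdn W hW, ← enorm_mul]
      by_cases h0 : d W = 0
      · simp [h0]
      · rw [inv_mul_cancel₀ h0]
        simp
    have hlev : ∀ k x, levelSum P B d k x = ∑ W ∈ P.level k, ∑' i, e i W * b i W x :=
      fun k x => Finset.sum_congr rfl fun W hW => hdB W ⟨k, hW⟩ x
    have hdle : coefNorm P p q d ≤ eCoefNorm P p q y :=
      eCoefNorm_mono P hp q fun W hW => (hdn W hW).le
    refine ⟨B, d, hBatom, hdle, isAtomicRep_tsum hp
      (fun W hW => (hBatom W hW).aestronglyMeasurable hP hp hq hs hβ hW)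
      (hdle.trans_lt hy) ?_ ?_⟩
    · refine lt_of_le_of_lt (ENNReal.tsum_le_tsum fun k => ?_) hGtop
      refine eLpNorm_mono_ae ?_
      filter_upwards [hsum] with x hx
      rw [hlev, Real.norm_of_nonneg (Finset.sum_nonneg fun W _ => hGnn W x)]
      exact norm_sum_le_of_le _ fun W hW => norm_tsum_le_tsum_norm (hx W ⟨k, hW⟩)
    · exact Eventually.of_forall fun x => tsum_congr fun k => (hlev k x).symm

/-- Representations by Besov atoms can be converted into representations by Souza atoms. -/
theorem exists_isConversionConstant (hP : P.IsGood c₁ c₂) (hp : 1 ≤ p) (hq : 1 ≤ q)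
    (hs : 0 < s) (hβ : s < β) : ∃ C, IsConversionConstant P p q s β C := by
  set ρ := ENNReal.ofReal (c₂ ^ (β - s)) with hρdef
  have hρ : ρ < 1 := hP.ofReal_rpow_lt_one (by linarith)
  have hCtop : 2 * (1 - ρ)⁻¹ < ∞ := ENNReal.mul_lt_top (by simp) (inv_one_sub_lt_top hρ)
  -- The 2 comes from the representation of a single atom, the geometric sum from Young's inequality
  -- over the coarser levels `k ≤ j`.
  refine ⟨(2 * (1 - ρ)⁻¹).toReal, ENNReal.toReal_nonneg, fun d b f hb hf => ?_⟩
  rw [ENNReal.ofReal_toReal hCtop.ne]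
  have hch : ∀ i : Σ k, P.level k, ∃ c, IsRep P p q s c (b i.2) ∧
      (∀ j, i.1 ≤ j → levelNorm P p c j ≤ 2 * ρ ^ (j - i.1)) ∧
      ∀ S ∈ P.cells, ¬ S ⊆ i.2 → c S = 0 := fun i =>
    (hb i.2 ⟨i.1, i.2.2⟩).exists_isRep hP hp hq hs hβ i.2.2
  choose c hc hcn hc0 using hch
  have hlev : ∀ j k, k ≤ j → eLevelNorm P p
      (fun S => ∑ Q : P.level k, ‖d Q * c ⟨k, Q⟩ S‖ₑ) j ≤ 2 * ρ ^ (j - k) * levelNorm P p d k := by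
    intro j k hkj
    have hp0 : 0 < p := by linarith
    rw [eLevelNorm_finset_sum_of_disjoint P hp]
    · calc (∑ Q : P.level k, eLevelNorm P p (fun S => ‖d Q * c ⟨k, Q⟩ S‖ₑ) j ^ p) ^ (1 / p)
          ≤ (∑ Q : P.level k, (2 * ρ ^ (j - k) * ‖d Q‖ₑ) ^ p) ^ (1 / p) := by
            gcongr with Q
            simp only [enorm_mul]
            rw [eLevelNorm_const_mul P hp, mul_comm]
            gcongr
            exact hcn ⟨k, Q⟩ j hkj
        _ = eLevelNorm P p (fun Q => 2 * ρ ^ (j - k) * ‖d Q‖ₑ) k := by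
            rw [eLevelNorm, Finset.sum_coe_sort (P.level k) fun Q => (2 * ρ ^ (j - k) * ‖d Q‖ₑ) ^ p]
        _ = _ := eLevelNorm_const_mul P hp _ _ k
    -- A cell `S` lies in at most one cell of level `k`.
    · intro S hS Q _ R _ hQ hR
      have hsub : ∀ Q : P.level k, ‖d Q * c ⟨k, Q⟩ S‖ₑ ≠ 0 → S ⊆ Q := fun Q h => by
        by_contra hSQ
        exact h (by rw [hc0 ⟨k, Q⟩ S ⟨j, hS⟩ hSQ, mul_zero, enorm_zero])
      obtain ⟨x, hx⟩ := Grid.IsGood.nonempty_of_mem_level hS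
      exact Subtype.ext (hP.eq_of_inter Q.2 R.2 (hsub Q hQ hx) (hsub R hR hx))
  have hy : eCoefNorm P p q (fun S => ∑' i : Σ k, P.level k, ‖d i.2 * c i S‖ₑ) ≤
      2 * (1 - ρ)⁻¹ * coefNorm P p q d := by
    have h1 : ∀ j, eLevelNorm P p (fun S => ∑' i : Σ k, P.level k, ‖d i.2 * c i S‖ₑ) j ≤
        2 * ∑ k ∈ Finset.range (j + 1), ρ ^ (j - k) * levelNorm P p d k := by
      intro j
      calc eLevelNorm P p (fun S => ∑' i : Σ k, P.level k, ‖d i.2 * c i S‖ₑ) j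
          ≤ eLevelNorm P p (fun S => ∑' k, if k ∈ Finset.range (j + 1) then
              ∑ Q : P.level k, ‖d Q * c ⟨k, Q⟩ S‖ₑ else 0) j := by
            refine eLevelNorm_mono P hp fun S hS => ?_
            rw [ENNReal.tsum_sigma']
            refine ENNReal.tsum_le_tsum fun k => ?_
            rw [tsum_fintype]
            split_ifs with hk
            · exact le_rfl
            -- An atom of level `k > j` has no coefficient at level `j`.
            · refine (Finset.sum_eq_zero fun Q _ => ?_).le
              rw [hc0 ⟨k, Q⟩ S ⟨j, hS⟩ fun h => hk ?_, mul_zero, enorm_zero]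
              exact Finset.mem_range.2 (Nat.lt_succ_of_le (hP.level_le_of_subset hS Q.2 h))
        _ ≤ ∑' k, eLevelNorm P p (fun S => if k ∈ Finset.range (j + 1) then
              ∑ Q : P.level k, ‖d Q * c ⟨k, Q⟩ S‖ₑ else 0) j := eLevelNorm_tsum_le P hp _ j
        _ ≤ ∑' k, if k ∈ Finset.range (j + 1) then 2 * (ρ ^ (j - k) * levelNorm P p d k)
              else 0 := by
            refine ENNReal.tsum_le_tsum fun k => ?_
            split_ifs with hk
            · rw [← mul_assoc]
              exact hlev j k (by simpa [Nat.lt_succ_iff] using hk)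
            · have hp0 : 0 < p := by linarith
              simp [eLevelNorm, hp0]
        _ = _ := by
            rw [Finset.mul_sum, tsum_eq_sum (s := Finset.range (j + 1))
              fun k hk => if_neg hk]
            exact Finset.sum_congr rfl fun k hk => if_pos hk
    refine (lqNorm_mono h1).trans ?_
    rw [lqNorm_const_mul hq, mul_assoc]
    gcongr
    exact lqNorm_young_down hq ρ _
  have hfin : 2 * (1 - ρ)⁻¹ * coefNorm P p q d < ∞ := ENNReal.mul_lt_top hCtop hf.coef_lt_top
  obtain ⟨hsum, hrep, hle⟩ := isRep_superposition hP hp hq hs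
    (c := fun i S => d i.2 * c i S) (fun i => (hc i).smul hp hq (d i.2)) (hy.trans_lt hfin)
  refine ⟨_, hrep.congr ?_, hle.trans hy⟩
  have hbm : ∀ Q ∈ P.cells, AEStronglyMeasurable (b Q) m := fun Q hQ =>
    (hb Q hQ).aestronglyMeasurable hP hp hq hs hβ hQ
  filter_upwards [hsum, (hf.ae_eq hp hbm).2] with x hx hfx
  rw [hfx, hx.of_norm.tsum_sigma]
  refine tsum_congr fun k => ?_
  rw [tsum_fintype]
  exact Finset.sum_coe_sort (P.level k) fun Q => d Q * b Q x

end Atoms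

/-! ## The action of a single branch -/

section Branch

variable {I : Type*} [MeasurableSpace I] {m : Measure I} {P : Grid m} {c₁ c₂ : ℝ}

open Classical in
/-- The cells which make up a regular domain. -/
theorem IsRegularDomain.exists_pieces [IsProbabilityMeasure m] (hP : P.IsGood c₁ c₂)
    {α C c : ℝ} {Ω : Set I} (h : IsRegularDomain P α C c Ω) :
    ∃ M : Set (Set I), M ⊆ P.cells ∧ (∀ W ∈ M, W ⊆ Ω) ∧ (∀ x ∈ Ω, ∃ W ∈ M, x ∈ W) ∧
      (∀ W ∈ M, ∀ V ∈ M, ∀ x ∈ W, x ∈ V → W = V) ∧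
      (∀ k, ∀ W ∈ P.level k, W ∈ M → P.k0 Ω ≤ k) ∧
      ∀ k, P.k0 Ω ≤ k → ∑ W ∈ P.level k with W ∈ M, m.real W ^ α ≤
        C * c ^ (k - P.k0 Ω) * m.real Ω ^ α := by
  obtain ⟨F, hF, hΩ, hd, hsum⟩ := h
  refine ⟨{W | ∃ k, P.k0 Ω ≤ k ∧ W ∈ F k}, ?_, ?_, ?_, ?_, ?_, ?_⟩
  · rintro W ⟨k, hk, hW⟩
    exact ⟨k, hF k hk hW⟩
  · rintro W ⟨k, hk, hW⟩ x hx
    rw [hΩ]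
    simp only [Set.mem_iUnion]
    exact ⟨k, hk, W, hW, hx⟩
  · intro x hx
    rw [hΩ] at hx
    simp only [Set.mem_iUnion] at hx
    obtain ⟨k, hk, W, hW, hx⟩ := hx
    exact ⟨W, ⟨k, hk, hW⟩, hx⟩
  · rintro W ⟨k, hk, hW⟩ V ⟨l, hl, hV⟩ x hxW hxV
    by_contra hne
    exact Set.disjoint_left.1 (hd k hk l hl W hW V hV hne) hxW hxV
  · rintro k W hWk ⟨l, hl, hW⟩
    rwa [hP.level_unique hWk (hF l hl hW)]
  -- A cell of level `k` belonging to some `F l` belongs to `F k`, since its level is unique.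
  · intro k hk
    refine le_trans (Finset.sum_le_sum_of_subset_of_nonneg ?_ fun _ _ _ => by positivity)
      (hsum k hk)
    intro W hW
    rw [Finset.mem_filter] at hW
    obtain ⟨hWk, l, hl, hW⟩ := hW
    rwa [hP.level_unique hWk (hF l hl hW)]

theorem ae_comp_of_null_iff {A B : Set I} (hB : MeasurableSet B) (h : A → B)
    (hn : ∀ Q : Set I, MeasurableSet Q → Q ⊆ B → (m Q = 0 ↔ m (pullback h Q) = 0))
    {p : I → Prop} (hp : ∀ᵐ y ∂m, p y) : ∀ᵐ x ∂m, ∀ hx : x ∈ A, p (h ⟨x, hx⟩) := by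
  rw [ae_iff] at hp ⊢
  -- The null-set condition concerns measurable subsets of `B` only, so the exceptional set is
  -- enlarged to a measurable hull and cut down to `B`.
  have h1 : m (toMeasurable m {y | ¬ p y} ∩ B) = 0 :=
    measure_mono_null Set.inter_subset_left (by rw [measure_toMeasurable, hp])
  rw [hn _ ((measurableSet_toMeasurable _ _).inter hB) Set.inter_subset_right] at h1
  refine measure_mono_null (fun x hx => ?_) h1
  simp only [Set.mem_ofPred_eq, not_forall] at hx
  obtain ⟨hxA, hx⟩ := hx
  exact ⟨hxA, subset_toMeasurable m {y | ¬ p y} hx, (h ⟨x, hxA⟩).2⟩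

variable {Λ : Type*} {D : Dynamics (J := I) m Λ} {E : Exponents}

theorem Dynamics.IsAdmissible.ae_comp (hD : D.IsAdmissible E P P) (r : Λ) {p : I → Prop}
    (hp : ∀ᵐ y ∂m, p y) : ∀ᵐ x ∂m, ∀ hx : x ∈ D.Jset r, p (D.h r ⟨x, hx⟩) :=
  ae_comp_of_null_iff (hD.branch r).measurableSet_Ihat (D.h r) (hD.branch r).null_iff hp

theorem Dynamics.IsAdmissible.term_congr (hD : D.IsAdmissible E P P) (r : Λ) {f g : I → ℂ}
    (hfg : f =ᵐ[m] g) : D.term r f =ᵐ[m] D.term r g := by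
  filter_upwards [hD.ae_comp r hfg] with x hx
  unfold Dynamics.term extendZero
  split_ifs with h
  · change D.g r ⟨x, h⟩ * f (D.h r ⟨x, h⟩) = D.g r ⟨x, h⟩ * g (D.h r ⟨x, h⟩)
    rw [hx h]
  · rfl

theorem Dynamics.IsAdmissible.pullback_pos [IsFiniteMeasure m] (hD : D.IsAdmissible E P P)
    (r : Λ) {Q : Set I} (hQ : Q ∈ (D.grid r).cells) : 0 < m.real (pullback (D.h r) Q) := by
  have hB := hD.branch r
  obtain ⟨k, hk⟩ := hQ
  refine ENNReal.toReal_pos (fun h => ?_) (measure_ne_top _ _)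
  rw [← hB.null_iff Q ((D.grid r).measurableSet k Q hk) (hB.grid_subset Q ⟨k, hk⟩)] at h
  exact ((D.grid r).pos k Q hk).ne' h

theorem Dynamics.IsAdmissible.DRS2_pos (hD : D.IsAdmissible E P P) (r : Λ) : 0 < D.DRS2 E r :=
  lt_max_of_lt_left (Real.rpow_pos_of_pos (hD.consts_pos r).2.2.2.1 _)

theorem Dynamics.IsAdmissible.Θ_pos (hD : D.IsAdmissible E P P) (r : Λ) : 0 < D.Θ E r := by
  obtain ⟨h1, h2, h3, h4, h5⟩ := hD.consts_pos r
  have := hD.DRS2_pos r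
  unfold Dynamics.Θ
  positivity

theorem Dynamics.IsAdmissible.iSup_DRS2_nonneg (hD : D.IsAdmissible E P P) :
    0 ≤ ⨆ r, D.DRS2 E r :=
  Real.iSup_nonneg fun r => (hD.DRS2_pos r).le

theorem Dynamics.IsAdmissible.DRS2_le (hD : D.IsAdmissible E P P) (r : Λ) :
    D.DRS2 E r ≤ ⨆ r, D.DRS2 E r :=
  le_ciSup (f := D.DRS2 E) ⟨1, by rintro _ ⟨r, rfl⟩; exact (hD.DRS2_lt_one r).le⟩ r

/-- The contraction factor `λ ^ γ`, as an extended number. -/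
def Dynamics.ratio (D : Dynamics (J := I) m Λ) (E : Exponents) : ℝ≥0∞ :=
  ENNReal.ofReal ((⨆ r, D.DRS2 E r) ^ E.γ)

theorem Dynamics.IsAdmissible.iSup_rpow_lt_one (hD : D.IsAdmissible E P P) :
    (⨆ r, D.DRS2 E r) ^ E.γ < 1 :=
  Real.rpow_lt_one hD.iSup_DRS2_nonneg hD.iSup_DRS2_lt_one E.γ_pos

theorem Dynamics.IsAdmissible.ofReal_CD (hD : D.IsAdmissible E P P) :
    ENNReal.ofReal (D.CD E) = 2 * (1 - D.ratio E)⁻¹ := by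
  have h := hD.iSup_rpow_lt_one
  have h0 : 0 ≤ (⨆ r, D.DRS2 E r) ^ E.γ := Real.rpow_nonneg hD.iSup_DRS2_nonneg _
  rw [Dynamics.CD, div_eq_mul_inv, ENNReal.ofReal_mul zero_le_two,
    ENNReal.ofReal_inv_of_pos (by linarith), ENNReal.ofReal_sub _ h0]
  simp [Dynamics.ratio]

theorem Dynamics.IsAdmissible.CD_nonneg (hD : D.IsAdmissible E P P) : 0 ≤ D.CD E := by
  have h := hD.iSup_rpow_lt_one
  exact div_nonneg zero_le_two (by linarith)

theorem Exponents.p_pos (E : Exponents) : 0 < E.p := by linarith [E.one_le_p]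

/-- The decay of the distortion factors with the distance between the levels. -/
theorem Dynamics.IsAdmissible.scaling_le [IsFiniteMeasure m] (hD : D.IsAdmissible E P P) (r : Λ)
    {j k : ℕ} {Q : Set I} (hQ : Q ∈ (D.grid r).level j) (hk : P.k0 (pullback (D.h r) Q) ≤ k) :
    D.DRP r * (m.real Q / m.real (pullback (D.h r) Q)) ^ D.ε' r *
        (D.DGD1 r ^ (1 / E.p) * (D.DGD2 r ^ (1 / E.p)) ^ (k - P.k0 (pullback (D.h r) Q))) ≤
      D.Θ E r * ((⨆ r, D.DRS2 E r) ^ E.γ) ^ ((k - j) + (j - k)) := by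
  have hB := hD.branch r
  obtain ⟨hD1, hL1, hD2, hL2, hD3⟩ := hD.consts_pos r
  have hQc : Q ∈ (D.grid r).cells := ⟨j, hQ⟩
  have hΩ := hD.pullback_pos r hQc
  have hQpos : 0 < m.real Q := Grid.IsGood.real_pos hQ
  set Ω := pullback (D.h r) Q
  set κ := P.k0 Ω
  obtain ⟨n, rfl⟩ := Nat.exists_eq_add_of_le hk
  rw [Nat.add_sub_cancel_left]
  set L := D.DRS2 E r with hL
  have hLpos : 0 < L := hD.DRS2_pos r
  have hL1' : L ≤ 1 := (hD.DRS2_lt_one r).le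
  set t : ℝ := |(j : ℝ) - (κ : ℝ)| with ht
  have hk0 : ((D.grid r).k0 Q : ℝ) = j := by rw [hB.grid_k0 j Q hQ]
  have ha : D.a r ≤ t := by
    have := hB.le_scale Q hQc
    rwa [hk0] at this
  -- The scaling condition has exponent `ε_r / |ε_r|`, a sign; raising it to the power `ε = |ε_r|`
  -- restores `ε_r`.
  have hsc : (m.real Q / m.real Ω) ^ D.ε' r ≤ D.DC1 r ^ E.ε * L ^ t := by
    have h := hB.scaling Q hQc
    rw [hk0, hD.abs_ε' r] at h
    have h' := Real.rpow_le_rpow (by positivity) h E.ε_pos.le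
    rw [← Real.rpow_mul (by positivity), div_mul_cancel₀ _ E.ε_pos.ne',
      Real.mul_rpow (by positivity) (by positivity), ← Real.rpow_mul hL2.le] at h'
    refine h'.trans ?_
    gcongr
    rw [mul_comm, Real.rpow_mul hL2.le]
    exact Real.rpow_le_rpow (by positivity) (le_max_left _ _) (abs_nonneg _)
  have hgd : (D.DGD2 r ^ (1 / E.p)) ^ n ≤ L ^ (n : ℝ) := by
    rw [Real.rpow_natCast]
    gcongr
    exact le_max_right _ _
  -- Here `t + n` is the length of the path from `j` to `κ` and on to `k = κ + n`, so `t + n ≥ |j -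
  -- k|`; also `t + n ≥ a_r`. As `L ≤ 1`, the share `1 - γ` of the exponent uses the second bound
  -- and the share `γ` the first.
  have hpow : L ^ t * L ^ (n : ℝ) ≤
      L ^ (D.a r * (1 - E.γ)) * ((⨆ r, D.DRS2 E r) ^ E.γ) ^ ((κ + n - j) + (j - (κ + n))) := by
    have hdist : (((κ + n - j) + (j - (κ + n)) : ℕ) : ℝ) ≤ t + n := by
      have h1 := le_abs_self ((j : ℝ) - κ)
      have h2 := neg_abs_le ((j : ℝ) - κ)
      rcases le_total j (κ + n) with h | h
      · rw [Nat.sub_eq_zero_of_le h, add_zero, Nat.cast_sub h]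
        push_cast
        linarith
      · rw [Nat.sub_eq_zero_of_le h, zero_add, Nat.cast_sub h]
        push_cast
        have : (0 : ℝ) ≤ n := Nat.cast_nonneg n
        linarith
    rw [← Real.rpow_add hLpos]
    have hsplit : t + n = (t + n) * (1 - E.γ) + E.γ * (t + n) := by ring
    rw [hsplit, Real.rpow_add hLpos]
    refine mul_le_mul ?_ ?_ (by positivity) (by positivity)
    · refine Real.rpow_le_rpow_of_exponent_ge hLpos hL1' ?_
      have h1 : 0 ≤ 1 - E.γ := by linarith [E.γ_le_one]
      have h2 : (0 : ℝ) ≤ n := Nat.cast_nonneg n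
      gcongr
      linarith
    · rw [← Real.rpow_natCast, ← Real.rpow_mul hD.iSup_DRS2_nonneg]
      refine (Real.rpow_le_rpow_of_exponent_ge hLpos hL1'
        (mul_le_mul_of_nonneg_left hdist E.γ_pos.le)).trans ?_
      exact Real.rpow_le_rpow hLpos.le (hD.DRS2_le r) (mul_nonneg E.γ_pos.le (Nat.cast_nonneg _))
  calc D.DRP r * (m.real Q / m.real Ω) ^ D.ε' r *
        (D.DGD1 r ^ (1 / E.p) * (D.DGD2 r ^ (1 / E.p)) ^ n)
      ≤ D.DRP r * (D.DC1 r ^ E.ε * L ^ t) * (D.DGD1 r ^ (1 / E.p) * L ^ (n : ℝ)) := by gcongr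
    _ = D.DC1 r ^ E.ε * D.DRP r * D.DGD1 r ^ (1 / E.p) * (L ^ t * L ^ (n : ℝ)) := by ring
    _ ≤ D.DC1 r ^ E.ε * D.DRP r * D.DGD1 r ^ (1 / E.p) * (L ^ (D.a r * (1 - E.γ)) *
          ((⨆ r, D.DRS2 E r) ^ E.γ) ^ ((κ + n - j) + (j - (κ + n)))) := by gcongr
    _ = _ := by rw [Dynamics.Θ]; ring

open Classical in
/-- The image of a Souza atom under a branch is a combination of Besov atoms, whose coefficients
decay with the distance between the levels. -/
theorem Dynamics.IsAdmissible.exists_atoms [IsProbabilityMeasure m] (hP : P.IsGood c₁ c₂)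
    (hD : D.IsAdmissible E P P) (r : Λ) {j : ℕ} {Q : Set I} (hQ : Q ∈ (D.grid r).level j) :
    ∃ (e : Set I → ℂ) (b : Set I → I → ℂ),
      (∀ W ∈ P.cells, IsBesovAtom P E.p E.q E.s E.β W (b W)) ∧
      (∀ W, e W ≠ 0 → W ⊆ pullback (D.h r) Q) ∧
      (∀ k, levelNorm P E.p e k ≤
        ENNReal.ofReal (D.Θ E r) * D.ratio E ^ ((k - j) + (j - k))) ∧
      ∀ x, ∑' k, ∑ W ∈ P.level k, e W * b W x = D.term r (souzaAtom m E.p E.s Q) x := by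
  have hp0 := E.p_pos
  have hB := hD.branch r
  obtain ⟨hD1, hL1, hD2, hL2, hD3⟩ := hD.consts_pos r
  have hQc : Q ∈ (D.grid r).cells := ⟨j, hQ⟩
  have hΩ := hD.pullback_pos r hQc
  have hQpos : 0 < m.real Q := Grid.IsGood.real_pos hQ
  obtain ⟨M, hMc, hMΩ, hMx, hMu, hMk, hMs⟩ := (hB.regular Q hQc).exists_pieces hP
  set Ω := pullback (D.h r) Q with hΩdef
  set T : ℝ := m.real Q / m.real Ω with hT
  have hTpos : 0 < T := by positivity
  -- The normalization for which the potential condition reads `|g_r 1_W| ≤ A W * |W|^(s-β)` in the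
  -- `β`-norm on `W`, so that `(A W)⁻¹ g_r 1_W` is an atom.
  set A : Set I → ℝ := fun W =>
    D.DRP r * T ^ (1 / E.p - E.s + D.ε' r) * m.real W ^ (1 / E.p - E.s) with hA
  have hpos : ∀ W ∈ P.cells, 0 < m.real W := fun W ⟨k, hk⟩ => Grid.IsGood.real_pos hk
  have hApos : ∀ W ∈ P.cells, 0 < A W := fun W hW => by
    have := hpos W hW
    positivity
  set e : Set I → ℂ := fun W =>
    if W ∈ M then ((m.real Q ^ (E.s - 1 / E.p) * A W : ℝ) : ℂ) else 0 with he
  set b : Set I → I → ℂ := fun W =>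
    if W ∈ M then ((A W : ℂ)⁻¹) • W.indicator (extendZero (D.g r)) else 0 with hb
  refine ⟨e, b, fun W hW => ?_, fun W hW => ?_, fun k => ?_, fun x => ?_⟩
  · unfold IsBesovAtom
    by_cases hWM : W ∈ M
    · have hpot := hD.potential r W hW Q hQc ((hMΩ W hWM).trans fun x hx => hx.1)
        (hB.grid_subset Q hQc) (hMΩ W hWM)
      simp only [hb, if_pos hWM]
      refine (besovNormOn_smul_le _ E.one_le_p E.one_le_q W
        (ne_top_of_le_ne_top ENNReal.ofReal_ne_top hpot)).trans ?_
      have hAW := hApos W hW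
      have hWp := hpos W hW
      have hn : ‖((A W : ℂ)⁻¹)‖ₑ = ENNReal.ofReal (A W)⁻¹ := by
        rw [← Complex.ofReal_inv, ← ofReal_norm, Complex.norm_real,
          Real.norm_of_nonneg (by positivity)]
      rw [hn]
      refine (mul_le_mul_right hpot _).trans ?_
      rw [← ENNReal.ofReal_mul (by positivity)]
      refine ENNReal.ofReal_le_ofReal (le_of_eq ?_)
      have hexp : m.real W ^ (1 / E.p - E.β) =
          m.real W ^ (1 / E.p - E.s) * m.real W ^ (E.s - E.β) := by
        rw [← Real.rpow_add hWp]
        congr 1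
        ring
      rw [hexp]
      have h1 : m.real W ^ (1 / E.p - E.s) ≠ 0 := by positivity
      have h2 : T ^ (1 / E.p - E.s + D.ε' r) ≠ 0 := by positivity
      change (D.DRP r * T ^ (1 / E.p - E.s + D.ε' r) * m.real W ^ (1 / E.p - E.s))⁻¹ *
        (D.DRP r * T ^ (1 / E.p - E.s + D.ε' r) *
          (m.real W ^ (1 / E.p - E.s) * m.real W ^ (E.s - E.β))) = _
      field_simp
    · simp only [hb, if_neg hWM]
      refine (iInf₂_le (0 : Set I → ℂ)
        ⟨isRep_zero P E.one_le_p E.one_le_q, fun _ _ _ => rfl⟩).trans ?_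
      rw [coefNorm_zero P E.one_le_p E.one_le_q]
      exact zero_le
  · refine hMΩ W ?_
    by_contra h
    exact hW (by simp [he, h])
  · by_cases hk : P.k0 Ω ≤ k
    -- The powers `|Q|^(s-1/p)` and `|Q|^(1/p-s)` cancel, leaving `D₃ T^ε_r (|W|/|Ω|)^(1/p-s)`. Its
    -- `p`-th power contains `|W|^(1-sp)`, the quantity that regularity of `Ω` controls.
    · have hen : ∀ W ∈ P.level k, ‖e W‖ₑ ^ E.p = if W ∈ M then
          ENNReal.ofReal ((D.DRP r * T ^ D.ε' r) ^ E.p * (m.real Ω ^ (1 - E.s * E.p))⁻¹ *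
            m.real W ^ (1 - E.s * E.p)) else 0 := by
        intro W hW
        have hWp := hpos W ⟨k, hW⟩
        have hAW := hApos W ⟨k, hW⟩
        simp only [he]
        split_ifs
        · rw [← ofReal_norm, Complex.norm_real, Real.norm_of_nonneg (by positivity),
            ENNReal.ofReal_rpow_of_nonneg (by positivity) hp0.le]
          congr 1
          have h1 : m.real Q ^ (E.s - 1 / E.p) * A W = D.DRP r * T ^ D.ε' r *
              ((m.real Ω ^ (1 / E.p - E.s))⁻¹ * m.real W ^ (1 / E.p - E.s)) := by
            simp only [hA]
            rw [Real.rpow_add hTpos, hT, Real.div_rpow hQpos.le hΩ.le (1 / E.p - E.s)]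
            have h2 : m.real Q ^ (E.s - 1 / E.p) * m.real Q ^ (1 / E.p - E.s) = 1 := by
              rw [← Real.rpow_add hQpos]
              have : E.s - 1 / E.p + (1 / E.p - E.s) = 0 := by ring
              rw [this, Real.rpow_zero]
            calc _ = (m.real Q ^ (E.s - 1 / E.p) * m.real Q ^ (1 / E.p - E.s)) *
                  (D.DRP r * (m.real Q / m.real Ω) ^ D.ε' r *
                  ((m.real Ω ^ (1 / E.p - E.s))⁻¹ * m.real W ^ (1 / E.p - E.s))) := by
                  rw [div_eq_mul_inv (m.real Q ^ (1 / E.p - E.s))]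
                  ring
              _ = _ := by rw [h2, one_mul]
          have h3 : (1 / E.p - E.s) * E.p = 1 - E.s * E.p := by
            field_simp
          rw [h1, Real.mul_rpow (x := D.DRP r * T ^ D.ε' r) (by positivity) (by positivity),
            Real.mul_rpow (x := (m.real Ω ^ (1 / E.p - E.s))⁻¹) (by positivity) (by positivity),
            Real.inv_rpow (by positivity),
            ← Real.rpow_mul hΩ.le, ← Real.rpow_mul hWp.le, h3, mul_assoc]
        · simp [hp0]
      have hsum : ∑ W ∈ P.level k, ‖e W‖ₑ ^ E.p ≤
          ENNReal.ofReal ((D.DRP r * T ^ D.ε' r) ^ E.p *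
            (D.DGD1 r * D.DGD2 r ^ (k - P.k0 Ω))) := by
        rw [Finset.sum_congr rfl hen, ← Finset.sum_filter,
          ← ENNReal.ofReal_sum_of_nonneg fun W _ => by positivity, ← Finset.mul_sum]
        refine ENNReal.ofReal_le_ofReal ?_
        calc _ ≤ (D.DRP r * T ^ D.ε' r) ^ E.p * (m.real Ω ^ (1 - E.s * E.p))⁻¹ *
              (D.DGD1 r * D.DGD2 r ^ (k - P.k0 Ω) * m.real Ω ^ (1 - E.s * E.p)) := by
              gcongr
              exact hMs k hk
          _ = _ := by
              have : m.real Ω ^ (1 - E.s * E.p) ≠ 0 := by positivity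
              field_simp
      have hroot := ENNReal.rpow_le_rpow hsum (show 0 ≤ 1 / E.p by positivity)
      refine hroot.trans ?_
      rw [ENNReal.ofReal_rpow_of_nonneg (by positivity) (by positivity), Dynamics.ratio,
        ← ENNReal.ofReal_pow (Real.rpow_nonneg hD.iSup_DRS2_nonneg _),
        ← ENNReal.ofReal_mul (hD.Θ_pos r).le]
      refine ENNReal.ofReal_le_ofReal (le_trans (le_of_eq ?_) (hD.scaling_le r hQ hk))
      rw [Real.mul_rpow (by positivity) (by positivity), ← Real.rpow_mul (by positivity),
        mul_one_div_cancel hp0.ne', Real.rpow_one, Real.mul_rpow (by positivity) (by positivity),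
        ← Real.rpow_natCast, ← Real.rpow_natCast, ← Real.rpow_mul hL1.le, ← Real.rpow_mul hL1.le,
        mul_comm (1 / E.p)]
    · have h0 : ∀ W ∈ P.level k, ‖e W‖ₑ ^ E.p = 0 := fun W hW => by
        have : W ∉ M := fun h => hk (hMk k W hW h)
        simp [he, this, hp0]
      rw [levelNorm, Finset.sum_eq_zero h0, ENNReal.zero_rpow_of_pos (by positivity)]
      exact zero_le
  · have heb : ∀ W ∈ P.cells, e W * b W x = if W ∈ M then W.indicator
        (fun x => ((m.real Q ^ (E.s - 1 / E.p) : ℝ) : ℂ) * extendZero (D.g r) x) x else 0 := by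
      intro W hW
      have hAW : (A W : ℂ) ≠ 0 := by exact_mod_cast (hApos W hW).ne'
      simp only [he, hb]
      split_ifs
      · by_cases hx : x ∈ W
        · simp only [Pi.smul_apply, Set.indicator_of_mem hx, smul_eq_mul, Complex.ofReal_mul]
          field_simp
        · simp [hx]
      · simp
    have hcongr : ∑' k, ∑ W ∈ P.level k, e W * b W x = ∑' k, ∑ W ∈ P.level k,
        if W ∈ M then W.indicator
        (fun x => ((m.real Q ^ (E.s - 1 / E.p) : ℝ) : ℂ) * extendZero (D.g r) x) x else 0 :=
      tsum_congr fun k => Finset.sum_congr rfl fun W hW => heb W ⟨k, hW⟩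
    rw [hcongr]
    by_cases hx : x ∈ Ω
    · obtain ⟨W, hWM, hxW⟩ := hMx x hx
      obtain ⟨k, hWk⟩ := hMc hWM
      -- Exactly one piece contains `x`, and it occurs at exactly one level.
      have hz : ∀ l, ∀ V ∈ P.level l, (l = k → V ≠ W) → (if V ∈ M then V.indicator
          (fun x => ((m.real Q ^ (E.s - 1 / E.p) : ℝ) : ℂ) * extendZero (D.g r) x) x else 0) = 0 := by
        intro l V hV hne
        split_ifs with hVM
        · refine Set.indicator_of_notMem (fun hxV => ?_) _
          have := hMu V hVM W hWM x hxV hxW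
          subst this
          exact hne (hP.level_unique hV hWk) rfl
        · rfl
      rw [tsum_eq_single k fun l hl => Finset.sum_eq_zero fun V hV => hz l V hV fun h => absurd h hl,
        Finset.sum_eq_single_of_mem W hWk fun V hV hne => hz k V hV fun _ => hne, if_pos hWM,
        Set.indicator_of_mem hxW]
      obtain ⟨hxJ, hxQ⟩ := hx
      simp only [Dynamics.term, extendZero, dif_pos hxJ, souzaAtom, Set.indicator_of_mem hxQ]
      ring
    · have hz : ∀ k, ∑ W ∈ P.level k, (if W ∈ M then W.indicator
          (fun x => ((m.real Q ^ (E.s - 1 / E.p) : ℝ) : ℂ) * extendZero (D.g r) x) x else 0) = 0 := by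
        refine fun k => Finset.sum_eq_zero fun W hW => ?_
        split_ifs with hWM
        · exact Set.indicator_of_notMem (fun hxW => hx (hMΩ W hWM hxW)) _
        · rfl
      rw [tsum_congr hz, tsum_zero]
      unfold Dynamics.term extendZero
      split_ifs with hxJ
      · have : (D.h r ⟨x, hxJ⟩ : I) ∉ Q := fun h => hx ⟨hxJ, h⟩
        simp [souzaAtom, this]
      · rfl

end Branch

/-! ## The transfer transformation on sliced functions -/

section Transfer

variable {I : Type*} [MeasurableSpace I] {m : Measure I} {P : Grid m} {c₁ c₂ : ℝ}
variable {Λ : Type*} {D : Dynamics (J := I) m Λ} {E : Exponents}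

theorem Dynamics.term_zero (D : Dynamics (J := I) m Λ) (r : Λ) {f : I → ℂ} {x : I}
    (hx : x ∉ D.Jset r) : D.term r f x = 0 := by
  simp [Dynamics.term, extendZero, hx]

theorem Dynamics.term_apply (D : Dynamics (J := I) m Λ) (r : Λ) (f : I → ℂ) {x : I}
    (hx : x ∈ D.Jset r) : D.term r f x = D.g r ⟨x, hx⟩ * f (D.h r ⟨x, hx⟩) := by
  simp [Dynamics.term, extendZero, hx]

/-- The bounds on the levels of the coefficients of `Φ f`, for the two kinds of slicings. -/
theorem Dynamics.exists_level_bound (D : Dynamics (J := I) m Λ) (E : Exponents) (P : Grid m)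
    {ρ : ℝ≥0∞} {X : ℝ≥0∞} (c : Λ → Set I → ℂ)
    (h : lqNorm E.q (fun j => ∑' r, ENNReal.ofReal (D.Θ E r) * levelNorm (D.grid r) E.p (c r) j) ≤
        X ∨
      D.N P ^ (1 - 1 / E.p) *
          lqNorm E.q (fun j => (∑' r, ENNReal.ofReal (D.Θ E r) ^ E.p *
            ∑ Q ∈ (D.grid r).level j, ‖c r Q‖ₑ ^ E.p) ^ (1 / E.p)) ≤ X)
    (x : Λ → ℕ → Set I → ℝ≥0∞)
    (hxJ : ∀ r j, ∀ W ∈ P.cells, x r j W ≠ 0 → W ⊆ D.Jset r)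
    (hx : ∀ r j k, eLevelNorm P E.p (x r j) k ≤
      ENNReal.ofReal (D.Θ E r) * ρ ^ ((k - j) + (j - k)) * levelNorm (D.grid r) E.p (c r) j) :
    eCoefNorm P E.p E.q (fun W => ∑' j, ∑' r, x r j W) ≤ 2 * (1 - ρ)⁻¹ * X := by
  have hp := E.one_le_p
  have hp0 := E.p_pos
  -- Both kinds of slicing give the same estimate in terms of a sequence `u` of slice norms; only
  -- the sum over branches is treated differently.
  have key : ∃ u : ℕ → ℝ≥0∞, lqNorm E.q u ≤ X ∧ ∀ j k,
      eLevelNorm P E.p (fun W => ∑' r, x r j W) k ≤ ρ ^ ((k - j) + (j - k)) * u j := by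
    rcases h with h | h
    · refine ⟨_, h, fun j k => ?_⟩
      refine (eLevelNorm_tsum_le P hp (fun r => x r j) k).trans ?_
      rw [← ENNReal.tsum_mul_left]
      refine ENNReal.tsum_le_tsum fun r => (hx r j k).trans (le_of_eq ?_)
      ring
    · rw [← lqNorm_const_mul E.one_le_q] at h
      refine ⟨_, h, fun j k => ?_⟩
      -- Hölder's inequality at each fixed `W`: only branches with `W ⊆ J_r` contribute, and there
      -- are at most `N` of them.
      have h1 : eLevelNorm P E.p (fun W => ∑' r, x r j W) k ≤ D.N P ^ (1 - 1 / E.p) *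
          eLevelNorm P E.p (fun W => (∑' r, x r j W ^ E.p) ^ (1 / E.p)) k := by
        rw [← eLevelNorm_const_mul P hp]
        refine eLevelNorm_mono P hp fun W hW => ?_
        refine (tsum_le_encard_rpow_mul hp {r | W ⊆ D.Jset r} (fun r => x r j W) fun r hr => ?_).trans
          ?_
        · by_contra h0
          exact hr (hxJ r j W ⟨k, hW⟩ h0)
        · gcongr
          · rw [sub_nonneg, div_le_one hp0]
            exact hp
          · exact le_iSup₂_of_le W ⟨k, hW⟩ le_rfl
      have h2 : eLevelNorm P E.p (fun W => (∑' r, x r j W ^ E.p) ^ (1 / E.p)) k =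
          (∑' r, eLevelNorm P E.p (x r j) k ^ E.p) ^ (1 / E.p) := by
        simp only [eLevelNorm_rpow P hp]
        rw [eLevelNorm, Summable.tsum_finsetSum fun _ _ => ENNReal.summable]
        simp only [← ENNReal.rpow_mul, one_div_mul_cancel hp0.ne', ENNReal.rpow_one]
      have h3 : (∑' r, eLevelNorm P E.p (x r j) k ^ E.p) ^ (1 / E.p) ≤
          ρ ^ ((k - j) + (j - k)) * (∑' r, ENNReal.ofReal (D.Θ E r) ^ E.p *
            ∑ Q ∈ (D.grid r).level j, ‖c r Q‖ₑ ^ E.p) ^ (1 / E.p) := by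
        have hρ : ρ ^ ((k - j) + (j - k)) = ((ρ ^ ((k - j) + (j - k))) ^ E.p) ^ (1 / E.p) := by
          rw [← ENNReal.rpow_mul, mul_one_div_cancel hp0.ne', ENNReal.rpow_one]
        rw [hρ, ← ENNReal.mul_rpow_of_nonneg _ _ (by positivity), ← ENNReal.tsum_mul_left]
        gcongr with r
        calc eLevelNorm P E.p (x r j) k ^ E.p
            ≤ (ENNReal.ofReal (D.Θ E r) * ρ ^ ((k - j) + (j - k)) *
                levelNorm (D.grid r) E.p (c r) j) ^ E.p := by
              gcongr
              exact hx r j k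
          _ = _ := by
              rw [ENNReal.mul_rpow_of_nonneg _ _ hp0.le, ENNReal.mul_rpow_of_nonneg _ _ hp0.le,
                ← eLevelNorm_enorm, eLevelNorm_rpow _ hp]
              ring
      calc _ ≤ D.N P ^ (1 - 1 / E.p) * (ρ ^ ((k - j) + (j - k)) *
            (∑' r, ENNReal.ofReal (D.Θ E r) ^ E.p *
            ∑ Q ∈ (D.grid r).level j, ‖c r Q‖ₑ ^ E.p) ^ (1 / E.p)) :=
            h1.trans (by rw [h2]; gcongr)
        _ = _ := by ring
  obtain ⟨u, hu, hxu⟩ := key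
  refine (lqNorm_mono (v := fun k => ∑' j, ρ ^ ((k - j) + (j - k)) * u j) fun k => ?_).trans
    ((lqNorm_young E.one_le_q ρ u).trans (by gcongr))
  exact (eLevelNorm_tsum_le P hp (fun j W => ∑' r, x r j W) k).trans
    (ENNReal.tsum_le_tsum fun j => hxu j k)

/-- Every atom of every slice is replaced by its image in Besov atoms. The level bound controls all
coefficients together, absolute convergence permits regrouping by cells of `P`, and the conversion
constant is applied once at the end. -/
theorem Dynamics.IsAdmissible.transfer_bound [IsProbabilityMeasure m] [Countable Λ]
    (hP : P.IsGood c₁ c₂) (hD : D.IsAdmissible E P P) {CGBS : ℝ}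
    (hconv : IsConversionConstant P E.p E.q E.s E.β CGBS) {C : ℝ} {d : Set I → ℂ} {f : I → ℂ}
    (hd : IsRep P E.p E.q E.s d f) (hS : D.HasRegularSlicing E P P C d) :
    (∀ᵐ x ∂m, Summable fun r => ‖D.term r f x‖) ∧
    ∃ z, IsRep P E.p E.q E.s z (D.transfer f) ∧ coefNorm P E.p E.q z ≤
      ENNReal.ofReal CGBS * (ENNReal.ofReal (D.CD E) *
        (ENNReal.ofReal C * coefNorm P E.p E.q d)) := by
  have hp := E.one_le_p
  have hp0 := E.p_pos
  have hq := E.one_le_q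
  obtain ⟨-, f₀, hf₀, c, hc, hbound, -⟩ := hS
  -- The slicing comes with its own function; having the same coefficients, it agrees with `f`
  -- almost everywhere.
  have hff₀ : f₀ =ᵐ[m] f := (hf₀.ae_eq hp).2.trans (hd.ae_eq hp).2.symm
  choose! e b hb heΩ hen hsum using fun r j Q (hQ : Q ∈ (D.grid r).level j) =>
    hD.exists_atoms hP r hQ
  set ρ := D.ratio E with hρdef
  have hρ : ρ < 1 := ENNReal.ofReal_lt_one.2 hD.iSup_rpow_lt_one
  let ι := Σ r : Λ, Σ j : ℕ, (D.grid r).level j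
  set e' : ι → Set I → ℂ := fun i W => c i.1 i.2.2 * e i.1 i.2.1 i.2.2 W with he'
  set b' : ι → Set I → I → ℂ := fun i => b i.1 i.2.1 i.2.2 with hb'
  set x : Λ → ℕ → Set I → ℝ≥0∞ := fun r j W =>
    ∑ Q : (D.grid r).level j, ‖c r Q * e r j Q W‖ₑ with hx
  have hsub : ∀ r j (Q : (D.grid r).level j) W, ‖c r Q * e r j Q W‖ₑ ≠ 0 →
      W ⊆ pullback (D.h r) Q := fun r j Q W h =>
    heΩ r j Q Q.2 W fun h0 => h (by rw [h0, mul_zero, enorm_zero])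
  have hxJ : ∀ r j, ∀ W ∈ P.cells, x r j W ≠ 0 → W ⊆ D.Jset r := by
    intro r j W _ h
    obtain ⟨Q, _, hQ⟩ := Finset.exists_ne_zero_of_sum_ne_zero h
    exact (hsub r j Q W hQ).trans fun y hy => hy.1
  have hxle : ∀ r j k, eLevelNorm P E.p (x r j) k ≤
      ENNReal.ofReal (D.Θ E r) * ρ ^ ((k - j) + (j - k)) * levelNorm (D.grid r) E.p (c r) j := by
    intro r j k
    rw [hx, eLevelNorm_finset_sum_of_disjoint P hp]
    · set t := ENNReal.ofReal (D.Θ E r) * ρ ^ ((k - j) + (j - k))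
      calc (∑ Q : (D.grid r).level j, eLevelNorm P E.p
            (fun W => ‖c r Q * e r j Q W‖ₑ) k ^ E.p) ^ (1 / E.p)
          ≤ (∑ Q : (D.grid r).level j, (t * ‖c r Q‖ₑ) ^ E.p) ^ (1 / E.p) := by
            gcongr with Q
            simp only [enorm_mul]
            rw [eLevelNorm_const_mul P hp, mul_comm]
            gcongr
            exact hen r j Q Q.2 k
        _ = eLevelNorm (D.grid r) E.p (fun Q => t * ‖c r Q‖ₑ) j := by
            rw [eLevelNorm, Finset.sum_coe_sort ((D.grid r).level j) fun Q =>
              (t * ‖c r Q‖ₑ) ^ E.p]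
        _ = _ := eLevelNorm_const_mul _ hp _ _ j
    -- Distinct cells of one level of the grid of branch `r` are disjoint, hence so are their
    -- preimages, and `W` lies in only one of these.
    · intro W hW Q _ R _ hQ hR
      obtain ⟨y, hy⟩ := Grid.IsGood.nonempty_of_mem_level hW
      obtain ⟨hyJ, hyQ⟩ := hsub r j Q W hQ hy
      obtain ⟨_, hyR⟩ := hsub r j R W hR hy
      by_contra hne
      exact Set.disjoint_left.1 ((hD.branch r).grid_disjoint j Q Q.2 R R.2
        fun h => hne (Subtype.ext h)) hyQ hyR
  have hy : eCoefNorm P E.p E.q (fun W => ∑' i, ‖e' i W‖ₑ) ≤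
      2 * (1 - ρ)⁻¹ * (ENNReal.ofReal C * coefNorm P E.p E.q d) := by
    refine le_trans (le_of_eq ?_) (D.exists_level_bound E P c hbound x hxJ hxle)
    congr 1
    ext W
    rw [ENNReal.tsum_sigma', ENNReal.tsum_comm]
    refine tsum_congr fun r => ?_
    rw [ENNReal.tsum_sigma']
    exact tsum_congr fun j => tsum_fintype _
  have hfin : 2 * (1 - ρ)⁻¹ * (ENNReal.ofReal C * coefNorm P E.p E.q d) < ∞ :=
    ENNReal.mul_lt_top (ENNReal.mul_lt_top (by simp) (inv_one_sub_lt_top hρ))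
      (ENNReal.mul_lt_top ENNReal.ofReal_lt_top hd.coef_lt_top)
  obtain ⟨hae, B, d', hB, hd', hrep⟩ := exists_isAtomicRep_of_family hP hp hq E.s_pos E.s_lt_β
    e' b' (fun i W hW => hb i.1 i.2.1 i.2.2 i.2.2.2 W hW) (hy.trans_lt hfin)
  obtain ⟨z, hz, hzle⟩ := hconv.2 d' B _ hB hrep
  -- pointwise identification of the sum of the family
  have hterm : ∀ᵐ y ∂m, ∀ r, D.term r f y = ∑' j, ∑ Q : (D.grid r).level j,
      c r Q * D.term r (souzaAtom m E.p E.s Q) y := by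
    rw [ae_all_iff]
    intro r
    filter_upwards [hD.ae_comp r ((hc r).ae_eq hp).2, hD.ae_comp r hff₀] with y h1 h2
    by_cases hyJ : y ∈ D.Jset r
    · have h3 := h1 hyJ
      rw [Set.indicator_of_mem (D.h r ⟨y, hyJ⟩).2, h2 hyJ] at h3
      rw [D.term_apply r f hyJ, h3, ← tsum_mul_left]
      refine tsum_congr fun j => ?_
      rw [levelSum, Finset.mul_sum, ← Finset.sum_coe_sort]
      refine Finset.sum_congr rfl fun Q _ => ?_
      rw [D.term_apply r _ hyJ]
      ring
    · simp [D.term_zero r hyJ]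
  have hpt : ∀ᵐ y ∂m, (Summable fun r => ‖D.term r f y‖) ∧
      ∑' k, ∑ W ∈ P.level k, ∑' i, e' i W * b' i W y = D.transfer f y := by
    filter_upwards [hae, hterm] with y hy1 hy2
    have hsumi : ∀ k, ∀ W ∈ P.level k, Summable fun i => e' i W * b' i W y := by
      intro k W hW
      refine Summable.of_norm (tsum_enorm_ne_top_iff_summable_norm.1 ?_)
      refine ne_top_of_le_ne_top hy1.ne (le_trans ?_ (ENNReal.le_tsum k))
      exact Finset.single_le_sum (f := fun W => ∑' i, ‖e' i W * b' i W y‖ₑ)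
        (fun _ _ => zero_le) hW
    -- The same absolutely convergent series is summed by cells of `P`, giving the represented
    -- function, and by branch, slice level and slice cell, giving `Φ f`.
    have hswap := tsum_comm_of_tsum_enorm_ne_top
      (fun i k => ∑ W ∈ P.level k, e' i W * b' i W y) (by
        refine ne_top_of_le_ne_top hy1.ne (ENNReal.tsum_le_tsum fun k => ?_)
        rw [← Summable.tsum_finsetSum fun _ _ => ENNReal.summable]
        exact ENNReal.tsum_le_tsum fun i => enorm_sum_le _ _)
    have hT : ∀ i : ι, ∑' k, ∑ W ∈ P.level k, e' i W * b' i W y =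
        c i.1 i.2.2 * D.term i.1 (souzaAtom m E.p E.s i.2.2) y := by
      intro i
      rw [← hsum i.1 i.2.1 i.2.2 i.2.2.2 y, ← tsum_mul_left]
      refine tsum_congr fun k => ?_
      rw [Finset.mul_sum]
      exact Finset.sum_congr rfl fun W _ => mul_assoc _ _ _
    simp only [hT] at hswap
    have hr : ∀ r, ∑' (i : Σ j : ℕ, (D.grid r).level j),
        c r i.2 * D.term r (souzaAtom m E.p E.s i.2) y = D.term r f y := by
      intro r
      rw [hy2 r, (hswap.1.of_norm.sigma_factor r).tsum_sigma]
      exact tsum_congr fun j => tsum_fintype _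
    refine ⟨?_, ?_⟩
    · have h := tsum_enorm_ne_top_iff_summable_norm.2 hswap.1
      rw [ENNReal.tsum_sigma'] at h
      rw [← tsum_enorm_ne_top_iff_summable_norm]
      refine ne_top_of_le_ne_top h (ENNReal.tsum_le_tsum fun r => ?_)
      rw [← hr r]
      exact enorm_tsum_le _
    · calc _ = ∑' k, ∑' i, ∑ W ∈ P.level k, e' i W * b' i W y :=
            tsum_congr fun k => (Summable.tsum_finsetSum (hsumi k)).symm
        _ = _ := hswap.2.symm
        _ = _ := by
            rw [hswap.1.of_norm.tsum_sigma]
            exact tsum_congr hr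
  refine ⟨hpt.mono fun y hy => hy.1, z, hz.congr (hpt.mono fun y hy => hy.2), ?_⟩
  rw [hD.ofReal_CD]
  exact hzle.trans (by gcongr; exact hd'.trans hy)

end Transfer

/-! ## The canonical family of a good grid -/

section Canonical

variable {I : Type*} [MeasurableSpace I] {m : Measure I}

/-- The coefficient of the Souza atom on `Q` in the conditional expectation of `g`. -/
def avgCoef (m : Measure I) (p s : ℝ) (g : I → ℂ) (Q : Set I) : ℂ :=
  ((m.real Q ^ (1 / p - s) : ℝ) : ℂ) * ⨍ x in Q, g x ∂m

variable [IsProbabilityMeasure m] {P : Grid m} {c₁ c₂ : ℝ} {p s : ℝ} {q : ℝ≥0∞}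

theorem enorm_average_le (hp : 1 ≤ p) {Q : Set I} (hQ : MeasurableSet Q) (hpos : 0 < m.real Q)
    {g : I → ℂ} (hg : AEStronglyMeasurable g m) :
    ‖⨍ x in Q, g x ∂m‖ₑ ≤
      ENNReal.ofReal (m.real Q ^ (-(1 / p))) * eLpNorm (Q.indicator g) (ENNReal.ofReal p) m := by
  have hp0 : 0 < p := by linarith
  have hp1 : (1 : ℝ≥0∞) ≤ ENNReal.ofReal p := by simpa using hp
  rw [setAverage_eq, enorm_smul, eLpNorm_indicator_eq_eLpNorm_restrict hQ]
  have h1 : ‖∫ x in Q, g x ∂m‖ₑ ≤ eLpNorm g (ENNReal.ofReal p) (m.restrict Q) *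
      ENNReal.ofReal (m.real Q ^ (1 - 1 / p)) := by
    refine (enorm_integral_le_lintegral_enorm _).trans ?_
    rw [← eLpNorm_one_eq_lintegral_enorm]
    refine (eLpNorm_le_eLpNorm_mul_rpow_measure_univ hp1 hg.restrict).trans (le_of_eq ?_)
    rw [Measure.restrict_apply_univ, ENNReal.toReal_ofReal hp0.le, ENNReal.toReal_one, div_one,
      ← ofReal_measureReal (measure_ne_top _ _), ENNReal.ofReal_rpow_of_pos hpos]
  have h2 : ‖(m.real Q)⁻¹‖ₑ = ENNReal.ofReal (m.real Q)⁻¹ := Real.enorm_of_nonneg (by positivity)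
  rw [h2]
  refine (mul_le_mul_right h1 _).trans (le_of_eq ?_)
  rw [mul_left_comm, ← ENNReal.ofReal_mul (by positivity), mul_comm, ← Real.rpow_neg_one,
    ← Real.rpow_add hpos]
  congr 3
  ring

theorem eLpNorm_const_mul_souzaAtom (hp : 1 ≤ p) {k : ℕ} {S : Set I} (hS : S ∈ P.level k) (a : ℂ) :
    eLpNorm (fun x => a * souzaAtom m p s S x) (ENNReal.ofReal p) m =
      ENNReal.ofReal (m.real S ^ s) * ‖a‖ₑ := by
  have hp0 : 0 < p := by linarith
  have hpos : 0 < m.real S := Grid.IsGood.real_pos hS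
  have : (fun x => a * souzaAtom m p s S x) = a • souzaAtom m p s S := rfl
  rw [this, eLpNorm_const_smul, souzaAtom, eLpNorm_indicator_const (P.measurableSet k S hS)
    (by simpa using hp0) ENNReal.ofReal_ne_top, mul_comm]
  congr 1
  rw [← ofReal_norm, Complex.norm_real, Real.norm_of_nonneg (by positivity),
    ENNReal.toReal_ofReal hp0.le, ← ofReal_measureReal (measure_ne_top _ _),
    ENNReal.ofReal_rpow_of_pos hpos, ← ENNReal.ofReal_mul (by positivity), ← Real.rpow_add hpos]
  congr 2
  ring

open Classical in
theorem indicator_levelSum (hP : P.IsGood c₁ c₂) {j k : ℕ} (hkj : k ≤ j) {Q : Set I}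
    (hQ : Q ∈ P.level k) (d : Set I → ℂ) :
    Q.indicator (levelSum P (souzaAtom m p s) d j) = fun x =>
      ∑ S ∈ P.level j, (if S ⊆ Q then d S else 0) * souzaAtom m p s S x := by
  ext x
  by_cases hx : x ∈ Q
  · rw [Set.indicator_of_mem hx]
    refine Finset.sum_congr rfl fun S hS => ?_
    split_ifs with h
    · rfl
    · have hxS : x ∉ S := fun hxS => Set.disjoint_left.1
        ((hP.subset_or_disjoint hS hQ hkj).resolve_left h) hxS hx
      simp [souzaAtom, hxS]
  · rw [Set.indicator_of_notMem hx]
    refine (Finset.sum_eq_zero fun S hS => ?_).symm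
    split_ifs with h
    · rw [souzaAtom, Set.indicator_of_notMem fun hxS => hx (h hxS), mul_zero]
    · rw [zero_mul]

open Classical in
-- Hölder's inequality on `Q` contributes `|Q|^(-1/p)`, the normalization `|Q|^(1/p-s)`, and the
-- atoms inside `Q` at most `(c₂^(j-k) |Q|)^s`. The powers of `|Q|` cancel, and only coefficients at
-- cells inside `Q` enter.
theorem enorm_avgCoef_levelSum_le (hP : P.IsGood c₁ c₂) (hp : 1 ≤ p) (hs : 0 < s)
    {j k : ℕ} (hkj : k ≤ j) {Q : Set I} (hQ : Q ∈ P.level k) (d : Set I → ℂ) :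
    ‖avgCoef m p s (levelSum P (souzaAtom m p s) d j) Q‖ₑ ≤
      ENNReal.ofReal (c₂ ^ s) ^ (j - k) *
        eLevelNorm P p (fun S => if S ⊆ Q then ‖d S‖ₑ else 0) j := by
  have hpos : 0 < m.real Q := Grid.IsGood.real_pos hQ
  have hc0 := hP.c₂_pos
  have hQm := P.measurableSet k Q hQ
  have h1 : eLpNorm (Q.indicator (levelSum P (souzaAtom m p s) d j)) (ENNReal.ofReal p) m ≤
      ENNReal.ofReal ((c₂ ^ (j - k) * m.real Q) ^ s) *
        eLevelNorm P p (fun S => if S ⊆ Q then ‖d S‖ₑ else 0) j := by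
    rw [indicator_levelSum hP hkj hQ]
    refine (eLpNorm_sum_le_of_disjoint hP.disjoint hp j
      (fun S x => (if S ⊆ Q then d S else 0) * souzaAtom m p s S x)
      (fun S hS => (aestronglyMeasurable_souzaAtom p s ⟨j, hS⟩).const_mul _)
      fun S hS => Eventually.of_forall fun x hx => by simp [souzaAtom, hx]).trans ?_
    rw [← eLevelNorm_const_mul P hp]
    refine eLevelNorm_mono P hp fun S hS => ?_
    rw [eLpNorm_const_mul_souzaAtom hp hS]
    split_ifs with h
    · gcongr
      exact hP.real_le_of_subset hS hQ h
    · simp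
  rw [avgCoef, enorm_mul, ← ofReal_norm (((m.real Q ^ (1 / p - s) : ℝ) : ℂ)), Complex.norm_real,
    Real.norm_of_nonneg (by positivity)]
  calc _ ≤ ENNReal.ofReal (m.real Q ^ (1 / p - s)) * (ENNReal.ofReal (m.real Q ^ (-(1 / p))) *
        (ENNReal.ofReal ((c₂ ^ (j - k) * m.real Q) ^ s) *
        eLevelNorm P p (fun S => if S ⊆ Q then ‖d S‖ₑ else 0) j)) := by
        gcongr
        refine (enorm_average_le hp hQm hpos
          (aestronglyMeasurable_levelSum_souzaAtom P p s d j)).trans ?_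
        gcongr
    _ = _ := by
        rw [← mul_assoc, ← mul_assoc, ← ENNReal.ofReal_mul (by positivity),
          ← ENNReal.ofReal_mul (by positivity), Real.mul_rpow (by positivity) hpos.le,
          ← ENNReal.ofReal_pow (by positivity)]
        congr 2
        rw [mul_left_comm, ← Real.rpow_add hpos, ← Real.rpow_add hpos]
        have h0 : 1 / p - s + -(1 / p) + s = 0 := by ring
        rw [h0, Real.rpow_zero, mul_one, ← Real.rpow_natCast, ← Real.rpow_natCast,
          ← Real.rpow_mul hc0.le, ← Real.rpow_mul hc0.le, mul_comm s]

/-- Averaging over the cells of level `k` improves the coefficients of a finer level. -/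
theorem levelNorm_avgCoef_le (hP : P.IsGood c₁ c₂) (hp : 1 ≤ p) (hs : 0 < s)
    {j k : ℕ} (hkj : k ≤ j) (d : Set I → ℂ) :
    levelNorm P p (avgCoef m p s (levelSum P (souzaAtom m p s) d j)) k ≤
      ENNReal.ofReal (c₂ ^ s) ^ (j - k) * levelNorm P p d j := by
  classical
  have hp0 : 0 < p := by linarith
  refine (eLevelNorm_mono P hp (y := fun Q =>
    ‖avgCoef m p s (levelSum P (souzaAtom m p s) d j) Q‖ₑ) fun Q hQ =>
    enorm_avgCoef_levelSum_le hP hp hs hkj hQ d).trans ?_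
  rw [eLevelNorm_const_mul P hp]
  gcongr
  rw [eLevelNorm, ← eLevelNorm_finset_sum_of_disjoint P hp (P.level k)
    (fun Q S => if S ⊆ Q then ‖d S‖ₑ else 0) j]
  · refine eLevelNorm_mono P hp (z := fun S => ‖d S‖ₑ) fun S hS => ?_
    by_cases h : ∃ Q ∈ P.level k, S ⊆ Q
    · obtain ⟨Q, hQ, hSQ⟩ := h
      rw [Finset.sum_eq_single_of_mem Q hQ fun R hR hne => if_neg fun hSR => hne ?_, if_pos hSQ]
      obtain ⟨x, hx⟩ := Grid.IsGood.nonempty_of_mem_level hS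
      exact hP.eq_of_inter hR hQ (hSR hx) (hSQ hx)
    · push Not at h
      rw [Finset.sum_eq_zero fun Q hQ => if_neg (h Q hQ)]
      exact zero_le
  · intro S hS Q hQ R hR hQ0 hR0
    obtain ⟨x, hx⟩ := Grid.IsGood.nonempty_of_mem_level hS
    have hSQ : S ⊆ Q := by
      by_contra h
      exact hQ0 (if_neg h)
    have hSR : S ⊆ R := by
      by_contra h
      exact hR0 (if_neg h)
    exact hP.eq_of_inter hQ hR (hSQ hx) (hSR hx)

theorem levelSum_eq_of_mem (hP : P.IsGood c₁ c₂) {j k : ℕ} (hjk : j ≤ k) {Q : Set I}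
    (hQ : Q ∈ P.level k) (d : Set I → ℂ) {x y : I} (hx : x ∈ Q) (hy : y ∈ Q) :
    levelSum P (souzaAtom m p s) d j x = levelSum P (souzaAtom m p s) d j y := by
  refine Finset.sum_congr rfl fun S hS => ?_
  have : x ∈ S ↔ y ∈ S := by
    rcases hP.subset_or_disjoint hQ hS hjk with h | h
    · exact ⟨fun _ => h hy, fun _ => h hx⟩
    · exact ⟨fun h' => absurd h' (Set.disjoint_left.1 h hx),
        fun h' => absurd h' (Set.disjoint_left.1 h hy)⟩
  by_cases hxS : x ∈ S
  · simp [souzaAtom, hxS, this.1 hxS]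
  · have hyS : y ∉ S := fun h => hxS (this.2 h)
    simp [souzaAtom, hxS, hyS]

theorem average_levelSum (hP : P.IsGood c₁ c₂) {j k : ℕ} (hjk : j ≤ k) {Q : Set I}
    (hQ : Q ∈ P.level k) (d : Set I → ℂ) {x : I} (hx : x ∈ Q) :
    ⨍ y in Q, levelSum P (souzaAtom m p s) d j y ∂m = levelSum P (souzaAtom m p s) d j x := by
  have hpos : 0 < m.real Q := Grid.IsGood.real_pos hQ
  rw [setAverage_eq, setIntegral_congr_fun (g := fun _ => levelSum P (souzaAtom m p s) d j x)
    (P.measurableSet k Q hQ) fun y hy => levelSum_eq_of_mem hP hjk hQ d hy hx,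
    setIntegral_const, smul_smul, inv_mul_cancel₀ hpos.ne', one_smul]

/-- Averaging over a cell is continuous in `L^p`, so it passes through the series. -/
theorem IsRep.hasSum_average (hp : 1 ≤ p) {d : Set I → ℂ} {f : I → ℂ}
    (hf : IsRep P p q s d f) {Q : Set I} (hQ : Q ∈ P.cells) :
    (Summable fun j => ‖⨍ x in Q, levelSum P (souzaAtom m p s) d j x ∂m‖) ∧
    HasSum (fun j => ⨍ x in Q, levelSum P (souzaAtom m p s) d j x ∂m) (⨍ x in Q, f x ∂m) := by
  obtain ⟨k, hk⟩ := hQ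
  have hp1 : (1 : ℝ≥0∞) ≤ ENNReal.ofReal p := by simpa using hp
  have hQm := P.measurableSet k Q hk
  have hpos : 0 < m.real Q := Grid.IsGood.real_pos hk
  have hm := fun j => aestronglyMeasurable_levelSum_souzaAtom P p s d j
  have hbd : ∀ g : I → ℂ, AEStronglyMeasurable g m → ‖⨍ x in Q, g x ∂m‖ₑ ≤
      ENNReal.ofReal (m.real Q ^ (-(1 / p))) * eLpNorm g (ENNReal.ofReal p) m := fun g hg =>
    (enorm_average_le hp hQm hpos hg).trans (by gcongr; exact eLpNorm_indicator_le g)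
  have hsum : Summable fun j => ‖⨍ x in Q, levelSum P (souzaAtom m p s) d j x ∂m‖ := by
    rw [← tsum_enorm_ne_top_iff_summable_norm]
    refine ne_top_of_le_ne_top ?_ (ENNReal.tsum_le_tsum fun j => hbd _ (hm j))
    rw [ENNReal.tsum_mul_left]
    exact (ENNReal.mul_lt_top ENNReal.ofReal_lt_top hf.abs_conv).ne
  refine ⟨hsum, (hsum.of_norm.hasSum_iff_tendsto_nat).2 ?_⟩
  have hmem : ∀ j, MemLp (levelSum P (souzaAtom m p s) d j) (ENNReal.ofReal p) m := fun j =>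
    ⟨hm j, (ENNReal.le_tsum j).trans_lt hf.abs_conv⟩
  have hint : ∀ j, IntegrableOn (levelSum P (souzaAtom m p s) d j) Q m := fun j =>
    ((hmem j).integrable hp1).integrableOn
  have hfint : IntegrableOn f Q m := (hf.memLp.integrable hp1).integrableOn
  rw [tendsto_iff_edist_tendsto_0]
  have hz := ENNReal.Tendsto.const_mul (a := ENNReal.ofReal (m.real Q ^ (-(1 / p)))) hf.tendsto
    (Or.inr ENNReal.ofReal_ne_top)
  rw [mul_zero] at hz
  refine tendsto_of_tendsto_of_tendsto_of_le_of_le tendsto_const_nhds hz (fun _ => zero_le)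
    fun n => ?_
  refine le_trans (le_of_eq ?_) (hbd _ (hf.aestronglyMeasurable_sub n))
  rw [edist_comm, edist_eq_enorm_sub]
  congr 1
  simp only [setAverage_eq]
  rw [integral_sub hfint (integrable_finsetSum _ fun j _ => hint j),
    integral_finsetSum _ fun j _ => hint j, smul_sub, Finset.smul_sum]

end Canonical

/-! ### Martingale differences as canonical coefficients -/

section Canonical

variable {I : Type*} [MeasurableSpace I] {m : Measure I}
variable {P : Grid m} {c₁ c₂ : ℝ} {p s : ℝ} {q : ℝ≥0∞}

theorem exists_averageCLM (m : Measure I) (Q : Set I) :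
    ∃ A : Lp ℂ 1 m →L[ℂ] ℂ, ∀ f, A f = ⨍ x in Q, f x ∂m := by
  have hint : ∀ f : Lp ℂ 1 m, Integrable f m := fun f => L1.integrable_coeFn f
  let A : Lp ℂ 1 m →ₗ[ℂ] ℂ :=
    { toFun := fun f => ⨍ x in Q, f x ∂m
      map_add' := fun f g => by
        simp only [setAverage_eq]
        rw [← smul_add, ← integral_add (hint f).integrableOn (hint g).integrableOn]
        congr 1
        exact integral_congr_ae (ae_restrict_of_ae (Lp.coeFn_add f g))
      map_smul' := fun a f => by
        simp only [setAverage_eq, RingHom.id_apply]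
        have h : ∫ x in Q, (a • f : Lp ℂ 1 m) x ∂m = a • ∫ x in Q, f x ∂m := by
          rw [← integral_smul]
          exact integral_congr_ae (ae_restrict_of_ae (Lp.coeFn_smul a f))
        rw [h, smul_comm] }
  refine ⟨A.mkContinuous (m.real Q)⁻¹ fun f => ?_, fun f => rfl⟩
  change ‖⨍ x in Q, f x ∂m‖ ≤ _
  rw [setAverage_eq, norm_smul, Real.norm_of_nonneg (by positivity), L1.norm_eq_integral_norm]
  gcongr
  refine (norm_integral_le_integral_norm _).trans ?_
  exact setIntegral_le_integral (hint f).norm (Eventually.of_forall fun x => norm_nonneg _)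

theorem levelSum_of_mem (hP : P.IsGood c₁ c₂) {k : ℕ} {Q : Set I} (hQ : Q ∈ P.level k)
    {x : I} (hx : x ∈ Q) (c : Set I → ℂ) :
    levelSum P (souzaAtom m p s) c k x = c Q * ((m.real Q ^ (s - 1 / p) : ℝ) : ℂ) := by
  rw [levelSum, Finset.sum_eq_single_of_mem Q hQ fun R hR hne => ?_]
  · simp [souzaAtom, hx]
  · rw [souzaAtom, Set.indicator_of_notMem fun hxR => hne (hP.eq_of_inter hR hQ hxR hx), mul_zero]

variable [IsProbabilityMeasure m]

/-- A functional attached to the set `Q` alone is well defined because a cell has one level and one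
parent. -/
theorem exists_difference_functionals (hP : P.IsGood c₁ c₂) (p s : ℝ) :
    ∃ κ : Set I → Lp ℂ 1 m →L[ℂ] ℂ,
      (∀ Q ∈ P.level 0, ∀ f, κ Q f = ((m.real Q ^ (1 / p - s) : ℝ) : ℂ) * ⨍ x in Q, f x ∂m) ∧
      ∀ k, ∀ Q ∈ P.level (k + 1), ∀ R ∈ P.level k, Q ⊆ R → ∀ f,
        κ Q f = ((m.real Q ^ (1 / p - s) : ℝ) : ℂ) *
          (⨍ x in Q, f x ∂m - ⨍ x in R, f x ∂m) := by
  have h : ∀ Q : Set I, ∃ κ : Lp ℂ 1 m →L[ℂ] ℂ,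
      (Q ∈ P.level 0 → ∀ f, κ f = ((m.real Q ^ (1 / p - s) : ℝ) : ℂ) * ⨍ x in Q, f x ∂m) ∧
      ∀ k, Q ∈ P.level (k + 1) → ∀ R ∈ P.level k, Q ⊆ R → ∀ f,
        κ f = ((m.real Q ^ (1 / p - s) : ℝ) : ℂ) *
          (⨍ x in Q, f x ∂m - ⨍ x in R, f x ∂m) := by
    intro Q
    obtain ⟨A, hA⟩ := exists_averageCLM m Q
    by_cases hQ : ∃ k R, Q ∈ P.level (k + 1) ∧ R ∈ P.level k ∧ Q ⊆ R
    · obtain ⟨k, R, hQk, hR, hQR⟩ := hQ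
      obtain ⟨B, hB⟩ := exists_averageCLM m R
      refine ⟨((m.real Q ^ (1 / p - s) : ℝ) : ℂ) • (A - B), fun h0 => ?_, ?_⟩
      · exact absurd (hP.level_unique h0 hQk) (by omega)
      · intro l hQl S hS hQS f
        obtain rfl : k = l := by
          have := hP.level_unique hQk hQl
          omega
        obtain ⟨x, hx⟩ := Grid.IsGood.nonempty_of_mem_level hQk
        rw [hP.eq_of_inter hS hR (hQS hx) (hQR hx), ← hA, ← hB]
        rfl
    · refine ⟨((m.real Q ^ (1 / p - s) : ℝ) : ℂ) • A, fun _ f => ?_, fun k hk R hR hQR => ?_⟩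
      · rw [← hA]
        rfl
      · exact absurd ⟨k, R, hk, hR, hQR⟩ hQ
  choose κ h0 h1 using h
  exact ⟨κ, fun Q hQ => h0 Q hQ, fun k Q hQ => h1 Q k hQ⟩

theorem rpow_mul_rpow_cancel {k : ℕ} {Q : Set I} (hQ : Q ∈ P.level k) (z : ℂ) :
    ((m.real Q ^ (1 / p - s) : ℝ) : ℂ) * z * ((m.real Q ^ (s - 1 / p) : ℝ) : ℂ) = z := by
  have hpos : 0 < m.real Q := Grid.IsGood.real_pos hQ
  rw [mul_right_comm, ← Complex.ofReal_mul, ← Real.rpow_add hpos]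
  have : 1 / p - s + (s - 1 / p) = 0 := by ring
  rw [this, Real.rpow_zero, Complex.ofReal_one, one_mul]

/-- The partial sums of the canonical series are the conditional expectations. -/
theorem sum_levelSum_eq_average (hP : P.IsGood c₁ c₂) {u : Set I → ℂ} {f : I → ℂ}
    (h0 : ∀ Q ∈ P.level 0, u Q = ((m.real Q ^ (1 / p - s) : ℝ) : ℂ) * ⨍ x in Q, f x ∂m)
    (h1 : ∀ k, ∀ Q ∈ P.level (k + 1), ∀ R ∈ P.level k, Q ⊆ R →
      u Q = ((m.real Q ^ (1 / p - s) : ℝ) : ℂ) * (⨍ x in Q, f x ∂m - ⨍ x in R, f x ∂m))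
    (n : ℕ) : ∀ Q ∈ P.level n, ∀ x ∈ Q,
      ∑ k ∈ Finset.range (n + 1), levelSum P (souzaAtom m p s) u k x = ⨍ x in Q, f x ∂m := by
  induction n with
  | zero =>
    intro Q hQ x hx
    rw [Finset.sum_range_one, levelSum_of_mem hP hQ hx, h0 Q hQ, rpow_mul_rpow_cancel hQ]
  | succ n ih =>
    intro Q hQ x hx
    obtain ⟨R, hR, hQR⟩ := hP.nested n Q hQ
    rw [Finset.sum_range_succ, ih R hR x (hQR hx), levelSum_of_mem hP hQ hx, h1 n Q hQ R hR hQR,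
      rpow_mul_rpow_cancel hQ]
    ring

theorem levelSum_avgCoef_of_mem (hP : P.IsGood c₁ c₂) {k : ℕ} {Q : Set I} (hQ : Q ∈ P.level k)
    {x : I} (hx : x ∈ Q) (g : I → ℂ) :
    levelSum P (souzaAtom m p s) (avgCoef m p s g) k x = ⨍ y in Q, g y ∂m := by
  rw [levelSum_of_mem hP hQ hx, avgCoef, rpow_mul_rpow_cancel hQ]

/-- The conditional expectations of `f` converge to `f`. -/
theorem IsRep.tendsto_average (hP : P.IsGood c₁ c₂) (hp : 1 ≤ p) (hq : 1 ≤ q) (hs : 0 < s)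
    {d : Set I → ℂ} {f : I → ℂ} (hf : IsRep P p q s d f) {S : ℕ → I → ℂ}
    (hS : ∀ n, ∀ Q ∈ P.level n, ∀ x ∈ Q, S (n + 1) x = ⨍ x in Q, f x ∂m) :
    Tendsto (fun n => eLpNorm (fun x => f x - S n x) (ENNReal.ofReal p) m) atTop (𝓝 0) := by
  have hp1 : (1 : ℝ≥0∞) ≤ ENNReal.ofReal p := by simpa using hp
  set σ := ENNReal.ofReal (c₂ ^ s) with hσdef
  have hσ : σ < 1 := hP.ofReal_rpow_lt_one hs
  set F := levelSum P (souzaAtom m p s) d with hF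
  have hm : ∀ (c : Set I → ℂ) j, AEStronglyMeasurable (levelSum P (souzaAtom m p s) c j) m :=
    fun c j => aestronglyMeasurable_levelSum_souzaAtom P p s c j
  have htail : Tendsto (fun n => ∑' i, 2 * (σ ^ (i + (n + 1)) * levelNorm P p d (i + (n + 1))))
      atTop (𝓝 0) := by
    refine (tendsto_add_atTop_iff_nat (f := fun n =>
      ∑' i, 2 * (σ ^ (i + n) * levelNorm P p d (i + n))) 1).2 ?_
    refine ENNReal.tendsto_sum_nat_add (fun i => 2 * (σ ^ i * levelNorm P p d i)) ?_
    rw [ENNReal.tsum_mul_left]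
    refine (ENNReal.mul_lt_top (by simp) ((tsum_pow_mul_eLevelNorm_le hq _).trans_lt ?_)).ne
    exact ENNReal.mul_lt_top (inv_one_sub_lt_top hσ) hf.coef_lt_top
  refine (tendsto_add_atTop_iff_nat 1).1 ?_
  refine tendsto_of_tendsto_of_tendsto_of_le_of_le tendsto_const_nhds htail (fun _ => zero_le)
    fun n => ?_
  -- Blocks of level `j ≤ n` are constant on cells of level `n` and equal their averages; only `j ≥
  -- n + 1` survive.
  have hae : (fun x => f x - S (n + 1) x) =ᵐ[m] fun x => ∑' i, (F (i + (n + 1)) x -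
      levelSum P (souzaAtom m p s) (avgCoef m p s (F (i + (n + 1)))) n x) := by
    obtain ⟨h1, h2⟩ := hf.ae_eq hp
    filter_upwards [h1, h2, hP.covers n] with x hx1 hx2 hx3
    obtain ⟨Q, hQ, hxQ⟩ := hx3
    obtain ⟨hs1, hs2⟩ := hf.hasSum_average hp ⟨n, hQ⟩
    rw [hS n Q hQ x hxQ, hx2, ← hs2.tsum_eq, ← (hx1.of_norm.tsum_sub hs1.of_norm),
      ← (hx1.of_norm.sub hs1.of_norm).sum_add_tsum_nat_add (n + 1), Finset.sum_eq_zero, zero_add]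
    · refine tsum_congr fun i => ?_
      rw [levelSum_avgCoef_of_mem hP hQ hxQ]
    · intro j hj
      rw [average_levelSum hP (by simpa [Nat.lt_succ_iff] using hj) hQ d hxQ, sub_self]
  rw [eLpNorm_congr_ae hae]
  refine (eLpNorm_tsum_le hp1 fun i => (hm _ _).sub (hm _ _)).trans
    (ENNReal.tsum_le_tsum fun i => ?_)
  refine (eLpNorm_sub_le (hm _ _) (hm _ _) hp1).trans ?_
  -- The block and its average obey the same bound: averaging gains `σ^(i+1)` and the block of level
  -- `n` supplies `σ^n`, together `σ^(i+n+1)`.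
  rw [two_mul]
  refine add_le_add (eLpNorm_levelSum_le hP hp hs d _) ?_
  refine (eLpNorm_levelSum_le hP hp hs _ n).trans ?_
  calc σ ^ n * levelNorm P p (avgCoef m p s (F (i + (n + 1)))) n
      ≤ σ ^ n * (σ ^ (i + (n + 1) - n) * levelNorm P p d (i + (n + 1))) := by
        gcongr
        exact levelNorm_avgCoef_le hP hp hs (by omega) d
    _ = _ := by
        rw [← mul_assoc, ← pow_add]
        congr 2
        omega

open Classical in
-- The children are disjoint subsets of `R`, each of measure at least `c₁ |R|`.
theorem card_children_le (hP : P.IsGood c₁ c₂) {k : ℕ} {R : Set I} (hR : R ∈ P.level k) :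
    (((P.level (k + 1)).filter fun Q => Q ⊆ R).card : ℝ) ≤ 1 / c₁ := by
  have hpos : 0 < m.real R := Grid.IsGood.real_pos hR
  set t := (P.level (k + 1)).filter fun Q => Q ⊆ R
  have h1 : (t.card : ℝ) * (c₁ * m.real R) ≤ ∑ Q ∈ t, m.real Q := by
    rw [← nsmul_eq_mul]
    refine Finset.card_nsmul_le_sum _ _ _ fun Q hQ => ?_
    obtain ⟨hQ, hQR⟩ := Finset.mem_filter.1 hQ
    exact (le_div_iff₀ hpos).1 (hP.ratio k Q hQ R hR hQR).1
  have h2 : ∑ Q ∈ t, m.real Q ≤ m.real R := by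
    rw [← measureReal_biUnion_finset]
    · exact measureReal_mono (Set.iUnion₂_subset fun Q hQ => (Finset.mem_filter.1 hQ).2)
    · intro Q hQ S hS hne
      exact hP.disjoint _ Q (Finset.mem_filter.1 hQ).1 S (Finset.mem_filter.1 hS).1 hne
    · exact fun Q hQ => P.measurableSet _ Q (Finset.mem_filter.1 hQ).1
  rw [le_div_iff₀ hP.c₁_pos]
  nlinarith

open Classical in
-- Each coefficient is copied to at most `1/c₁` children, and each child has a single parent; taking
-- `p`-th roots gives the constant.
theorem eLevelNorm_parent_le (hP : P.IsGood c₁ c₂) (hp : 1 ≤ p) (y : Set I → ℝ≥0∞) (k : ℕ) :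
    eLevelNorm P p (fun Q => ∑ R ∈ P.level k, if Q ⊆ R then y R else 0) (k + 1) ≤
      ENNReal.ofReal (1 / c₁) ^ (1 / p) * eLevelNorm P p y k := by
  have hp0 : 0 < p := by linarith
  rw [eLevelNorm_finset_sum_of_disjoint P hp (P.level k) (fun R Q => if Q ⊆ R then y R else 0)]
  · rw [eLevelNorm, ← ENNReal.mul_rpow_of_nonneg _ _ (by positivity), Finset.mul_sum]
    gcongr with R hR
    rw [eLevelNorm_rpow P hp]
    have : ∀ Q ∈ P.level (k + 1), (if Q ⊆ R then y R else 0) ^ p =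
        if Q ⊆ R then y R ^ p else 0 := fun Q _ => by
      split_ifs
      · rfl
      · exact ENNReal.zero_rpow_of_pos hp0
    rw [Finset.sum_congr rfl this, ← Finset.sum_filter, Finset.sum_const, nsmul_eq_mul]
    gcongr
    rw [← ENNReal.ofReal_natCast]
    exact ENNReal.ofReal_le_ofReal (card_children_le hP hR)
  · intro Q hQ R hR S hS hR0 hS0
    obtain ⟨x, hx⟩ := Grid.IsGood.nonempty_of_mem_level hQ
    have hQR : Q ⊆ R := by
      by_contra h
      exact hR0 (if_neg h)
    have hQS : Q ⊆ S := by
      by_contra h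
      exact hS0 (if_neg h)
    exact hP.eq_of_inter hR hS (hQR hx) (hQS hx)

/-- The coefficients of the canonical series are controlled by those of any representation. -/
theorem IsRep.coefNorm_differences_le (hP : P.IsGood c₁ c₂) (hp : 1 ≤ p) (hq : 1 ≤ q)
    (hs : 0 < s) (hsp : s ≤ 1 / p)
    {d : Set I → ℂ} {f : I → ℂ} (hf : IsRep P p q s d f) {u : Set I → ℂ}
    (h0 : ∀ Q ∈ P.level 0, u Q = ((m.real Q ^ (1 / p - s) : ℝ) : ℂ) * ⨍ x in Q, f x ∂m)
    (h1 : ∀ k, ∀ Q ∈ P.level (k + 1), ∀ R ∈ P.level k, Q ⊆ R →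
      u Q = ((m.real Q ^ (1 / p - s) : ℝ) : ℂ) * (⨍ x in Q, f x ∂m - ⨍ x in R, f x ∂m)) :
    coefNorm P p q u ≤ (1 + ENNReal.ofReal (1 / c₁) ^ (1 / p)) *
      ((1 - ENNReal.ofReal (c₂ ^ s))⁻¹ * coefNorm P p q d) := by
  classical
  set σ := ENNReal.ofReal (c₂ ^ s) with hσdef
  have hσ : σ < 1 := hP.ofReal_rpow_lt_one hs
  set C := ENNReal.ofReal (1 / c₁) ^ (1 / p) with hC
  set F := levelSum P (souzaAtom m p s) d with hF
  have hlev : ∀ k, levelNorm P p u k ≤ (1 + C) * ∑' n, σ ^ n * levelNorm P p d (k + n) := by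
    intro k
    match k with
    | 0 =>
      have hle : ∀ Q ∈ P.level 0, ‖u Q‖ₑ ≤ ∑' n, ‖avgCoef m p s (F n) Q‖ₑ := by
        intro Q hQ
        rw [h0 Q hQ, ← (hf.hasSum_average hp ⟨0, hQ⟩).2.tsum_eq, ← tsum_mul_left]
        exact enorm_tsum_le _
      refine (eLevelNorm_mono P hp hle).trans ((eLevelNorm_tsum_le P hp
        (fun n Q => ‖avgCoef m p s (F n) Q‖ₑ) 0).trans ?_)
      refine le_trans (ENNReal.tsum_le_tsum fun n => ?_)
        (le_mul_of_one_le_left zero_le (self_le_add_right 1 C))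
      rw [zero_add]
      exact levelNorm_avgCoef_le hP hp hs (Nat.zero_le n) d
    | k + 1 =>
      have hle : ∀ Q ∈ P.level (k + 1), ‖u Q‖ₑ ≤ ∑' n, (‖avgCoef m p s (F (k + 1 + n)) Q‖ₑ +
          ∑ R ∈ P.level k, if Q ⊆ R then ‖avgCoef m p s (F (k + 1 + n)) R‖ₑ else 0) := by
        intro Q hQ
        obtain ⟨R, hR, hQR⟩ := hP.nested k Q hQ
        obtain ⟨x, hx⟩ := Grid.IsGood.nonempty_of_mem_level hQ
        obtain ⟨hQ1, hQ2⟩ := hf.hasSum_average hp ⟨k + 1, hQ⟩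
        obtain ⟨hR1, hR2⟩ := hf.hasSum_average hp ⟨k, hR⟩
        -- Blocks up to the parent's level are constant on `R ⊇ Q`, so they drop out of the
        -- difference of averages.
        have hz : ∀ j ∈ Finset.range (k + 1), ⨍ x in Q, F j x ∂m - ⨍ x in R, F j x ∂m = 0 := by
          intro j hj
          have hj' : j ≤ k := by simpa [Nat.lt_succ_iff] using hj
          rw [average_levelSum hP (hj'.trans k.le_succ) hQ d hx,
            average_levelSum hP hj' hR d (hQR hx), sub_self]
        rw [h1 k Q hQ R hR hQR, ← hQ2.tsum_eq, ← hR2.tsum_eq, ← hQ1.of_norm.tsum_sub hR1.of_norm,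
          ← (hQ1.of_norm.sub hR1.of_norm).sum_add_tsum_nat_add (k + 1), Finset.sum_eq_zero hz,
          zero_add, ← tsum_mul_left]
        refine (enorm_tsum_le _).trans (ENNReal.tsum_le_tsum fun n => ?_)
        rw [add_comm n, mul_sub]
        refine (enorm_sub_le).trans (add_le_add le_rfl ?_)
        refine le_trans ?_ (Finset.single_le_sum (f := fun R =>
          if Q ⊆ R then ‖avgCoef m p s (F (k + 1 + n)) R‖ₑ else 0) (fun _ _ => zero_le) hR)
        simp only [if_pos hQR, avgCoef, enorm_mul]
        gcongr
        rw [← ofReal_norm, ← ofReal_norm, Complex.norm_real, Complex.norm_real,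
          Real.norm_of_nonneg (by positivity), Real.norm_of_nonneg (by positivity)]
        -- The factor `|Q|^(1/p-s)` is replaced by that of the parent, using `s ≤ 1/p`.
        refine ENNReal.ofReal_le_ofReal (Real.rpow_le_rpow measureReal_nonneg
          (measureReal_mono hQR) (by linarith))
      refine (eLevelNorm_mono P hp hle).trans ((eLevelNorm_tsum_le P hp _ (k + 1)).trans ?_)
      rw [← ENNReal.tsum_mul_left]
      refine ENNReal.tsum_le_tsum fun n => ?_
      refine (eLevelNorm_add_le P hp _ _ (k + 1)).trans ?_
      rw [add_mul, one_mul]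
      refine add_le_add ?_ ?_
      · have := levelNorm_avgCoef_le hP hp hs (show k + 1 ≤ k + 1 + n by omega) d
        rwa [Nat.add_sub_cancel_left] at this
      · refine (eLevelNorm_parent_le hP hp _ k).trans ?_
        gcongr
        refine (levelNorm_avgCoef_le hP hp hs (show k ≤ k + 1 + n by omega) d).trans ?_
        exact mul_le_mul' (pow_le_pow_of_le_one zero_le hσ.le (by omega)) le_rfl
  refine (lqNorm_mono hlev).trans ?_
  rw [lqNorm_const_mul hq]
  gcongr
  exact lqNorm_young_up hq σ _

/-- Every good grid has a canonical family of functionals. -/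
theorem exists_isCanonicalFamily (hP : P.IsGood c₁ c₂) (hp : 1 ≤ p) (hq : 1 ≤ q)
    (hs : 0 < s) (hsp : s ≤ 1 / p) :
    ∃ (κ : Set I → Lp ℂ 1 m →L[ℂ] ℂ) (C : ℝ), IsCanonicalFamily P p q s κ C := by
  have hp0 : 0 < p := by linarith
  have hp1 : (1 : ℝ≥0∞) ≤ ENNReal.ofReal p := by simpa using hp
  obtain ⟨κ, h0, h1⟩ := exists_difference_functionals hP p s
  set K := (1 + ENNReal.ofReal (1 / c₁) ^ (1 / p)) * (1 - ENNReal.ofReal (c₂ ^ s))⁻¹ with hK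
  have hKtop : K < ∞ := by
    refine ENNReal.mul_lt_top (ENNReal.add_lt_top.2 ⟨by simp, ?_⟩)
      (inv_one_sub_lt_top (hP.ofReal_rpow_lt_one hs))
    exact ENNReal.rpow_lt_top_of_nonneg (by positivity) ENNReal.ofReal_ne_top
  have hK1 : 1 ≤ K := by
    refine one_le_mul (self_le_add_right 1 _) ?_
    rw [ENNReal.one_le_inv]
    exact tsub_le_self
  refine ⟨κ, K.toReal, ?_, fun f hf => ?_⟩
  · simpa using ENNReal.toReal_mono hKtop.ne hK1
  rw [ENNReal.ofReal_toReal hKtop.ne]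
  have hbd : ∀ d, IsRep P p q s d f → coefNorm P p q (fun Q => κ Q f) ≤ K * coefNorm P p q d := by
    intro d hd
    refine (hd.coefNorm_differences_le hP hp hq hs hsp (fun Q hQ => h0 Q hQ f)
      fun k Q hQ R hR hQR => h1 k Q hQ R hR hQR f).trans (le_of_eq ?_)
    rw [hK, mul_assoc]
  obtain ⟨d, hd⟩ := hf
  have hfin : coefNorm P p q (fun Q => κ Q f) < ∞ :=
    (hbd d hd).trans_lt (ENNReal.mul_lt_top hKtop hd.coef_lt_top)
  refine ⟨⟨hd.memLp, hfin, tsum_eLpNorm_levelSum_lt_top hP hp hq hs hfin, ?_⟩, ?_⟩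
  · exact hd.tendsto_average hP hp hq hs fun n Q hQ x hx =>
      sum_levelSum_eq_average hP (fun Q hQ => h0 Q hQ f)
        (fun k Q hQ R hR hQR => h1 k Q hQ R hR hQR f) n Q hQ x hx
  · unfold besovNorm
    simp only [iInf_subtype']
    have : Nonempty {c // IsRep P p q s c f} := ⟨⟨d, hd⟩⟩
    rw [ENNReal.mul_iInf fun h => absurd h hKtop.ne]
    exact le_iInf fun c => hbd c.1 c.2

end Canonical

/-! ### Completeness of the Besov space -/

namespace BesovSpace

variable {I : Type*} [MeasurableSpace I] {m : Measure I} {P : Grid m} {c₁ c₂ : ℝ}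
  {hP : P.IsGood c₁ c₂} {E : Exponents}

theorem memBesov (f : BesovSpace hP E) : MemBesov P E.p E.q E.s f.toL1 := f.2

theorem ext_ae {f g : BesovSpace hP E} (h : f.toL1 =ᵐ[m] g.toL1) : f = g :=
  Subtype.ext (Lp.ext h)

theorem toL1_add_ae (f g : BesovSpace hP E) :
    (f + g).toL1 =ᵐ[m] fun x => f.toL1 x + g.toL1 x := Lp.coeFn_add f.toL1 g.toL1

theorem toL1_sub_ae (f g : BesovSpace hP E) :
    (f - g).toL1 =ᵐ[m] fun x => f.toL1 x - g.toL1 x := Lp.coeFn_sub f.toL1 g.toL1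

theorem toL1_smul_ae (a : ℂ) (f : BesovSpace hP E) :
    (a • f).toL1 =ᵐ[m] fun x => a * f.toL1 x := Lp.coeFn_smul a f.toL1

theorem toL1_zero_ae : (0 : BesovSpace hP E).toL1 =ᵐ[m] fun _ => 0 := Lp.coeFn_zero ℂ 1 m

theorem toL1_sum_ae (u : ℕ → BesovSpace hP E) (n : ℕ) :
    (∑ i ∈ Finset.range n, u i).toL1 =ᵐ[m] fun x => ∑ i ∈ Finset.range n, (u i).toL1 x := by
  induction n with
  | zero => simpa using toL1_zero_ae
  | succ n ih =>
    rw [Finset.sum_range_succ]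
    filter_upwards [toL1_add_ae (∑ i ∈ Finset.range n, u i) (u n), ih] with x h1 h2
    rw [h1, h2, Finset.sum_range_succ]

variable [IsProbabilityMeasure m]

theorem exists_toL1_ae_eq (hP : P.IsGood c₁ c₂) (E : Exponents) {c : Set I → ℂ} {f : I → ℂ}
    (h : IsRep P E.p E.q E.s c f) : ∃ F : BesovSpace hP E, F.toL1 =ᵐ[m] f := by
  have h1 : MemLp f 1 m := h.memLp.mono_exponent (by simpa using E.one_le_p)
  have h2 := h1.coeFn_toLp
  exact ⟨⟨h1.toLp f, c, h.congr h2.symm⟩, h2⟩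

theorem enorm_eq (f : BesovSpace hP E) : ‖f‖ₑ = besovNorm P E.p E.q E.s f.toL1 := by
  rw [← ofReal_norm, norm_def, ENNReal.ofReal_toReal (besovNorm_lt_top f.memBesov).ne]

theorem enorm_le_of_isRep {f : BesovSpace hP E} {c : Set I → ℂ} {g : I → ℂ}
    (hfg : f.toL1 =ᵐ[m] g) (h : IsRep P E.p E.q E.s c g) : ‖f‖ₑ ≤ coefNorm P E.p E.q c := by
  rw [enorm_eq]
  exact iInf₂_le c (h.congr hfg.symm)

theorem exists_isRep_le (f : BesovSpace hP E) {η : ℝ≥0∞} (hη : η ≠ 0) :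
    ∃ c, IsRep P E.p E.q E.s c f.toL1 ∧ coefNorm P E.p E.q c ≤ ‖f‖ₑ + η := by
  have h : besovNorm P E.p E.q E.s f.toL1 < ‖f‖ₑ + η := by
    rw [enorm_eq]
    exact ENNReal.lt_add_right (besovNorm_lt_top f.memBesov).ne hη
  simp only [besovNorm, iInf_lt_iff] at h
  obtain ⟨c, hc, hlt⟩ := h
  exact ⟨c, hc, hlt.le⟩

/-- For an absolutely summable series, nearly optimal representations with summable errors are
superposed. The coefficients of the tail represent the remainder, whose norm is at most a tail of a
convergent series. -/
instance completeSpace (hP : P.IsGood c₁ c₂) (E : Exponents) : CompleteSpace (BesovSpace hP E) := by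
  refine NormedAddCommGroup.completeSpace_of_summable_imp_tendsto fun u hu => ?_
  obtain ⟨η, hη, hηs⟩ := ENNReal.exists_pos_sum_of_countable one_ne_zero ℕ
  choose c hc hle using fun n =>
    (u n).exists_isRep_le (η := (η n : ℝ≥0∞)) (by simpa using (hη n).ne')
  have hfin : ∑' n, coefNorm P E.p E.q (c n) ≠ ∞ := by
    refine ((ENNReal.tsum_le_tsum hle).trans_lt ?_).ne
    rw [ENNReal.tsum_add]
    exact ENNReal.add_lt_top.2 ⟨(tsum_enorm_ne_top_iff_summable_norm.2 hu).lt_top,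
      hηs.trans ENNReal.one_lt_top⟩
  have htail : ∀ N, (∀ᵐ x ∂m, Summable fun i => ‖(u (i + N)).toL1 x‖) ∧
      IsRep P E.p E.q E.s (fun Q => ∑' i, c (i + N) Q) (fun x => ∑' i, (u (i + N)).toL1 x) ∧
      coefNorm P E.p E.q (fun Q => ∑' i, c (i + N) Q) ≤
        ∑' i, coefNorm P E.p E.q (c (i + N)) := by
    intro N
    have hN : eCoefNorm P E.p E.q (fun Q => ∑' i, ‖c (i + N) Q‖ₑ) ≤
        ∑' i, coefNorm P E.p E.q (c (i + N)) :=
      eCoefNorm_tsum_le P E.one_le_p E.one_le_q fun i Q => ‖c (i + N) Q‖ₑ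
    have hlt : ∑' i, coefNorm P E.p E.q (c (i + N)) < ∞ :=
      (ENNReal.tsum_comp_le_tsum_of_injective (add_left_injective N) _).trans_lt hfin.lt_top
    obtain ⟨h1, h2, h3⟩ := isRep_superposition hP E.one_le_p E.one_le_q E.s_pos
      (fun i => hc (i + N)) (hN.trans_lt hlt)
    exact ⟨h1, h2, h3.trans hN⟩
  -- The case `N = 0` gives the sum; general `N` estimates the remainders.
  obtain ⟨F, hF⟩ := exists_toL1_ae_eq hP E (htail 0).2.1
  refine ⟨F, ?_⟩
  rw [tendsto_iff_edist_tendsto_0]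
  refine tendsto_of_tendsto_of_tendsto_of_le_of_le tendsto_const_nhds
    (ENNReal.tendsto_sum_nat_add _ hfin) (fun _ => zero_le) fun N => ?_
  rw [edist_comm, edist_eq_enorm_sub]
  refine (enorm_le_of_isRep ?_ (htail N).2.1).trans (htail N).2.2
  filter_upwards [toL1_sub_ae F (∑ i ∈ Finset.range N, u i), toL1_sum_ae u N, hF, (htail 0).1]
    with x h1 h2 h3 h4
  simp only [add_zero] at h3 h4
  rw [h1, h2, h3, sub_eq_iff_eq_add', h4.of_norm.sum_add_tsum_nat_add]

end BesovSpace

/-! ## Perturbations by operators of finite rank -/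

section Fredholm

variable {V : Type*} [NormedAddCommGroup V] [NormedSpace ℂ V]

open LinearMap.FiniteRangeSetoid in
-- A Neumann series inverts `z - A`. Since `z - T` differs from it by the finite-rank `K`, the same
-- inverse is a quasi-inverse of `z - T`.
theorem isFredholm_smul_id_sub [CompleteSpace V] {T A K : V →L[ℂ] V} (hT : T = K + A)
    (hK : FiniteDimensional ℂ K.range) {z : ℂ} (hz : ‖A‖ < ‖z‖) :
    (z • ContinuousLinearMap.id ℂ V - T).IsFredholm := by
  have hz0 : z ≠ 0 := norm_pos_iff.1 ((norm_nonneg A).trans_lt hz)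
  have h1 : IsUnit (1 - z⁻¹ • A) := by
    refine isUnit_one_sub_of_norm_lt_one ?_
    rw [norm_smul, norm_inv, inv_mul_lt_iff₀ (norm_pos_iff.2 hz0), mul_one]
    exact hz
  obtain ⟨w, hw⟩ := h1
  have hwA : z • ContinuousLinearMap.id ℂ V - A = z • (w : V →L[ℂ] V) := by
    rw [hw, smul_sub, smul_smul, mul_inv_cancel₀ hz0, one_smul]
    rfl
  set u : V →L[ℂ] V := z • (w : V →L[ℂ] V) with hu
  set v : V →L[ℂ] V := z⁻¹ • ((w⁻¹ : (V →L[ℂ] V)ˣ) : V →L[ℂ] V) with hv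
  have hvu : v * u = 1 := by
    rw [hu, hv, smul_mul_smul_comm, inv_mul_cancel₀ hz0, one_smul, Units.inv_mul]
  have huv : u * v = 1 := by
    rw [hu, hv, smul_mul_smul_comm, mul_inv_cancel₀ hz0, one_smul, Units.mul_inv]
  have hq : (v : V →ₗ[ℂ] V).IsQuasiInverse (u : V →ₗ[ℂ] V) := by
    constructor
    · have h2 : (v : V →ₗ[ℂ] V) ∘ₗ (u : V →ₗ[ℂ] V) = LinearMap.id :=
        congrArg (fun B : V →L[ℂ] V => (B : V →ₗ[ℂ] V)) hvu
      unfold LinearMap.IsLeftQuasiInverse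
      rw [h2]
    · have h2 : (u : V →ₗ[ℂ] V) ∘ₗ (v : V →ₗ[ℂ] V) = LinearMap.id :=
        congrArg (fun B : V →L[ℂ] V => (B : V →ₗ[ℂ] V)) huv
      unfold LinearMap.IsRightQuasiInverse
      rw [h2]
  refine ContinuousLinearMap.IsFredholm.of_isQuasiInverse (v := v) (hq.congr (Setoid.refl _) ?_)
  rw [equiv_iff_hasFiniteRange]
  have h3 : ((z • ContinuousLinearMap.id ℂ V - T : V →L[ℂ] V) : V →ₗ[ℂ] V) - (u : V →ₗ[ℂ] V) =
      -(K : V →ₗ[ℂ] V) := by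
    rw [← hwA, hT]
    ext x
    simp
  rw [h3]
  refine LinearMap.HasFiniteRange.neg (LinearMap.hasFiniteRange_iff_range.2 ?_)
  exact Module.Finite.iff_fg.1 hK

theorem essentialSpectralRadius_le [CompleteSpace V] {T A K : V →L[ℂ] V} (hT : T = K + A)
    (hK : FiniteDimensional ℂ K.range) : essentialSpectralRadius T ≤ ENNReal.ofReal ‖A‖ := by
  refine iSup₂_le fun z hz => ?_
  by_contra! hlt
  rw [← ofReal_norm] at hlt
  replace hlt := (ENNReal.ofReal_lt_ofReal_iff_of_nonneg (norm_nonneg A)).1 hlt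
  exact hz (isFredholm_smul_id_sub hT hK hlt)

end Fredholm

/-! ### Operators defined through representations -/

section Operators

variable {I : Type*} [MeasurableSpace I] {m : Measure I} {P : Grid m} {c₁ c₂ : ℝ}

theorem IsRep.ae_unique {p s : ℝ} {q : ℝ≥0∞} (hp : 1 ≤ p) {c : Set I → ℂ} {f g : I → ℂ}
    (hf : IsRep P p q s c f) (hg : IsRep P p q s c g) : f =ᵐ[m] g :=
  (hf.ae_eq hp).2.trans (hg.ae_eq hp).2.symm

theorem coefNorm_indicator_le (P : Grid m) {p : ℝ} (hp : 1 ≤ p) (q : ℝ≥0∞) (S : Set (Set I))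
    (c : Set I → ℂ) : coefNorm P p q (S.indicator c) ≤ coefNorm P p q c :=
  eCoefNorm_mono P hp q fun Q _ => by
    by_cases h : Q ∈ S <;> simp [h]

variable [IsProbabilityMeasure m] {hP : P.IsGood c₁ c₂} {E : Exponents}

theorem BesovSpace.opNorm_le {T : BesovSpace hP E →L[ℂ] BesovSpace hP E} {K : ℝ} (hK : 0 ≤ K)
    (h : ∀ f, ‖T f‖ₑ ≤ ENNReal.ofReal K * ‖f‖ₑ) : ‖T‖ ≤ K := by
  refine T.opNorm_le_bound hK fun f => ?_
  have := h f
  rw [← ofReal_norm, ← ofReal_norm, ← ENNReal.ofReal_mul hK] at this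
  exact (ENNReal.ofReal_le_ofReal_iff (by positivity)).1 this

/-- A linear operation on functions that is bounded in terms of representations. -/
theorem BesovSpace.exists_operator {G : BesovSpace hP E → I → ℂ} {K : ℝ} (hK : 0 ≤ K)
    (hadd : ∀ f g, G (f + g) =ᵐ[m] fun x => G f x + G g x)
    (hsmul : ∀ (a : ℂ) f, G (a • f) =ᵐ[m] fun x => a * G f x)
    (hG : ∀ f, ∃ z, IsRep P E.p E.q E.s z (G f) ∧
      coefNorm P E.p E.q z ≤ ENNReal.ofReal K * ‖f‖ₑ) :
    ∃ T : BesovSpace hP E →L[ℂ] BesovSpace hP E, (∀ f, (T f).toL1 =ᵐ[m] G f) ∧ ‖T‖ ≤ K := by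
  choose z hz hzK using hG
  choose T hT using fun f => BesovSpace.exists_toL1_ae_eq hP E (hz f)
  have hbound : ∀ f, ‖T f‖ₑ ≤ ENNReal.ofReal K * ‖f‖ₑ := fun f =>
    (BesovSpace.enorm_le_of_isRep (hT f) (hz f)).trans (hzK f)
  let L : BesovSpace hP E →ₗ[ℂ] BesovSpace hP E :=
    { toFun := T
      map_add' := fun f g => BesovSpace.ext_ae <| by
        filter_upwards [hT (f + g), hadd f g, BesovSpace.toL1_add_ae (T f) (T g), hT f, hT g]
          with x h1 h2 h3 h4 h5
        rw [h1, h2, h3, h4, h5]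
      map_smul' := fun a f => BesovSpace.ext_ae <| by
        filter_upwards [hT (a • f), hsmul a f, BesovSpace.toL1_smul_ae a (T f), hT f]
          with x h1 h2 h3 h4
        rw [RingHom.id_apply, h1, h2, h3, h4] }
  let L' : BesovSpace hP E →L[ℂ] BesovSpace hP E := L.mkContinuous K fun f => by
    have := hbound f
    rw [← ofReal_norm, ← ofReal_norm, ← ENNReal.ofReal_mul hK] at this
    exact (ENNReal.ofReal_le_ofReal_iff (by positivity)).1 this
  exact ⟨L', hT, BesovSpace.opNorm_le hK hbound⟩

/-- The part of the canonical representation with coefficients in `S`. -/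
theorem exists_canonical_projection {κ : Set I → Lp ℂ 1 m →L[ℂ] ℂ} {CGC : ℝ}
    (hκ : IsCanonicalFamily P E.p E.q E.s κ CGC) (S : Set (Set I)) :
    ∃ π : BesovSpace hP E →L[ℂ] BesovSpace hP E,
      ∀ f, IsRep P E.p E.q E.s (S.indicator fun Q => κ Q f.toL1) (π f).toL1 := by
  have hle : ∀ f : BesovSpace hP E, coefNorm P E.p E.q (S.indicator fun Q => κ Q f.toL1) ≤
      ENNReal.ofReal CGC * ‖f‖ₑ := fun f => by
    rw [BesovSpace.enorm_eq]
    exact (coefNorm_indicator_le P E.one_le_p E.q S _).trans (hκ.2 f.toL1 f.memBesov).2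
  have hrep : ∀ f : BesovSpace hP E, IsRep P E.p E.q E.s (S.indicator fun Q => κ Q f.toL1)
      fun x => ∑' k, levelSum P (souzaAtom m E.p E.s) (S.indicator fun Q => κ Q f.toL1) k x :=
    fun f => isRep_of_ae_eq hP E.one_le_p E.one_le_q E.s_pos
      ((hle f).trans_lt (ENNReal.mul_lt_top ENNReal.ofReal_lt_top enorm_lt_top)) ae_eq_rfl
  suffices h : ∃ π : BesovSpace hP E →L[ℂ] BesovSpace hP E, (∀ f, (π f).toL1 =ᵐ[m] fun x =>
      ∑' k, levelSum P (souzaAtom m E.p E.s) (S.indicator fun Q => κ Q f.toL1) k x) ∧ ‖π‖ ≤ CGC by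
    obtain ⟨π, hπ, -⟩ := h
    exact ⟨π, fun f => (hrep f).congr (hπ f).symm⟩
  refine BesovSpace.exists_operator (zero_le_one.trans hκ.1) (fun f g => ?_) (fun a f => ?_)
    fun f => ⟨_, hrep f, hle f⟩
  · refine IsRep.ae_unique E.one_le_p (hrep (f + g)) ?_
    have h : (S.indicator fun Q => κ Q (f + g).toL1) =
        (S.indicator fun Q => κ Q f.toL1) + S.indicator fun Q => κ Q g.toL1 := by
      rw [← Set.indicator_add']
      congr 1
      funext Q
      exact map_add (κ Q) f.toL1 g.toL1
    rw [h]
    exact (hrep f).add E.one_le_p E.one_le_q (hrep g)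
  · refine IsRep.ae_unique E.one_le_p (hrep (a • f)) ?_
    have h : (S.indicator fun Q => κ Q (a • f).toL1) = a • S.indicator fun Q => κ Q f.toL1 := by
      funext Q
      by_cases hQ : Q ∈ S
      · simp only [Pi.smul_apply, Set.indicator_of_mem hQ]
        exact map_smul (κ Q) a f.toL1
      · simp [hQ]
    rw [h]
    exact (hrep f).smul E.one_le_p E.one_le_q a

/-- The function `π f` is determined by the finitely many numbers `κ Q f`, `Q ∈ S`: if they vanish,
so does `π f`. Hence the kernel of `T ∘ π` contains a subspace of finite codimension. -/
theorem finiteDimensional_range_of_isRep_indicator {κ : Set I → Lp ℂ 1 m →L[ℂ] ℂ}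
    {S : Finset (Set I)} {π : BesovSpace hP E →L[ℂ] BesovSpace hP E}
    (hπ : ∀ f, IsRep P E.p E.q E.s ((S : Set (Set I)).indicator fun Q => κ Q f.toL1) (π f).toL1)
    (T : BesovSpace hP E →L[ℂ] BesovSpace hP E) : FiniteDimensional ℂ (T ∘L π).range := by
  let L : BesovSpace hP E →ₗ[ℂ] (S → ℂ) :=
    { toFun := fun f Q => κ Q f.toL1
      map_add' := fun f g => funext fun Q => map_add (κ Q) f.toL1 g.toL1
      map_smul' := fun a f => funext fun Q => map_smul (κ Q) a f.toL1 }
  have hker : LinearMap.ker L ≤ LinearMap.ker ((T ∘L π : BesovSpace hP E →L[ℂ] BesovSpace hP E) :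
      BesovSpace hP E →ₗ[ℂ] BesovSpace hP E) := by
    intro f hf
    have h0 : ((S : Set (Set I)).indicator fun Q => κ Q f.toL1) = 0 := by
      funext Q
      by_cases hQ : Q ∈ S
      · have := congrFun (LinearMap.mem_ker.1 hf) ⟨Q, hQ⟩
        exact (Set.indicator_of_mem (Finset.mem_coe.2 hQ) _).trans this
      · simp [hQ]
    have h1 := hπ f
    rw [h0] at h1
    have h2 : π f = 0 := BesovSpace.ext_ae
      (((h1.ae_unique E.one_le_p (isRep_zero P E.one_le_p E.one_le_q))).trans
        BesovSpace.toL1_zero_ae.symm)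
    rw [LinearMap.mem_ker]
    change T (π f) = 0
    rw [h2, map_zero]
  have h3 : (LinearMap.ker L).CoFG := LinearMap.ker_coFG_iff_hasFiniteRange.2 .of_isNoetherian_rng
  exact Module.Finite.iff_fg.2 <| LinearMap.hasFiniteRange_iff_range.1
    (LinearMap.ker_coFG_iff_hasFiniteRange.1 (h3.of_le hker))

end Operators

/-! ## The transfer operator -/

namespace Dynamics

variable {I : Type*} [MeasurableSpace I] {m : Measure I} {Λ : Type*}

theorem term_add (D : Dynamics (J := I) m Λ) (r : Λ) (f g : I → ℂ) (x : I) :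
    D.term r (fun y => f y + g y) x = D.term r f x + D.term r g x := by
  by_cases hx : x ∈ D.Jset r
  · simp only [D.term_apply r _ hx, mul_add]
  · simp [D.term_zero r hx]

theorem term_const_mul (D : Dynamics (J := I) m Λ) (r : Λ) (a : ℂ) (f : I → ℂ) (x : I) :
    D.term r (fun y => a * f y) x = a * D.term r f x := by
  by_cases hx : x ∈ D.Jset r
  · simp only [D.term_apply r _ hx]
    ring
  · simp [D.term_zero r hx]

variable [Countable Λ] {D : Dynamics (J := I) m Λ} {P : Grid m} {E : Exponents}

theorem IsAdmissible.ae_forall_term_eq (hD : D.IsAdmissible E P P) {f g : I → ℂ}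
    (h : f =ᵐ[m] g) : ∀ᵐ x ∂m, ∀ r, D.term r f x = D.term r g x :=
  ae_all_iff.2 fun r => hD.term_congr r h

theorem IsAdmissible.transfer_const_mul_ae (hD : D.IsAdmissible E P P) {f g : I → ℂ} {a : ℂ}
    (h : g =ᵐ[m] fun x => a * f x) : D.transfer g =ᵐ[m] fun x => a * D.transfer f x := by
  filter_upwards [hD.ae_forall_term_eq h] with x hx
  simp only [transfer, hx, term_const_mul, tsum_mul_left]

/-- Additivity of `Φ` requires convergence of both series, because a divergent `tsum` has the
default value 0. -/
theorem IsAdmissible.transfer_add_ae (hD : D.IsAdmissible E P P) {f g k : I → ℂ}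
    (h : k =ᵐ[m] fun x => f x + g x) (hf : ∀ᵐ x ∂m, Summable fun r => ‖D.term r f x‖)
    (hg : ∀ᵐ x ∂m, Summable fun r => ‖D.term r g x‖) :
    (∀ᵐ x ∂m, Summable fun r => ‖D.term r k x‖) ∧
      D.transfer k =ᵐ[m] fun x => D.transfer f x + D.transfer g x := by
  have hk := hD.ae_forall_term_eq h
  constructor
  · filter_upwards [hk, hf, hg] with x h1 h2 h3
    simp only [h1, term_add]
    exact (h2.add h3).of_nonneg_of_le (fun _ => norm_nonneg _) fun _ => norm_add_le _ _
  · filter_upwards [hk, hf, hg] with x h1 h2 h3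
    simp only [transfer, h1, term_add]
    exact h2.of_norm.tsum_add h3.of_norm

end Dynamics

section

variable {I : Type*} [MeasurableSpace I] {m : Measure I} [IsProbabilityMeasure m] {P : Grid m}
  {c₁ c₂ : ℝ} {hP : P.IsGood c₁ c₂} {E : Exponents} {Λ : Type*} [Countable Λ]
  {D : Dynamics (J := I) m Λ}

/-- The transfer operator on a part of the canonical representation that has a regular slicing. -/
theorem exists_transfer_rep_of_hasRegularSlicing {κ : Set I → Lp ℂ 1 m →L[ℂ] ℂ} {CGC CGBS C : ℝ}
    (hκ : IsCanonicalFamily P E.p E.q E.s κ CGC)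
    (hconv : IsConversionConstant P E.p E.q E.s E.β CGBS) (hD : D.IsAdmissible E P P) (hC : 0 ≤ C)
    {S : Set (Set I)} {π : BesovSpace hP E →L[ℂ] BesovSpace hP E}
    (hπ : ∀ f, IsRep P E.p E.q E.s (S.indicator fun Q => κ Q f.toL1) (π f).toL1)
    {f : BesovSpace hP E}
    (hS : D.HasRegularSlicing E P P C (S.indicator fun Q => κ Q f.toL1)) :
    (∀ᵐ x ∂m, Summable fun r => ‖D.term r (π f).toL1 x‖) ∧
    ∃ z, IsRep P E.p E.q E.s z (D.transfer (π f).toL1) ∧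
      coefNorm P E.p E.q z ≤ ENNReal.ofReal (CGBS * D.CD E * C * CGC) * ‖f‖ₑ := by
  obtain ⟨h1, z, hz, hle⟩ := hD.transfer_bound hP hconv (hπ f) hS
  refine ⟨h1, z, hz, hle.trans ?_⟩
  have hCD := hD.CD_nonneg
  have hB := hconv.1
  rw [ENNReal.ofReal_mul (by positivity), ENNReal.ofReal_mul (by positivity),
    ENNReal.ofReal_mul hB]
  simp only [mul_assoc]
  gcongr
  rw [BesovSpace.enorm_eq]
  exact (coefNorm_indicator_le P E.one_le_p E.q S _).trans (hκ.2 f.toL1 f.memBesov).2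

/-- The bounds for `T ∘ π` are read off the representation of `Φ (π f)` in terms of `‖f‖`. Passing
through `‖T‖ ‖π‖` would lose constants and would not separate `CFR` from `CES`. -/
theorem exists_transfer_operator {κ : Set I → Lp ℂ 1 m →L[ℂ] ℂ} {CGC CGBS CFR CES : ℝ}
    (hκ : IsCanonicalFamily P E.p E.q E.s κ CGC)
    (hconv : IsConversionConstant P E.p E.q E.s E.β CGBS) (hD : D.IsAdmissible E P P)
    (hCFR : 0 ≤ CFR) (hCES : 0 ≤ CES) {S : Set (Set I)}
    (hS : ∀ f ∈ besovSubmodule P E.p E.q E.s E.one_le_p E.one_le_q, ∀ d : Set I → ℂ,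
      IsRep P E.p E.q E.s d f →
        D.HasRegularSlicing E P P CES (Sᶜ.indicator d) ∧
        D.HasRegularSlicing E P P CFR (S.indicator d))
    {πF πE : BesovSpace hP E →L[ℂ] BesovSpace hP E}
    (hF : ∀ f, IsRep P E.p E.q E.s (S.indicator fun Q => κ Q f.toL1) (πF f).toL1)
    (hE : ∀ f, IsRep P E.p E.q E.s (Sᶜ.indicator fun Q => κ Q f.toL1) (πE f).toL1)
    (hid : ∀ f, πF f + πE f = f) :
    ∃ T : BesovSpace hP E →L[ℂ] BesovSpace hP E,
      (∀ f : BesovSpace hP E, (∀ᵐ x ∂m, Summable fun r => ‖D.term r f.toL1 x‖) ∧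
        (T f).toL1 =ᵐ[m] D.transfer f.toL1) ∧
      ‖T ∘L πF‖ ≤ CGBS * D.CD E * CFR * CGC ∧ ‖T ∘L πE‖ ≤ CGBS * D.CD E * CES * CGC := by
  have hCD := hD.CD_nonneg
  have hB := hconv.1
  have hG : 0 ≤ CGC := zero_le_one.trans hκ.1
  have hslice := fun f : BesovSpace hP E =>
    hS f.toL1 f.memBesov _ (hκ.2 f.toL1 f.memBesov).1
  have h1 := fun f => exists_transfer_rep_of_hasRegularSlicing hκ hconv hD hCFR hF (hslice f).2
  have h2 := fun f => exists_transfer_rep_of_hasRegularSlicing hκ hconv hD hCES hE (hslice f).1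
  have hsum : ∀ f : BesovSpace hP E, (∀ᵐ x ∂m, Summable fun r => ‖D.term r f.toL1 x‖) ∧
      D.transfer f.toL1 =ᵐ[m]
        fun x => D.transfer (πF f).toL1 x + D.transfer (πE f).toL1 x := fun f => by
    refine hD.transfer_add_ae ?_ (h1 f).1 (h2 f).1
    conv_lhs => rw [← hid f]
    exact BesovSpace.toL1_add_ae (πF f) (πE f)
  -- Adding the representations of the two parts shows that `Φ f` lies in the space and depends
  -- boundedly on `f`.
  have hop : ∃ T : BesovSpace hP E →L[ℂ] BesovSpace hP E,
      (∀ f, (T f).toL1 =ᵐ[m] D.transfer f.toL1) ∧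
        ‖T‖ ≤ CGBS * D.CD E * CFR * CGC + CGBS * D.CD E * CES * CGC := by
    refine BesovSpace.exists_operator (by positivity) (fun f g => ?_) (fun a f => ?_) fun f => ?_
    · exact (hD.transfer_add_ae (BesovSpace.toL1_add_ae f g) (hsum f).1 (hsum g).1).2
    · exact hD.transfer_const_mul_ae (BesovSpace.toL1_smul_ae a f)
    · obtain ⟨-, z, hz, hzle⟩ := h1 f
      obtain ⟨-, w, hw, hwle⟩ := h2 f
      refine ⟨z + w, (hz.add E.one_le_p E.one_le_q hw).congr (hsum f).2.symm, ?_⟩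
      rw [ENNReal.ofReal_add (by positivity) (by positivity), add_mul]
      exact (coefNorm_add_le P E.one_le_p E.one_le_q z w).trans (add_le_add hzle hwle)
  obtain ⟨T, hT, -⟩ := hop
  refine ⟨T, fun f => ⟨(hsum f).1, hT f⟩, ?_, ?_⟩
  · refine BesovSpace.opNorm_le (by positivity) fun f => ?_
    obtain ⟨-, z, hz, hzle⟩ := h1 f
    exact (BesovSpace.enorm_le_of_isRep (hT (πF f)) hz).trans hzle
  · refine BesovSpace.opNorm_le (by positivity) fun f => ?_
    obtain ⟨-, z, hz, hzle⟩ := h2 f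
    exact (BesovSpace.enorm_le_of_isRep (hT (πE f)) hz).trans hzle

end

end BesovTransfer

end

open BesovTransfer
theorem mainTheorem2 {I : Type*} [MeasurableSpace I] (m : MeasureTheory.Measure I)
    [MeasureTheory.IsProbabilityMeasure m] (P : BesovTransfer.Grid m) (c₁ c₂ : ℝ)
    (hP : P.IsGood c₁ c₂) (E : BesovTransfer.Exponents) :
    -- canonical functionals and the two constants of the grid exist
    (∃ (κ : Set I → MeasureTheory.Lp ℂ 1 m →L[ℂ] ℂ) (CGC : ℝ),
      BesovTransfer.IsCanonicalFamily P E.p E.q E.s κ CGC) ∧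
    (∃ CGBS : ℝ, BesovTransfer.IsConversionConstant P E.p E.q E.s E.β CGBS) ∧
    -- and for any choice of them the following holds
    ∀ (κ : Set I → MeasureTheory.Lp ℂ 1 m →L[ℂ] ℂ) (CGC CGBS : ℝ),
      BesovTransfer.IsCanonicalFamily P E.p E.q E.s κ CGC →
      BesovTransfer.IsConversionConstant P E.p E.q E.s E.β CGBS →
      ∀ (Λ : Set ℕ) (D : BesovTransfer.Dynamics (J := I) m Λ),
        D.IsAdmissible E P P →
        D.IsIntegrable m E →
        ∀ (P' : Finset (Set I)) (CFR CES : ℝ),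
          D.HasEssentialSlicing E P P
            (BesovTransfer.besovSubmodule P E.p E.q E.s E.one_le_p E.one_le_q) P' CFR CES →
          ∃ T πF πE : BesovTransfer.BesovSpace hP E →L[ℂ] BesovTransfer.BesovSpace hP E,
            -- `T` is the transfer transformation
            (∀ f : BesovTransfer.BesovSpace hP E,
              (∀ᵐ x ∂m, Summable fun r => ‖D.term r f.toL1 x‖) ∧
                (T f).toL1 =ᵐ[m] D.transfer f.toL1) ∧
            -- `πF`, `πE` keep the part of the canonical representation in, resp. outside, `P'`
            (∀ f : BesovTransfer.BesovSpace hP E, BesovTransfer.IsRep P E.p E.q E.s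
              ((P' : Set (Set I)).indicator fun Q => κ Q f.toL1) (πF f).toL1) ∧
            (∀ f : BesovTransfer.BesovSpace hP E, BesovTransfer.IsRep P E.p E.q E.s
              ((P' : Set (Set I))ᶜ.indicator fun Q => κ Q f.toL1) (πE f).toL1) ∧
            πF + πE = ContinuousLinearMap.id ℂ _ ∧
            -- norm and essential spectral radius
            ‖T‖ ≤ CGBS * D.CD E * (CFR + CES) * CGC ∧
            BesovTransfer.essentialSpectralRadius T ≤
              ENNReal.ofReal (CGBS * D.CD E * CES * CGC) ∧
            -- the splitting
            FiniteDimensional ℂ (T ∘L πF).range ∧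
            ‖T ∘L πF‖ ≤ CGBS * D.CD E * CFR * CGC ∧
            ‖T ∘L πE‖ ≤ CGBS * D.CD E * CES * CGC := by
  have hp := E.one_le_p
  have hsp : E.s ≤ 1 / E.p := by linarith [E.s_add_ε_le, E.ε_pos]
  refine ⟨exists_isCanonicalFamily hP hp E.one_le_q E.s_pos hsp,
    exists_isConversionConstant hP hp E.one_le_q E.s_pos E.s_lt_β, ?_⟩
  intro κ CGC CGBS hκ hconv Λ D hD _ P' CFR CES hS
  obtain ⟨-, hCFR, hCES, hS⟩ := hS
  obtain ⟨πF, hF⟩ := exists_canonical_projection (hP := hP) hκ (P' : Set (Set I))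
  obtain ⟨πE, hE⟩ := exists_canonical_projection (hP := hP) hκ (P' : Set (Set I))ᶜ
  -- The coefficients of the two parts add up to the canonical ones, and coefficients determine the
  -- function.
  have hid : ∀ f : BesovSpace hP E, πF f + πE f = f := fun f => BesovSpace.ext_ae <| by
    have h := (hF f).add hp E.one_le_q (hE f)
    rw [Set.indicator_self_add_compl] at h
    exact (BesovSpace.toL1_add_ae (πF f) (πE f)).trans
      (h.ae_unique hp (hκ.2 f.toL1 f.memBesov).1)
  obtain ⟨T, hT, hTF, hTE⟩ := exists_transfer_operator hκ hconv hD hCFR hCES hS hF hE hid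
  have hsplit : T = T ∘L πF + T ∘L πE := by
    ext1 f
    change T f = T (πF f) + T (πE f)
    rw [← map_add, hid]
  refine ⟨T, πF, πE, hT, hF, hE, ContinuousLinearMap.ext hid, ?_, ?_,
    finiteDimensional_range_of_isRep_indicator hF T, hTF, hTE⟩
  · rw [hsplit]
    refine (norm_add_le _ _).trans ((add_le_add hTF hTE).trans (le_of_eq ?_))
    ring
  · exact (essentialSpectralRadius_le hsplit
      (finiteDimensional_range_of_isRep_indicator hF T)).trans (ENNReal.ofReal_le_ofReal hTE)
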